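/- Let $X$ be a real or complex Banach space and let $p\in[1,\infty)$. A strongly continuous exponentially bounded evolution family on $X$ is a family $\{U(t,\tau)\}_{t\ge\tau}$, $t,\tau\in\mathbb R$, of bounded linear operators on $X$ such that $(t,\tau)\mapsto U(t,\tau)x$ is continuous on $\{t\ge\tau\}$ for each $x\in X$; $\|U(t,\tau)\|\le Ce^{\omega(t-\tau)}$ for all $t\ge\tau$, with some constants $C,\omega\in\mathbb R$; $U(t,t)=I$; and $U(t,\tau)=U(t,s)U(s,\tau)$ for $t\ge s\ge\tau$. Let $\mathbf G_U$ denote the generator of its evolution semigroup $(T^hu)(t)=U(t,t-h)u(t-h)$, $h\ge 0$, on $L_p(\mathbb R;X)$; that is, $u\in\operatorname{dom}\mathbf G_U$ and $\mathbf G_Uu=f$ if and only if $h^{-1}(T^hu-u)\to f$ in $L_p(\mathbb R;X)$ as $h\downarrow0$. Let $A(t)$, $t\in\mathbb R$, be (generally unbounded) linear operators in $X$. For $\tau\le T$ and $f\in L_p([\tau,T];X)$, a function $u\in W^1_p([\tau,T];X)$ is called a regular solution of $u'=A(t)u+f$ on $[\tau,T]$ if $u(t)\in\operatorname{dom}A(t)$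 for all $t\in[\tau,T]$ and $u'(t)=A(t)u(t)+f(t)$ for almost all $t\in[\tau,T]$. The equation $u'(t)=A(t)u(t)$, $t\in\mathbb R$, is called well-posed with propagator $U$ if $U$ is a strongly continuous exponentially bounded evolution family and 1. there is a dense subspace $\mathcal D\subset X$ with $\operatorname{dom}A(t)=\mathcal D$ for all $t\in\mathbb R$; 2. (existence) for all $\tau\in\mathbb R$, $x\in\mathcal D$ and $T\ge\tau$, the function $t\mapsto U(t,\tau)x$ is a regular solution of $u'=A(t)u$ on $[\tau,T]$; 3. (uniqueness and continuous dependence on the data) for all $\tau\le T$ there is a constant $C$ such that every regular solution $u$ of $u'=A(t)u+f$ on $[\tau,T]$, with any $f\in L_p([\tau,T];X)$, satisfies $\sup_{t\in[\tau,T]}\|u(t)\|\le C\big(\|u(\tau)\|+\|f\|_{L_p([\tau,T];X)}\big)$. A closed operator $\mathbf G$ is called Fredholm if $\dim\ker\mathbf G<\infty$ and $\operatorname{Im}\mathbf G$ is closed and of finite codimension; then $\operatorname{ind}\mathbf G=\dim\ker\mathbf G-\operatorname{codim}\operatorname{Im}\mathbf G$. **Proposition.** Suppose that the equation $u'(t)=A(t)u(t)$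 is well-posed with propagator $U_A$, and that $B:\mathbb R\to\mathcal L(X)$ satisfies: - $(P_1)$ $t\mapsto B(t)x$ is continuous for each $x\in X$; - $(P_2)$ $\sup_{t\in\mathbb R}\|B(t)\|<\infty$; - $(P_3)$ the equation $u'(t)=[A(t)+B(t)]u(t)$ is well-posed with propagator $U_{A+B}$; - $(P_4)$ $\lim_{|t|\to\infty}\|B(t)\|=0$; - $(P_5)$ $B(t)$ is a compact operator for each $t\in\mathbb R$. Let $\mathbf G_A$ and $\mathbf G_{A+B}$ be the generators of the evolution semigroups on $L_p(\mathbb R;X)$ induced by $U_A$ and $U_{A+B}$. Then $\mathbf G_A$ is Fredholm if and only if $\mathbf G_{A+B}$ is Fredholm, and in this case $\operatorname{ind}\mathbf G_A=\operatorname{ind}\mathbf G_{A+B}$. -/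

import Mathlib

open MeasureTheory Filter Topology Set
open scoped NNReal ENNReal

/-- A strongly continuous, exponentially bounded evolution family `U t τ`, `t ≥ τ`, of bounded
operators on `X`.  The values `U t τ` with `t < τ` are never used. -/
structure EvolutionFamily (𝕜 : Type*) (X : Type*) [RCLike 𝕜] [NormedAddCommGroup X]
    [NormedSpace 𝕜 X] where
  toFun : ℝ → ℝ → X →L[𝕜] X
  continuousOn_apply : ∀ x : X,
    ContinuousOn (fun q : ℝ × ℝ => toFun q.1 q.2 x) {q | q.2 ≤ q.1}
  exists_exp_bound : ∃ ω C : ℝ, ∀ t τ : ℝ, τ ≤ t → ‖toFun t τ‖ ≤ C * Real.exp (ω * (t - τ))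
  self_eq_id : ∀ t : ℝ, toFun t t = ContinuousLinearMap.id 𝕜 X
  comp_eq : ∀ t s τ : ℝ, τ ≤ s → s ≤ t → toFun t τ = (toFun t s).comp (toFun s τ)

namespace EvolutionFamily

variable {𝕜 : Type*} {X : Type*} [RCLike 𝕜] [NormedAddCommGroup X] [NormedSpace 𝕜 X]

instance : CoeFun (EvolutionFamily 𝕜 X) (fun _ => ℝ → ℝ → X →L[𝕜] X) := ⟨toFun⟩

theorem exists_bound_shift (U : EvolutionFamily 𝕜 X) (h : ℝ≥0) :
    ∃ K : ℝ≥0, ∀ t : ℝ, ‖U t (t - h)‖ ≤ K := by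
  obtain ⟨ω, C, hC⟩ := U.exists_exp_bound
  refine ⟨(C * Real.exp (ω * h)).toNNReal, fun t => ?_⟩
  have := hC t (t - h) (by simp)
  simp only [sub_sub_cancel] at this
  exact this.trans (Real.le_coe_toNNReal _)

theorem continuous_shift (U : EvolutionFamily 𝕜 X) (h : ℝ≥0) :
    Continuous (fun q : X × ℝ => U q.2 (q.2 - h) q.1) := by
  obtain ⟨K, hK⟩ := U.exists_bound_shift h
  refine continuous_prod_of_continuous_lipschitzWith _ K (fun x => ?_) (fun t => ?_)
  · exact (U.continuousOn_apply x).comp_continuous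
      (f := fun t : ℝ => ((t, t - h) : ℝ × ℝ)) (by fun_prop) (fun t => by simp)
  · exact ((U t (t - h)).lipschitz).weaken (by exact_mod_cast hK t)

variable {p : ℝ≥0∞}

theorem memLp_shift (U : EvolutionFamily 𝕜 X) (h : ℝ≥0) (u : Lp X p (volume : Measure ℝ)) :
    MemLp (fun t : ℝ => U t (t - h) (u (t - h))) p volume := by
  obtain ⟨K, hK⟩ := U.exists_bound_shift h
  have hu : MemLp (fun t : ℝ => u (t - h)) p volume :=
    (Lp.memLp u).comp_measurePreserving (measurePreserving_sub_right volume (h : ℝ))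
  refine hu.of_le_mul (c := K) ?_ (Eventually.of_forall fun t => ?_)
  · exact (U.continuous_shift h).comp_aestronglyMeasurable
      (hu.aestronglyMeasurable.prodMk aestronglyMeasurable_id)
  · exact ((U t (t - h)).le_opNorm _).trans (by gcongr; exact hK t)

/-- The evolution semigroup on `L_p(ℝ; X)`: `(T^h u)(t) = U(t, t - h) u(t - h)` for `h ≥ 0`. -/
noncomputable def evolutionSemigroup (U : EvolutionFamily 𝕜 X) (p : ℝ≥0∞) (h : ℝ≥0) :
    Lp X p (volume : Measure ℝ) →ₗ[𝕜] Lp X p (volume : Measure ℝ) where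
  toFun u := (U.memLp_shift h u).toLp _
  map_add' u v := by
    rw [← MemLp.toLp_add, MemLp.toLp_eq_toLp_iff]
    have := (measurePreserving_sub_right volume (h : ℝ)).quasiMeasurePreserving.ae_eq_comp
      (Lp.coeFn_add u v)
    filter_upwards [this] with t ht
    simp only [Function.comp_apply, Pi.add_apply] at ht
    rw [ht, map_add, Pi.add_apply]
  map_smul' c u := by
    rw [RingHom.id_apply, ← MemLp.toLp_const_smul, MemLp.toLp_eq_toLp_iff]
    have := (measurePreserving_sub_right volume (h : ℝ)).quasiMeasurePreserving.ae_eq_comp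
      (Lp.coeFn_smul c u)
    filter_upwards [this] with t ht
    simp only [Function.comp_apply, Pi.smul_apply] at ht
    rw [ht, map_smul, Pi.smul_apply]

theorem coeFn_evolutionSemigroup (U : EvolutionFamily 𝕜 X) (h : ℝ≥0)
    (u : Lp X p (volume : Measure ℝ)) :
    (U.evolutionSemigroup p h u : ℝ → X) =ᵐ[volume] fun t => U t (t - h) (u (t - h)) :=
  MemLp.coeFn_toLp (U.memLp_shift h u)

end EvolutionFamily

section Generator

variable {𝕜 : Type*} {E : Type*} [RCLike 𝕜] [NormedAddCommGroup E] [NormedSpace 𝕜 E]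

/-- The graph of the infinitesimal generator of a family `T h`, `h ≥ 0`, of operators on `E`:
the pairs `(u, f)` with `h⁻¹ (T h u - u) → f` as `h ↓ 0`. -/
def generatorGraph (T : ℝ≥0 → E →ₗ[𝕜] E) : Submodule 𝕜 (E × E) where
  carrier := {q | Tendsto (fun h : ℝ≥0 => ((h : ℝ) : 𝕜)⁻¹ • (T h q.1 - q.1)) (𝓝[>] 0) (𝓝 q.2)}
  zero_mem' := by simp
  add_mem' {a b} ha hb := by
    refine (Tendsto.add ha hb).congr fun h => ?_
    rw [Prod.fst_add, map_add, ← smul_add]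
    congr 1
    abel
  smul_mem' c a ha := by
    refine (Tendsto.const_smul ha c).congr fun h => ?_
    rw [Prod.smul_fst, map_smul, ← smul_sub, smul_comm]

/-- The infinitesimal generator of `T` as an unbounded operator. -/
noncomputable def generator (T : ℝ≥0 → E →ₗ[𝕜] E) : E →ₗ.[𝕜] E :=
  (generatorGraph T).toLinearPMap

theorem mem_generator_graph_iff (T : ℝ≥0 → E →ₗ[𝕜] E) (u f : E) :
    (u, f) ∈ (generator T).graph ↔
      Tendsto (fun h : ℝ≥0 => ((h : ℝ) : 𝕜)⁻¹ • (T h u - u)) (𝓝[>] 0) (𝓝 f) := by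
  rw [generator, Submodule.toLinearPMap_graph_eq]
  · rfl
  · rintro ⟨a, b⟩ hab (rfl : a = 0)
    have hab' : Tendsto (fun h : ℝ≥0 => ((h : ℝ) : 𝕜)⁻¹ • (T h (0 : E) - 0)) (𝓝[>] 0) (𝓝 b) :=
      hab
    simp only [map_zero, sub_zero, smul_zero] at hab'
    exact (tendsto_nhds_unique hab' tendsto_const_nhds)

end Generator

/-- The operator `𝐆` of an evolution family: the generator of its evolution semigroup on
`L_p(ℝ; X)`. -/
noncomputable def EvolutionFamily.G {𝕜 : Type*} {X : Type*} [RCLike 𝕜] [NormedAddCommGroup X]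
    [NormedSpace 𝕜 X] (U : EvolutionFamily 𝕜 X) (p : ℝ≥0∞) [Fact (1 ≤ p)] :
    Lp X p (volume : Measure ℝ) →ₗ.[𝕜] Lp X p (volume : Measure ℝ) :=
  generator (U.evolutionSemigroup p)

namespace LinearPMap

variable {𝕜 : Type*} {E : Type*} [RCLike 𝕜] [NormedAddCommGroup E] [NormedSpace 𝕜 E]

/-- A (possibly unbounded) closed operator is Fredholm if its kernel is finite dimensional and its
range is closed and of finite codimension. -/
structure IsFredholm (G : E →ₗ.[𝕜] E) : Prop where
  isClosed : G.IsClosed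
  finite_ker : FiniteDimensional 𝕜 (LinearMap.ker G.toFun)
  isClosed_range : _root_.IsClosed (LinearMap.range G.toFun : Set E)
  finite_coker : FiniteDimensional 𝕜 (E ⧸ LinearMap.range G.toFun)

/-- `ind G = dim ker G - codim Im G`, meaningful for Fredholm `G`. -/
noncomputable def index (G : E →ₗ.[𝕜] E) : ℤ :=
  (Module.finrank 𝕜 (LinearMap.ker G.toFun) : ℤ)
    - (Module.finrank 𝕜 (E ⧸ LinearMap.range G.toFun) : ℤ)

end LinearPMap

section WellPosed

variable {𝕜 : Type*} {X : Type*} [RCLike 𝕜] [NormedAddCommGroup X] [NormedSpace 𝕜 X]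
  [NormedSpace ℝ X]

/-- `u` is a regular solution of `u'(t) = A(t)u(t) + f(t)` on `[τ, T]`: it takes values in
`dom A(t)`, it belongs to `W_p^1([τ, T]; X)` with derivative `v`, one has `f ∈ L_p`, and the
equation holds almost everywhere (`(x, y) ∈ (A t).graph` means `x ∈ dom A(t)` and
`A(t)x = y`). -/
def IsRegularSolution (p : ℝ≥0∞) (A : ℝ → X →ₗ.[𝕜] X) (f u : ℝ → X) (τ T : ℝ) : Prop :=
  (∀ t ∈ Icc τ T, u t ∈ (A t).domain) ∧
  MemLp f p (volume.restrict (Icc τ T)) ∧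
  ∃ v : ℝ → X, MemLp v p (volume.restrict (Icc τ T)) ∧
    (∀ t ∈ Icc τ T, u t = u τ + ∫ s in τ..t, v s) ∧
    ∀ᵐ t ∂(volume.restrict (Icc τ T)), (u t, v t - f t) ∈ (A t).graph

/-- The equation `u'(t) = A(t)u(t)`, `t ∈ ℝ`, is well posed in the `W_p^1` sense, with
propagator `U`. -/
structure IsWellPosedWith (p : ℝ≥0∞) (A : ℝ → X →ₗ.[𝕜] X) (U : EvolutionFamily 𝕜 X) :
    Prop where
  /-- The operators `A(t)` have a common dense domain. -/
  common_domain : ∃ D : Submodule 𝕜 X, Dense (D : Set X) ∧ ∀ t : ℝ, (A t).domain = D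
  /-- Existence: `t ↦ U(t, τ)x` is a regular solution for all initial times `τ` and all initial
  values `x` in the common domain. -/
  existence : ∀ (τ : ℝ) (x : X), x ∈ (A τ).domain → ∀ T : ℝ, τ ≤ T →
    IsRegularSolution p A (fun _ => 0) (fun t => U t τ x) τ T
  /-- Uniqueness and continuous dependence: on each compact interval a regular solution is
  controlled by its initial value and the inhomogeneity. -/
  continuous_dependence : ∀ τ T : ℝ, τ ≤ T → ∃ C : ℝ, ∀ f u : ℝ → X,
    IsRegularSolution p A f u τ T → ∀ t ∈ Icc τ T,
      ‖u t‖ ≤ C * (‖u τ‖ + (eLpNorm f p (volume.restrict (Icc τ T))).toReal)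

end WellPosed

/-!
The generators are compared through bounded operators. Subtracting a large multiple `c` of the
identity makes the evolution family `U_A` exponentially stable, and then `𝐆_A - c` is invertible,
with inverse `-J`, where `(J f)(t) = ∫_{h > 0} V(t, t - h) f(t - h) dh` is the Green operator of the
rescaled family `V` (`EvolutionFamily.IsStable.mem_G_graph_iff`). Well-posedness yields the
variation of constants formula relating `U_{A+B}` to `U_A` (`IsWellPosedWith.duhamel`), and from it
`𝐆_{A+B} = 𝐆_A + 𝓑` with the same domain, where `𝓑` is multiplication by `B`
(`EvolutionFamily.mem_G_graph_iff_of_duhamel`). Hence `𝐆_A` and `𝐆_{A+B}` have the Fredholm property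
and the index of `S = c J - 1` and of `S' = (c + 𝓑) J - 1`, respectively
(`LinearPMap.isFredholm_iff_of_graph`).

The difference `N = 𝓑 J` of these two operators need not be compact: `B` is only strongly
continuous, so `B(t) (J f)(t)` need not be equicontinuous in `t`. However `J 𝓑 J` is compact, and
`S' = S (1 - N) + c J N`, where `‖N‖ < 1` once `c` is large: `S'` is a compact perturbation of the
product of `S` with an invertible operator (`ContinuousLinearMap.finiteIndex_perturb`).

For the compactness of `J 𝓑 J`, the decay of `B` at infinity allows cutting `B` off outside a
bounded interval. The cut-off product is the strong integral over `s` of the operators sending `f`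
to the trajectory of `V` started at time `s` from `B(s) (J f)(s)`. Each of these is compact because
`B(s)` is, and a strong integral of uniformly bounded compact operators over a finite measure space
is compact (`IsCompactOperator.of_strong_integral`).
-/

/-! ### Algebraic Fredholm theory and compact perturbations -/

namespace LinearMap

variable {𝕜 V W Z : Type*} [Field 𝕜] [AddCommGroup V] [Module 𝕜 V] [AddCommGroup W] [Module 𝕜 W]
  [AddCommGroup Z] [Module 𝕜 Z]

/-- A linear map has finite index if its kernel and its cokernel are finite dimensional. For
bounded operators between Banach spaces this is the same as being Fredholm. -/
structure FiniteIndex (f : V →ₗ[𝕜] W) : Prop where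
  finite_ker : FiniteDimensional 𝕜 (ker f)
  finite_coker : FiniteDimensional 𝕜 (W ⧸ range f)

/-- The algebraic index `dim ker f - dim coker f`, meaningful for maps of finite index. -/
noncomputable def algIndex (f : V →ₗ[𝕜] W) : ℤ :=
  (Module.finrank 𝕜 (ker f) : ℤ) - (Module.finrank 𝕜 (W ⧸ range f) : ℤ)

theorem finiteDimensional_of_ker_of_range (f : V →ₗ[𝕜] W) [FiniteDimensional 𝕜 (ker f)]
    [FiniteDimensional 𝕜 (range f)] : FiniteDimensional 𝕜 V := by
  have : FiniteDimensional 𝕜 (V ⧸ ker f) := Module.Finite.equiv f.quotKerEquivRange.symm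
  exact Module.Finite.of_submodule_quotient (ker f)

/-- Maps of finite index compose, and the index is additive. The proof reads off the dimensions
from the exact sequence
`0 → ker f → ker (g ∘ f) → ker g → coker f → coker (g ∘ f) → coker g → 0`. -/
theorem FiniteIndex.comp {g : W →ₗ[𝕜] Z} {f : V →ₗ[𝕜] W} (hg : g.FiniteIndex)
    (hf : f.FiniteIndex) :
    (g ∘ₗ f).FiniteIndex ∧ (g ∘ₗ f).algIndex = g.algIndex + f.algIndex := by
  have := hg.finite_ker
  have := hg.finite_coker
  have := hf.finite_ker
  have := hf.finite_coker
  let φ : ker (g ∘ₗ f) →ₗ[𝕜] ker g := f.restrict (fun x hx => hx)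
  let χ : ker g →ₗ[𝕜] W ⧸ range f := (range f).mkQ ∘ₗ (ker g).subtype
  have hle : range f ≤ (range (g ∘ₗ f)).comap g := by
    rintro _ ⟨x, rfl⟩
    exact ⟨x, rfl⟩
  let ψ : (W ⧸ range f) →ₗ[𝕜] Z ⧸ range (g ∘ₗ f) := Submodule.mapQ _ _ g hle
  let θ : (Z ⧸ range (g ∘ₗ f)) →ₗ[𝕜] Z ⧸ range g := Submodule.factor (range_comp_le_range f g)
  let e : ker f ≃ₗ[𝕜] ker φ := LinearEquiv.ofBijective
    (LinearMap.codRestrict (ker φ) (Submodule.inclusion (ker_le_ker_comp f g))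
      (fun x => by
        ext
        exact x.2))
    ⟨fun x y hxy => by
        have := congrArg (fun z : ker φ => ((z : ker (g ∘ₗ f)) : V)) hxy
        exact Subtype.ext this,
      fun ⟨⟨x, hx⟩, hx'⟩ => ⟨⟨x, congrArg Subtype.val hx'⟩, rfl⟩⟩
  have hχ : ker χ = range φ := by
    ext ⟨w, hw⟩
    simp only [χ, mem_ker, coe_comp, Submodule.coe_subtype, Function.comp_apply,
      Submodule.mkQ_apply, Submodule.Quotient.mk_eq_zero]
    constructor
    · rintro ⟨x, rfl⟩
      exact ⟨⟨x, hw⟩, rfl⟩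
    · rintro ⟨⟨x, hx⟩, h⟩
      exact ⟨x, congrArg Subtype.val h⟩
  have hψ : ker ψ = range χ := by
    ext w
    obtain ⟨w, rfl⟩ := Submodule.mkQ_surjective _ w
    simp only [ψ, mem_ker, Submodule.mkQ_apply, Submodule.mapQ_apply,
      Submodule.Quotient.mk_eq_zero]
    constructor
    · rintro ⟨x, hx⟩
      refine ⟨⟨w - f x, ?_⟩, ?_⟩
      · rw [mem_ker, map_sub, sub_eq_zero, ← hx]
        rfl
      · simp only [χ, coe_comp, Submodule.coe_subtype, Function.comp_apply, Submodule.mkQ_apply]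
        rw [Submodule.Quotient.eq]
        exact ⟨-x, by simp⟩
    · rintro ⟨⟨w', hw'⟩, h⟩
      simp only [χ, coe_comp, Submodule.coe_subtype, Function.comp_apply,
        Submodule.mkQ_apply] at h
      rw [Submodule.Quotient.eq] at h
      obtain ⟨x, hx⟩ := h
      refine ⟨-x, ?_⟩
      rw [mem_ker] at hw'
      simp [hx, hw']
  have hθ : ker θ = range ψ := by
    ext z
    obtain ⟨z, rfl⟩ := Submodule.mkQ_surjective _ z
    have hz : θ ((range (g ∘ₗ f)).mkQ z) = (range g).mkQ z := rfl
    rw [mem_ker, hz, Submodule.mkQ_apply, Submodule.Quotient.mk_eq_zero]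
    constructor
    · rintro ⟨w, rfl⟩
      exact ⟨(range f).mkQ w, rfl⟩
    · rintro ⟨w, h⟩
      obtain ⟨w, rfl⟩ := Submodule.mkQ_surjective _ w
      simp only [ψ, Submodule.mkQ_apply, Submodule.mapQ_apply] at h
      rw [Submodule.Quotient.eq] at h
      obtain ⟨x, hx⟩ := h
      refine ⟨w - f x, ?_⟩
      rw [map_sub]
      simp only [coe_comp, Function.comp_apply] at hx
      rw [hx]
      abel
  have hθs : range θ = ⊤ := range_eq_top.2 (Submodule.factor_surjective _)
  have : FiniteDimensional 𝕜 (ker φ) := Module.Finite.equiv e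
  have hk : FiniteDimensional 𝕜 (ker (g ∘ₗ f)) := finiteDimensional_of_ker_of_range φ
  have : FiniteDimensional 𝕜 (ker θ) := by rw [hθ]; infer_instance
  have hc : FiniteDimensional 𝕜 (Z ⧸ range (g ∘ₗ f)) := finiteDimensional_of_ker_of_range θ
  refine ⟨⟨hk, hc⟩, ?_⟩
  have h1 := finrank_range_add_finrank_ker φ
  have h2 := finrank_range_add_finrank_ker χ
  have h3 := finrank_range_add_finrank_ker ψ
  have h4 := finrank_range_add_finrank_ker θ
  rw [← e.finrank_eq] at h1
  rw [hχ] at h2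
  rw [hψ] at h3
  rw [hθ, hθs, finrank_top] at h4
  simp only [algIndex]
  omega

theorem finiteIndex_of_bijective {f : V →ₗ[𝕜] W} (hf : Function.Bijective f) :
    f.FiniteIndex ∧ f.algIndex = 0 := by
  have h1 : ker f = ⊥ := ker_eq_bot.2 hf.1
  have h2 : range f = ⊤ := range_eq_top.2 hf.2
  have : Subsingleton (W ⧸ range f) := by
    rw [h2]
    infer_instance
  refine ⟨⟨?_, inferInstance⟩, ?_⟩
  · rw [h1]
    infer_instance
  · rw [algIndex, h1, Module.finrank_zero_of_subsingleton (M := W ⧸ range f)]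
    simp

end LinearMap

section Riesz

variable {𝕜 E : Type*} [RCLike 𝕜] [NormedAddCommGroup E] [NormedSpace 𝕜 E]

open LinearMap (FiniteIndex algIndex)

/-- A continuous projection onto the finite dimensional kernel of a linear map. -/
theorem LinearMap.exists_proj_ker {F : Type*} [AddCommGroup F] [Module 𝕜 F] (f : E →ₗ[𝕜] F)
    [FiniteDimensional 𝕜 (ker f)] :
    ∃ π : E →L[𝕜] ker f, ∀ x : ker f, π x = x :=
  Submodule.ClosedComplemented.of_finiteDimensional (ker f)

variable [CompleteSpace E]

/-- The Fredholm alternative: an injective compact perturbation of the identity is bijective. -/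
theorem IsCompactOperator.bijective_one_add_of_injective {K : E →L[𝕜] E}
    (hK : IsCompactOperator K) (h : Function.Injective (1 + K : E →L[𝕜] E)) :
    Function.Bijective (1 + K : E →L[𝕜] E) := by
  have hK' : IsCompactOperator (-K : E →L[𝕜] E) := hK.neg
  rcases hK'.hasEigenvalue_or_mem_resolventSet (μ := (1 : 𝕜)) one_ne_zero with h1 | h1
  · exfalso
    obtain ⟨x, hx⟩ := h1.exists_hasEigenvector
    refine hx.2 (h ?_)
    have h2 : -K x = x := by simpa using hx.apply_eq_smul
    have h3 : x + K x = 0 := by rw [← eq_neg_iff_add_eq_zero, h2]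
    simpa using h3
  · rw [spectrum.mem_resolventSet_iff, ContinuousLinearMap.isUnit_iff_bijective] at h1
    simpa [sub_eq_add_neg] using h1

/-- A surjective compact perturbation `L = 1 + K` of the identity with finite dimensional kernel is
injective: a right inverse `Q` of `L` satisfies `Q = 1 - K ∘ Q`, so the Fredholm alternative makes
`Q`, hence `L`, bijective. -/
theorem IsCompactOperator.injective_one_add_of_surjective {K : E →L[𝕜] E}
    (hK : IsCompactOperator K)
    (hker : FiniteDimensional 𝕜 (LinearMap.ker (1 + K : E →L[𝕜] E).toLinearMap))
    (h : Function.Surjective (1 + K : E →L[𝕜] E)) :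
    Function.Injective (1 + K : E →L[𝕜] E) := by
  have hLx (x : E) : (1 + K : E →L[𝕜] E) x = x + K x := by simp
  set L : E →L[𝕜] E := 1 + K with hL
  obtain ⟨Q, hQ⟩ : ∃ Q : E →L[𝕜] E, ∀ x, L (Q x) = x := by
    obtain ⟨π, hπ⟩ := LinearMap.exists_proj_ker L.toLinearMap
    let M : E →L[𝕜] E × LinearMap.ker L.toLinearMap := L.prod π
    have hMx (x : E) : M x = (L x, π x) := rfl
    have hM1 : M.ker = ⊥ := by
      rw [LinearMap.ker_eq_bot']
      intro x hx
      have hx1 : L x = 0 := congrArg Prod.fst hx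
      have hx2 : π x = 0 := congrArg Prod.snd hx
      have := hπ ⟨x, hx1⟩
      rw [hx2] at this
      exact (congrArg Subtype.val this).symm
    have hM2 : M.range = ⊤ := by
      rw [LinearMap.range_eq_top]
      rintro ⟨y, k⟩
      obtain ⟨x, rfl⟩ := h y
      have h0 : L ((k - π x : LinearMap.ker L.toLinearMap) : E) = 0 :=
        (k - π x : LinearMap.ker L.toLinearMap).2
      have h1 : L (x + (k - π x : LinearMap.ker L.toLinearMap)) = L x := by
        rw [map_add, h0, add_zero]
      have h2 : π (x + (k - π x : LinearMap.ker L.toLinearMap)) = k := by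
        rw [map_add, hπ, add_sub_cancel]
      exact ⟨x + (k - π x : LinearMap.ker L.toLinearMap), Prod.ext h1 h2⟩
    let e := ContinuousLinearEquiv.ofBijective M hM1 hM2
    refine ⟨(e.symm : E × LinearMap.ker L.toLinearMap →L[𝕜] E) ∘L
      ContinuousLinearMap.inl 𝕜 E _, fun x => ?_⟩
    have := ContinuousLinearEquiv.ofBijective_apply_symm_apply M hM1 hM2 (x, 0)
    exact congrArg Prod.fst this
  have hQK : (1 + -(K ∘L Q) : E →L[𝕜] E) = Q := by
    ext x
    have h1 : Q x + K (Q x) = x := by rw [← hLx, hQ]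
    have h2 : (1 + -(K ∘L Q) : E →L[𝕜] E) x = x - K (Q x) := by simp [sub_eq_add_neg]
    rw [h2, sub_eq_iff_eq_add, h1]
  have hQi : Function.Injective Q := fun x y hxy => by rw [← hQ x, ← hQ y, hxy]
  have hQb : Function.Bijective Q := by
    rw [← hQK]
    refine IsCompactOperator.bijective_one_add_of_injective ?_ (by rwa [hQK])
    exact (hK.comp_clm Q).neg
  intro x y hxy
  obtain ⟨x, rfl⟩ := hQb.2 x
  obtain ⟨y, rfl⟩ := hQb.2 y
  rw [hQ, hQ] at hxy
  rw [hxy]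

theorem IsCompactOperator.finiteDimensional_ker_one_add {K : E →L[𝕜] E}
    (hK : IsCompactOperator K) :
    FiniteDimensional 𝕜 (LinearMap.ker (1 + K : E →L[𝕜] E).toLinearMap) := by
  set N := LinearMap.ker (1 + K : E →L[𝕜] E).toLinearMap with hN
  have hKN : ∀ x ∈ N, (-K : E →L[𝕜] E).toLinearMap x = x := by
    intro x hx
    have : x + K x = 0 := by simpa [hN] using hx
    simpa using (eq_neg_iff_add_eq_zero.2 this).symm
  have hK' : IsCompactOperator (-K : E →L[𝕜] E).toLinearMap := hK.neg
  have := hK'.restrict' (V := N) (fun x hx => by rwa [hKN x hx])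
  refine FiniteDimensional.of_isCompactOperator_id (𝕜 := 𝕜) ?_
  convert! this using 1
  ext x
  exact (hKN x x.2).symm

/-- Riesz: a compact perturbation of the identity has index zero. -/
theorem IsCompactOperator.finiteIndex_one_add {K : E →L[𝕜] E} (hK : IsCompactOperator K) :
    (1 + K : E →L[𝕜] E).toLinearMap.FiniteIndex ∧
      (1 + K : E →L[𝕜] E).toLinearMap.algIndex = 0 := by
  have hfin := hK.finiteDimensional_ker_one_add
  have hLx (x : E) : (1 + K : E →L[𝕜] E) x = x + K x := by simp
  set L : E →L[𝕜] E := 1 + K with hL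
  set N := LinearMap.ker L.toLinearMap with hN
  obtain ⟨π, hπ⟩ : ∃ π : E →L[𝕜] N, ∀ x : N, π x = x :=
    LinearMap.exists_proj_ker L.toLinearMap
  set R := LinearMap.range L.toLinearMap with hR
  obtain ⟨C, hC⟩ := R.exists_isCompl
  have hproj : Function.Bijective (R.mkQ ∘ₗ C.subtype) :=
    (Submodule.quotientEquivOfIsCompl R C hC).symm.bijective
  -- Perturbing `L` by a finite rank operator `ι ∘ π` with `ι : ker L → C` stays of the form
  -- identity plus compact.
  have key (ι : N →ₗ[𝕜] C) : ∃ K' : E →L[𝕜] E, IsCompactOperator K' ∧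
      ∀ x, (1 + K' : E →L[𝕜] E) x = L x + ι (π x) := by
    let ι' : N →L[𝕜] E := LinearMap.toContinuousLinearMap (C.subtype ∘ₗ ι)
    have : ProperSpace N := FiniteDimensional.proper 𝕜 N
    have hι : IsCompactOperator ι' := isCompactOperator_of_locallyCompactSpace_rng ι'
    refine ⟨K + ι' ∘L π, hK.add (hι.comp_clm π), fun x => ?_⟩
    have : ι' (π x) = ι (π x) := rfl
    simp [hLx, ← this, add_assoc]
  have hdisj : ∀ (x : E) (c : C), L x + c = 0 → L x = 0 ∧ c = 0 := by
    intro x c h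
    have h1 : L x = -(c : E) := eq_neg_of_add_eq_zero_left h
    have h2 : L x ∈ R ⊓ C := ⟨⟨x, rfl⟩, by rw [h1]; exact C.neg_mem c.2⟩
    rw [hC.inf_eq_bot, Submodule.mem_bot] at h2
    refine ⟨h2, ?_⟩
    rw [h2, zero_add] at h
    exact Subtype.ext h
  -- Whichever of kernel `N` and complement `C` is smaller, some `ι : N → C` makes `L + ι ∘ π`
  -- injective or surjective, hence bijective, which forces `ι` to be an isomorphism.
  have hNC : Nonempty (N ≃ₗ[𝕜] C) := by
    rcases le_total (Module.rank 𝕜 N) (Module.rank 𝕜 C) with hle | hle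
    · obtain ⟨ι, hι⟩ := rank_le_iff_exists_linearMap.1 hle
      obtain ⟨K', hK', hx'⟩ := key ι
      have hinj : Function.Injective (1 + K' : E →L[𝕜] E) := by
        rw [injective_iff_map_eq_zero]
        intro x hx
        rw [hx'] at hx
        obtain ⟨h1, h2⟩ := hdisj _ _ hx
        have h3 : π x = 0 := (injective_iff_map_eq_zero ι).1 hι _ h2
        have h4 := hπ ⟨x, h1⟩
        rw [h3] at h4
        exact (congrArg Subtype.val h4).symm
      have hsurj := (hK'.bijective_one_add_of_injective hinj).2
      refine ⟨LinearEquiv.ofBijective ι ⟨hι, fun c => ?_⟩⟩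
      obtain ⟨x, hx⟩ := hsurj c
      rw [hx'] at hx
      have : L x + ((ι (π x) - c : C) : E) = 0 := by
        rw [Submodule.coe_sub, ← hx]
        abel
      exact ⟨π x, sub_eq_zero.1 (hdisj _ _ this).2⟩
    · obtain ⟨κ, hκ⟩ := rank_le_iff_exists_linearMap.1 hle
      obtain ⟨ι, hι⟩ := κ.exists_leftInverse_of_injective (LinearMap.ker_eq_bot.2 hκ)
      have hι' (c : C) : ι (κ c) = c := congrArg (fun T => T c) hι
      obtain ⟨K', hK', hx'⟩ := key ι
      have hsurj : Function.Surjective (1 + K' : E →L[𝕜] E) := by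
        intro y
        have hy : y ∈ R ⊔ C := by rw [hC.sup_eq_top]; trivial
        obtain ⟨_, ⟨x, rfl⟩, c, hc, rfl⟩ := Submodule.mem_sup.1 hy
        refine ⟨x + (κ ⟨c, hc⟩ - π x : N), ?_⟩
        have h0 : L ((κ ⟨c, hc⟩ - π x : N) : E) = 0 := (κ ⟨c, hc⟩ - π x : N).2
        have h1 : π (x + (κ ⟨c, hc⟩ - π x : N)) = κ ⟨c, hc⟩ := by
          rw [map_add, hπ]
          abel
        rw [hx', map_add, h0, h1, hι', add_zero]
        rfl
      have hinj := hK'.injective_one_add_of_surjective hK'.finiteDimensional_ker_one_add hsurj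
      refine ⟨LinearEquiv.ofBijective ι ⟨?_, fun c => ⟨κ c, hι' c⟩⟩⟩
      intro m n hmn
      have hm (m : N) : (1 + K' : E →L[𝕜] E) m = ι m := by
        have : L m = 0 := m.2
        rw [hx', hπ, this, zero_add]
      have := hinj ((hm m).trans ((congrArg Subtype.val hmn).trans (hm n).symm))
      exact Subtype.ext this
  obtain ⟨e⟩ := hNC
  let e' : N ≃ₗ[𝕜] E ⧸ R := e.trans (LinearEquiv.ofBijective _ hproj)
  refine ⟨⟨hfin, Module.Finite.equiv e'⟩, ?_⟩
  rw [algIndex, sub_eq_zero]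
  exact_mod_cast e'.finrank_eq

/-- A bounded operator of finite index can be bordered to an isomorphism `E × C ≃ E × ker T`, where
`C` is a complement of the range, embedded in the target, and the second component is a continuous
projection to the kernel. -/
theorem LinearMap.FiniteIndex.exists_bordering {T : E →L[𝕜] E} (hT : T.toLinearMap.FiniteIndex) :
    ∃ (C : Submodule 𝕜 E) (e : (E × C) ≃L[𝕜] (E × LinearMap.ker T.toLinearMap)),
      FiniteDimensional 𝕜 C ∧ (∀ x c, (e (x, c)).1 = T x + c) ∧
        ∀ y, y ∈ LinearMap.range T.toLinearMap ↔ (e.symm (y, 0)).2 = 0 := by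
  have := hT.finite_ker
  have := hT.finite_coker
  set N := LinearMap.ker T.toLinearMap with hN
  obtain ⟨π, hπ⟩ : ∃ π : E →L[𝕜] N, ∀ x : N, π x = x :=
    LinearMap.exists_proj_ker T.toLinearMap
  set R := LinearMap.range T.toLinearMap with hR
  obtain ⟨C, hC⟩ := R.exists_isCompl
  let eC : (E ⧸ R) ≃ₗ[𝕜] C := Submodule.quotientEquivOfIsCompl R C hC
  have : FiniteDimensional 𝕜 C := Module.Finite.equiv eC
  have : CompleteSpace C := FiniteDimensional.complete 𝕜 C
  have : CompleteSpace N := FiniteDimensional.complete 𝕜 N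
  let M : E × C →L[𝕜] E × N :=
    (T ∘L ContinuousLinearMap.fst 𝕜 E C + C.subtypeL ∘L ContinuousLinearMap.snd 𝕜 E C).prod
      (π ∘L ContinuousLinearMap.fst 𝕜 E C)
  have hMx (x : E) (c : C) : M (x, c) = (T x + c, π x) := rfl
  have hM1 : M.ker = ⊥ := by
    rw [LinearMap.ker_eq_bot']
    rintro ⟨x, c⟩ hx
    have hx1 : T x + c = 0 := congrArg Prod.fst hx
    have hx2 : π x = 0 := congrArg Prod.snd hx
    have h1 : T x = -(c : E) := eq_neg_of_add_eq_zero_left hx1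
    have h2 : T x ∈ R ⊓ C := ⟨⟨x, rfl⟩, by rw [h1]; exact C.neg_mem c.2⟩
    rw [hC.inf_eq_bot, Submodule.mem_bot] at h2
    rw [h2, zero_add] at hx1
    have h3 := hπ ⟨x, h2⟩
    rw [hx2] at h3
    exact Prod.ext (congrArg Subtype.val h3).symm (Subtype.ext hx1)
  have hM2 : M.range = ⊤ := by
    rw [LinearMap.range_eq_top]
    rintro ⟨y, k⟩
    have hy : y ∈ R ⊔ C := by rw [hC.sup_eq_top]; trivial
    obtain ⟨_, ⟨x, rfl⟩, c, hc, rfl⟩ := Submodule.mem_sup.1 hy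
    have h0 : T ((k - π x : N) : E) = 0 := (k - π x : N).2
    have h1 : T (x + (k - π x : N)) + c = T x + c := by rw [map_add, h0, add_zero]
    have h2 : π (x + (k - π x : N)) = k := by rw [map_add, hπ, add_sub_cancel]
    exact ⟨(x + (k - π x : N), ⟨c, hc⟩), Prod.ext h1 h2⟩
  let e := ContinuousLinearEquiv.ofBijective M hM1 hM2
  refine ⟨C, e, inferInstance, fun x c => rfl, fun y => ⟨?_, fun h => ?_⟩⟩
  · rintro ⟨x, rfl⟩
    have h0 : T (π x : E) = 0 := (π x).2
    have h1 : e (x - π x, 0) = (T x, 0) := by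
      change M _ = _
      rw [hMx, map_sub, map_sub, hπ, h0]
      simp
    change (e.symm (T x, 0)).2 = 0
    rw [← h1, e.symm_apply_apply]
  · have h1 := congrArg Prod.fst (e.apply_symm_apply (y, 0))
    have h2 : e.symm (y, 0) = ((e.symm (y, 0)).1, 0) := Prod.ext rfl h
    rw [h2] at h1
    refine ⟨(e.symm (y, 0)).1, ?_⟩
    have h3 : (e ((e.symm (y, 0)).1, 0)).1 = T (e.symm (y, 0)).1 + ((0 : C) : E) := rfl
    rw [h3] at h1
    simpa using h1

/-- A bounded operator between Banach spaces with finite dimensional kernel and cokernel has closed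
range. -/
theorem LinearMap.FiniteIndex.isClosed_range {T : E →L[𝕜] E} (hT : T.toLinearMap.FiniteIndex) :
    IsClosed (LinearMap.range T.toLinearMap : Set E) := by
  obtain ⟨C, e, -, -, h⟩ := hT.exists_bordering
  have : (LinearMap.range T.toLinearMap : Set E) = {y | (e.symm (y, 0)).2 = 0} := by
    ext y
    exact h y
  rw [this]
  exact isClosed_eq (by fun_prop) continuous_const

/-- Compact perturbations preserve finiteness of the index and the index. The operator `T` is
bordered to an isomorphism `E × C ≃ E × ker T`, where `C` is a complement of the range; the bordered
perturbation is this isomorphism composed with identity plus compact, and `T + K` is one of its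
corners. -/
theorem IsCompactOperator.finiteIndex_add {T K : E →L[𝕜] E} (hK : IsCompactOperator K)
    (hT : T.toLinearMap.FiniteIndex) :
    (T + K).toLinearMap.FiniteIndex ∧ (T + K).toLinearMap.algIndex = T.toLinearMap.algIndex := by
  have := hT.finite_ker
  set N := LinearMap.ker T.toLinearMap with hN
  obtain ⟨C, e, hCfin, hMx, -⟩ : ∃ (C : Submodule 𝕜 E) (e : (E × C) ≃L[𝕜] (E × N)), _ :=
    hT.exists_bordering
  have : CompleteSpace C := FiniteDimensional.complete 𝕜 C
  let M : E × C →L[𝕜] E × N := e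
  have he (y : E × N) : M (e.symm y) = y := e.apply_symm_apply y
  replace hMx (x : E) (c : C) : (M (x, c)).1 = T x + c := hMx x c
  let K' : E × C →L[𝕜] E × C := (e.symm : E × N →L[𝕜] E × C) ∘L
    (ContinuousLinearMap.inl 𝕜 E N ∘L (K ∘L ContinuousLinearMap.fst 𝕜 E C))
  have hK' : IsCompactOperator K' :=
    ((hK.comp_clm (ContinuousLinearMap.fst 𝕜 E C)).clm_comp
      (ContinuousLinearMap.inl 𝕜 E N)).clm_comp (e.symm : E × N →L[𝕜] E × C)
  have hMb : Function.Bijective M.toLinearMap := e.bijective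
  -- The corner of `M ∘ D`, for `D` of index zero, has an index that does not depend on `D`.
  have corner (T' : E →L[𝕜] E) (D : E × C →L[𝕜] E × C) (hD : D.toLinearMap.FiniteIndex)
      (hD0 : D.toLinearMap.algIndex = 0) (h : ∀ x, (M (D (x, 0))).1 = T' x) :
      T'.toLinearMap.FiniteIndex ∧ T'.toLinearMap.algIndex =
        (LinearMap.fst 𝕜 E N).algIndex + (LinearMap.inl 𝕜 E C).algIndex := by
    have hfst : (LinearMap.fst 𝕜 E N).FiniteIndex := by
      constructor
      · rw [LinearMap.ker_fst]
        infer_instance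
      · rw [LinearMap.range_eq_top.2 Prod.fst_surjective]
        infer_instance
    have hinl : (LinearMap.inl 𝕜 E C).FiniteIndex := by
      constructor
      · rw [LinearMap.ker_eq_bot.2 LinearMap.inl_injective]
        infer_instance
      · exact Module.Finite.equiv ((Submodule.quotEquivOfEq _ _ (LinearMap.range_inl 𝕜 E C)).trans
          ((LinearMap.snd 𝕜 E C).quotKerEquivOfSurjective Prod.snd_surjective)).symm
    have hM := LinearMap.finiteIndex_of_bijective hMb
    have h1 := hD.comp hinl
    have h2 := hM.1.comp h1.1
    have h3 := hfst.comp h2.1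
    have hT' : T'.toLinearMap = LinearMap.fst 𝕜 E N ∘ₗ
        (M.toLinearMap ∘ₗ (D.toLinearMap ∘ₗ LinearMap.inl 𝕜 E C)) := by
      ext x
      exact (h x).symm
    rw [hT']
    refine ⟨h3.1, ?_⟩
    rw [h3.2, h2.2, h1.2, hM.2, hD0]
    ring
  have hone : (1 : E × C →L[𝕜] E × C).toLinearMap.FiniteIndex ∧
      (1 : E × C →L[𝕜] E × C).toLinearMap.algIndex = 0 :=
    LinearMap.finiteIndex_of_bijective Function.bijective_id
  have hadd := hK'.finiteIndex_one_add
  have r1 := corner T 1 hone.1 hone.2 (fun x => by simp [hMx])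
  have r2 := corner (T + K) (1 + K') hadd.1 hadd.2 (fun x => by
    have h1 : M (K' (x, 0)) = (K x, 0) := he _
    have h2 : (1 + K' : E × C →L[𝕜] E × C) (x, 0) = (x, 0) + K' (x, 0) := by simp
    rw [h2, map_add, h1, Prod.fst_add, hMx]
    simp)
  exact ⟨r2.1, r2.2.trans r1.2.symm⟩

/-- An operator whose graph is `{(u, f) | u = J (P u - f)}`, for bounded `J` and `P`, is
parametrized by `g ↦ (J g, P J g - g)`; it is therefore closed, and its Fredholm properties are
those of the bounded operator `P J - 1`. -/
theorem LinearPMap.isFredholm_iff_of_graph {G : E →ₗ.[𝕜] E} {J P : E →L[𝕜] E}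
    (hG : ∀ u f, (u, f) ∈ G.graph ↔ u = J (P u - f)) :
    (G.IsFredholm ↔ (P * J - 1 : E →L[𝕜] E).toLinearMap.FiniteIndex) ∧
      (G.IsFredholm → G.index = (P * J - 1 : E →L[𝕜] E).toLinearMap.algIndex) := by
  set S : E →L[𝕜] E := P * J - 1 with hS
  have hSx (g : E) : S g = P (J g) - g := rfl
  have hgr (g : E) : (J g, S g) ∈ G.graph := by rw [hG, hSx, sub_sub_cancel]
  have hdom (g : E) : J g ∈ G.domain := LinearPMap.mem_domain_of_mem_graph (hgr g)
  let e : E →ₗ[𝕜] G.domain := LinearMap.codRestrict G.domain J.toLinearMap hdom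
  have hGe (g : E) : G.toFun (e g) = S g :=
    (LinearPMap.image_iff (hdom g)).2 (hgr g) |>.symm
  have hcomp : S.toLinearMap = G.toFun ∘ₗ e := by
    ext g
    exact (hGe g).symm
  have he : Function.Bijective e := by
    constructor
    · rw [injective_iff_map_eq_zero]
      intro g hg
      have h0 : J g = 0 := congrArg Subtype.val hg
      have h1 : S g = 0 := by
        rw [← hGe, hg]
        exact LinearMap.map_zero _
      have h2 : P (0 : E) = 0 := ContinuousLinearMap.map_zero P
      rwa [hSx, h0, h2, zero_sub, neg_eq_zero] at h1
    · rintro ⟨u, hu⟩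
      obtain ⟨f, hf⟩ := LinearPMap.mem_domain_iff.1 hu
      exact ⟨P u - f, Subtype.ext ((hG u f).1 hf).symm⟩
  let e' := LinearEquiv.ofBijective e he
  have hcomp' : G.toFun = S.toLinearMap ∘ₗ e'.symm.toLinearMap := by
    rw [hcomp]
    ext u
    change _ = G.toFun (e' (e'.symm u))
    rw [e'.apply_symm_apply]
  have hes := LinearMap.finiteIndex_of_bijective (f := e'.symm.toLinearMap) e'.symm.bijective
  have hrange : LinearMap.range G.toFun = LinearMap.range S.toLinearMap := by
    rw [hcomp', LinearMap.range_comp_of_range_eq_top]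
    exact LinearMap.range_eq_top.2 e'.symm.surjective
  have hclosed : G.IsClosed := by
    have : (G.graph : Set (E × E)) = {q | q.1 = J (P q.1 - q.2)} := by
      ext ⟨u, f⟩
      exact hG u f
    rw [LinearPMap.IsClosed, this]
    exact isClosed_eq (by fun_prop) (by fun_prop)
  have hiff : G.IsFredholm ↔ S.toLinearMap.FiniteIndex := by
    constructor
    · intro h
      rw [hcomp]
      exact (LinearMap.FiniteIndex.comp ⟨h.finite_ker, h.finite_coker⟩
        (LinearMap.finiteIndex_of_bijective he).1).1
    · intro h
      have h' := (h.comp hes.1).1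
      rw [← hcomp'] at h'
      refine ⟨hclosed, h'.finite_ker, ?_, h'.finite_coker⟩
      rw [hrange]
      exact h.isClosed_range
  refine ⟨hiff, fun h => ?_⟩
  have h1 := ((hiff.1 h).comp hes.1).2
  rw [← hcomp', hes.2, add_zero] at h1
  exact h1

/-- The perturbation theorem behind the invariance of the index: if `‖B J‖ < 1` and `J B J` is
compact, then `(c + B) J - 1 = (c J - 1)(1 - B J) + c J B J` is an invertible modification of
`c J - 1` up to a compact operator. Compactness of `B J` itself is not needed. -/
theorem ContinuousLinearMap.finiteIndex_perturb {J B : E →L[𝕜] E} (c : 𝕜) (hBJ : ‖B * J‖ < 1)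
    (hc : IsCompactOperator (J * B * J : E →L[𝕜] E)) :
    ((((c • 1 + B) * J - 1 : E →L[𝕜] E).toLinearMap.FiniteIndex ↔
        ((c • 1) * J - 1 : E →L[𝕜] E).toLinearMap.FiniteIndex)) ∧
      (((c • 1) * J - 1 : E →L[𝕜] E).toLinearMap.FiniteIndex →
        ((c • 1) * J - 1 : E →L[𝕜] E).toLinearMap.algIndex =
          ((c • 1 + B) * J - 1 : E →L[𝕜] E).toLinearMap.algIndex) := by
  set S : E →L[𝕜] E := (c • 1) * J - 1 with hS
  set S' : E →L[𝕜] E := (c • 1 + B) * J - 1 with hS'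
  set K : E →L[𝕜] E := c • (J * B * J) with hKdef
  have hK : IsCompactOperator K := hc.smul c
  let v : (E →L[𝕜] E)ˣ := Units.oneSub (B * J) hBJ
  have hv : (v : E →L[𝕜] E) = 1 - B * J := rfl
  have hSS' : S' = S * v + K := by
    rw [hS, hS', hv, hKdef]
    simp only [smul_mul_assoc, one_mul, add_mul, mul_sub, sub_mul, mul_one, mul_assoc]
    abel
  have hbij (w : (E →L[𝕜] E)ˣ) : Function.Bijective (w : E →L[𝕜] E).toLinearMap :=
    ContinuousLinearMap.isUnit_iff_bijective.1 w.isUnit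
  have hright (T : E →L[𝕜] E) (w : (E →L[𝕜] E)ˣ) (hT : T.toLinearMap.FiniteIndex) :
      (T * w : E →L[𝕜] E).toLinearMap.FiniteIndex ∧
        (T * w : E →L[𝕜] E).toLinearMap.algIndex = T.toLinearMap.algIndex := by
    have hw := LinearMap.finiteIndex_of_bijective (hbij w)
    have := hT.comp hw.1
    rw [hw.2, add_zero] at this
    exact this
  have hfwd (h : S.toLinearMap.FiniteIndex) :
      S'.toLinearMap.FiniteIndex ∧ S'.toLinearMap.algIndex = S.toLinearMap.algIndex := by
    have h1 := hright S v h
    have h2 := hK.finiteIndex_add h1.1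
    rw [hSS']
    exact ⟨h2.1, h2.2.trans h1.2⟩
  refine ⟨⟨fun h => ?_, fun h => (hfwd h).1⟩, fun h => (hfwd h).2.symm⟩
  have hSeq : S = (S' + -K) * (v⁻¹ : (E →L[𝕜] E)ˣ) := by
    rw [hSS', add_neg_cancel_right, Units.mul_inv_cancel_right]
  rw [hSeq]
  exact (hright _ v⁻¹ (IsCompactOperator.finiteIndex_add hK.neg h).1).1

end Riesz

/-! ### Evolution families and regular solutions -/

namespace EvolutionFamily

variable {𝕜 : Type*} {X : Type*} [RCLike 𝕜] [NormedAddCommGroup X] [NormedSpace 𝕜 X]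

/-- The extension of an evolution family to all pairs of times by the identity in the range
`t < s`, which makes it jointly continuous on the whole plane. -/
def extend (U : EvolutionFamily 𝕜 X) (t s : ℝ) : X →L[𝕜] X := U (max t s) s

theorem extend_of_le (U : EvolutionFamily 𝕜 X) {t s : ℝ} (h : s ≤ t) : U.extend t s = U t s := by
  rw [extend, max_eq_left h]

/-- The growth bound can be taken with nonnegative rate and positive constant. -/
theorem exists_exp_bound_pos (U : EvolutionFamily 𝕜 X) :
    ∃ ω C : ℝ, 0 ≤ ω ∧ 0 < C ∧ ∀ t τ : ℝ, τ ≤ t → ‖U t τ‖ ≤ C * Real.exp (ω * (t - τ)) := by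
  obtain ⟨ω, C, h⟩ := U.exists_exp_bound
  refine ⟨|ω|, max C 1, abs_nonneg _, by positivity, fun t τ hτ => (h t τ hτ).trans ?_⟩
  have : ω * (t - τ) ≤ |ω| * (t - τ) :=
    mul_le_mul_of_nonneg_right (le_abs_self ω) (sub_nonneg.2 hτ)
  gcongr
  exact le_max_left _ _

theorem exists_extend_bound (U : EvolutionFamily 𝕜 X) (d : ℝ) :
    ∃ M : ℝ, 0 < M ∧ ∀ t s : ℝ, t - s ≤ d → ‖U.extend t s‖ ≤ M := by
  obtain ⟨ω, C, hω, hC, h⟩ := U.exists_exp_bound_pos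
  refine ⟨C * Real.exp (ω * max d 0), by positivity, fun t s hts => ?_⟩
  refine (h _ _ (le_max_right t s)).trans ?_
  gcongr
  rcases le_total t s with hle | hle
  · rw [max_eq_right hle, sub_self]
    exact le_max_right _ _
  · rw [max_eq_left hle]
    exact hts.trans (le_max_left _ _)

theorem continuous_extend (U : EvolutionFamily 𝕜 X) :
    Continuous fun q : X × (ℝ × ℝ) => U.extend q.2.1 q.2.2 q.1 := by
  obtain ⟨ω, C, hω, hC, h⟩ := U.exists_exp_bound_pos
  -- Dividing by the exponential bound gives a uniformly Lipschitz family.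
  let e (r : ℝ × ℝ) : ℝ := Real.exp (-(ω * (max r.1 r.2 - r.2)))
  have he : Continuous e := by fun_prop
  have hW : Continuous fun q : X × (ℝ × ℝ) => (e q.2 : 𝕜) • U.extend q.2.1 q.2.2 q.1 := by
    refine continuous_prod_of_continuous_lipschitzWith _ C.toNNReal (fun x => ?_) (fun r => ?_)
    · refine (RCLike.continuous_ofReal.comp he).smul ?_
      exact (U.continuousOn_apply x).comp_continuous
        (f := fun r : ℝ × ℝ => ((max r.1 r.2, r.2) : ℝ × ℝ)) (by fun_prop)
        (fun r => le_max_right r.1 r.2)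
    · refine (((e r : 𝕜) • U.extend r.1 r.2).lipschitz).weaken ?_
      rw [← NNReal.coe_le_coe, coe_nnnorm, norm_smul, Real.coe_toNNReal _ hC.le, RCLike.norm_ofReal,
        abs_of_pos (Real.exp_pos _)]
      calc e r * ‖U.extend r.1 r.2‖
          ≤ e r * (C * Real.exp (ω * (max r.1 r.2 - r.2))) := by
            gcongr
            exact h _ _ (le_max_right _ _)
        _ = C := by
            simp only [e]
            rw [mul_left_comm, ← Real.exp_add]
            simp
  have hinv : Continuous fun q : X × (ℝ × ℝ) => (((e q.2)⁻¹ : ℝ) : 𝕜) :=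
    RCLike.continuous_ofReal.comp
      ((he.comp continuous_snd).inv₀ (fun q => (Real.exp_pos _).ne'))
  convert hinv.smul hW using 2 with q
  change _ = (((e q.2)⁻¹ : ℝ) : 𝕜) • (e q.2 : 𝕜) • U.extend q.2.1 q.2.2 q.1
  rw [smul_smul, ← RCLike.ofReal_mul, inv_mul_cancel₀ (Real.exp_pos _).ne', RCLike.ofReal_one,
    one_smul]

theorem continuous_extend_comp (U : EvolutionFamily 𝕜 X) {Y : Type*} [TopologicalSpace Y]
    {a b : Y → ℝ} {x : Y → X} (ha : Continuous a) (hb : Continuous b) (hx : Continuous x) :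
    Continuous fun y => U.extend (a y) (b y) (x y) :=
  U.continuous_extend.comp (hx.prodMk (ha.prodMk hb))

theorem memLp_extend_apply (U : EvolutionFamily 𝕜 X) {p : ℝ≥0∞} {τ T : ℝ} {g : ℝ → X}
    (hg : MemLp g p (volume.restrict (Icc τ T))) :
    MemLp (fun s => U.extend T s (g s)) p (volume.restrict (Icc τ T)) := by
  obtain ⟨M, hM, h⟩ := U.exists_extend_bound (T - τ)
  refine hg.of_le_mul (c := M) ?_ ?_
  · exact U.continuous_extend.comp_aestronglyMeasurable
      (hg.aestronglyMeasurable.prodMk (aestronglyMeasurable_const.prodMk aestronglyMeasurable_id))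
  · filter_upwards [ae_restrict_mem measurableSet_Icc] with s hs
    exact ((U.extend T s).le_opNorm _).trans (by gcongr; exact h _ _ (by linarith [hs.1]))

end EvolutionFamily

section RegularSolution

variable {X : Type*} [NormedAddCommGroup X]

theorem MeasureTheory.MemLp.intervalIntegrable_Icc {p : ℝ≥0∞} (hp : 1 ≤ p) {v : ℝ → X} {τ T : ℝ}
    (hv : MemLp v p (volume.restrict (Icc τ T))) {a b : ℝ} (ha : a ∈ Icc τ T) (hb : b ∈ Icc τ T) :
    IntervalIntegrable v volume a b := by
  have h1 : IntegrableOn v (Icc τ T) := hv.integrable hp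
  exact (h1.mono_set (uIcc_subset_Icc ha hb)).intervalIntegrable

variable [NormedSpace ℝ X] [CompleteSpace X]

/-- Integration by parts against `s ↦ s - a` for a primitive of an integrable function. -/
theorem intervalIntegral.sub_smul_primitive {v : ℝ → X} {a t : ℝ} (hat : a ≤ t)
    (hv : IntervalIntegrable v volume a t) (z : X) :
    (t - a) • (z + ∫ s in a..t, v s) =
      ∫ s in a..t, ((z + ∫ r in a..s, v r) + (s - a) • v s) := by
  have hprim : ContinuousOn (fun s => ∫ r in a..s, v r) (uIcc a t) :=
    intervalIntegral.continuousOn_primitive_interval' hv left_mem_uIcc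
  have h1 : IntervalIntegrable (fun s => ∫ r in a..s, v r) volume a t := hprim.intervalIntegrable
  have h2 : IntervalIntegrable (fun s => (s - a) • v s) volume a t :=
    hv.continuousOn_smul (by fun_prop)
  have h3 : IntervalIntegrable (fun s => (t - s) • v s) volume a t :=
    hv.continuousOn_smul (by fun_prop)
  -- Fubini over the triangle `a < r ≤ s < t`.
  have hswap : ∫ s in a..t, ∫ r in a..s, v r = ∫ s in a..t, (t - s) • v s := by
    let F : ℝ → ℝ → X := fun s r => if r ≤ s then v r else 0
    have : IsFiniteMeasure (volume.restrict (uIoc a t)) := by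
      rw [uIoc_of_le hat]
      infer_instance
    have hint : IntegrableOn (Function.uncurry F) (uIoc a t ×ˢ uIoc a t) := by
      rw [IntegrableOn, Measure.volume_eq_prod, ← Measure.prod_restrict]
      have hb : Integrable (fun q : ℝ × ℝ => v q.2)
          ((volume.restrict (uIoc a t)).prod (volume.restrict (uIoc a t))) :=
        (intervalIntegrable_iff.1 hv).integrable.comp_snd _
      have : Function.uncurry F = {q : ℝ × ℝ | q.2 ≤ q.1}.indicator (fun q => v q.2) := by
        ext ⟨s, r⟩
        simp [F, Function.uncurry, indicator]
      rw [this]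
      exact hb.indicator (measurableSet_le measurable_snd measurable_fst)
    have hs := intervalIntegral_intervalIntegral_swap (F := F) (a := a) (b := t) (c := a) (d := t)
      hint
    have e1 : ∀ s ∈ uIcc a t, ∫ r in a..t, F s r = ∫ r in a..s, v r := by
      intro s hs
      rw [uIcc_of_le hat] at hs
      rw [intervalIntegral.integral_of_le hat, intervalIntegral.integral_of_le hs.1]
      have : (fun r => F s r) = (Iic s).indicator v := by
        ext r
        simp [F, indicator]
      rw [this, setIntegral_indicator measurableSet_Iic, Ioc_inter_Iic, min_eq_right hs.2]
    have e2 : ∀ r ∈ uIcc a t, ∫ s in a..t, F s r = (t - r) • v r := by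
      intro r hr
      rw [uIcc_of_le hat] at hr
      rw [intervalIntegral.integral_of_le hat, integral_Ioc_eq_integral_Ioo,
        ← integral_Ico_eq_integral_Ioo]
      have : (fun s => F s r) = (Ici r).indicator (fun _ => v r) := by
        ext s
        simp [F, indicator]
      rw [this, setIntegral_indicator measurableSet_Ici, Ico_inter_Ici, max_eq_right hr.1,
        setIntegral_const]
      simp [measureReal_def, ENNReal.toReal_ofReal (sub_nonneg.2 hr.2)]
    rw [intervalIntegral.integral_congr e1, intervalIntegral.integral_congr e2] at hs
    exact hs
  have h4 : IntervalIntegrable (fun s => z + ∫ r in a..s, v r) volume a t :=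
    (continuousOn_const.add hprim).intervalIntegrable
  rw [intervalIntegral.integral_add h4 h2,
    intervalIntegral.integral_add (by simp) h1, hswap, add_assoc,
    ← intervalIntegral.integral_add h3 h2, intervalIntegral.integral_const, smul_add,
    ← intervalIntegral.integral_smul]
  congr 1
  refine intervalIntegral.integral_congr fun s _ => ?_
  simp only [← add_smul]
  congr 1
  ring

end RegularSolution

namespace IsRegularSolution

variable {𝕜 : Type*} {X : Type*} [RCLike 𝕜] [NormedAddCommGroup X] [NormedSpace 𝕜 X]
  [NormedSpace ℝ X] {p : ℝ≥0∞} {A : ℝ → X →ₗ.[𝕜] X} {f g u w : ℝ → X} {τ b T : ℝ}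

theorem sub (hp : 1 ≤ p) (hτT : τ ≤ T) (hu : IsRegularSolution p A f u τ T)
    (hw : IsRegularSolution p A g w τ T) :
    IsRegularSolution p A (fun t => f t - g t) (fun t => u t - w t) τ T := by
  obtain ⟨hu1, hu2, v, hv1, hv2, hv3⟩ := hu
  obtain ⟨hw1, hw2, v', hv1', hv2', hv3'⟩ := hw
  refine ⟨fun t ht => (A t).domain.sub_mem (hu1 t ht) (hw1 t ht), hu2.sub hw2,
    fun t => v t - v' t, hv1.sub hv1', fun t ht => ?_, ?_⟩
  · rw [intervalIntegral.integral_sub (hv1.intervalIntegrable_Icc hp (left_mem_Icc.2 hτT) ht)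
      (hv1'.intervalIntegrable_Icc hp (left_mem_Icc.2 hτT) ht)]
    change u t - w t = u τ - w τ + _
    rw [hv2 t ht, hv2' t ht]
    abel
  · filter_upwards [hv3, hv3'] with t h h'
    have := (A t).graph.sub_mem h h'
    rw [Prod.mk_sub_mk] at this
    convert this using 2
    abel

/-- Regular solutions on adjacent intervals that agree at the common endpoint can be glued. -/
theorem concat (hp : 1 ≤ p) (hτb : τ ≤ b) (hbT : b ≤ T) (hu : IsRegularSolution p A f u τ b)
    (hw : IsRegularSolution p A g w b T) (h : u b = w b) :
    IsRegularSolution p A ((Iic b).piecewise f g) ((Iic b).piecewise u w) τ T := by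
  obtain ⟨hu1, hu2, v, hv1, hv2, hv3⟩ := hu
  obtain ⟨hw1, hw2, v', hv1', hv2', hv3'⟩ := hw
  have hI1 : Iic b ∩ Icc τ T = Icc τ b := by
    ext t
    simp only [mem_inter_iff, mem_Iic, mem_Icc]
    constructor
    · rintro ⟨h1, h2, h3⟩
      exact ⟨h2, h1⟩
    · rintro ⟨h1, h2⟩
      exact ⟨h2, h1, h2.trans hbT⟩
  have hI2 : (Iic b)ᶜ ∩ Icc τ T ⊆ Icc b T := by
    rintro t ⟨h1, h2⟩
    exact ⟨(not_le.1 (fun h => h1 h)).le, h2.2⟩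
  have hmem {a c : ℝ → X} (ha : MemLp a p (volume.restrict (Icc τ b)))
      (hc : MemLp c p (volume.restrict (Icc b T))) :
      MemLp ((Iic b).piecewise a c) p (volume.restrict (Icc τ T)) := by
    refine MemLp.piecewise measurableSet_Iic ?_ ?_
    · rwa [Measure.restrict_restrict measurableSet_Iic, hI1]
    · rw [Measure.restrict_restrict measurableSet_Iic.compl]
      exact hc.mono_measure (Measure.restrict_mono hI2 le_rfl)
  have hV := hmem hv1 hv1'
  have hτ : (Iic b).piecewise u w τ = u τ := piecewise_eq_of_mem (Iic b) _ _ hτb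
  have hint1 {t : ℝ} (hτt : τ ≤ t) (ht : t ≤ b) :
      ∫ s in τ..t, (Iic b).piecewise v v' s = ∫ s in τ..t, v s := by
    refine intervalIntegral.integral_congr fun s hs => ?_
    rw [uIcc_of_le hτt] at hs
    exact piecewise_eq_of_mem (Iic b) _ _ (hs.2.trans ht)
  refine ⟨fun t ht => ?_, hmem hu2 hw2, (Iic b).piecewise v v', hV, fun t ht => ?_, ?_⟩
  · by_cases htb : t ≤ b
    · rw [piecewise_eq_of_mem (Iic b) _ _ htb]
      exact hu1 t ⟨ht.1, htb⟩
    · rw [piecewise_eq_of_notMem (Iic b) _ _ htb]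
      exact hw1 t ⟨(not_le.1 htb).le, ht.2⟩
  · rw [hτ]
    by_cases htb : t ≤ b
    · rw [piecewise_eq_of_mem (Iic b) _ _ htb, hint1 ht.1 htb]
      exact hv2 t ⟨ht.1, htb⟩
    · have hbt : b ≤ t := (not_le.1 htb).le
      have hτ' : τ ∈ Icc τ T := ⟨le_rfl, hτb.trans hbT⟩
      have hb' : b ∈ Icc τ T := ⟨hτb, hbT⟩
      rw [piecewise_eq_of_notMem (Iic b) _ _ htb, hv2' t ⟨hbt, ht.2⟩, ← h, hv2 b ⟨hτb, le_rfl⟩,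
        ← intervalIntegral.integral_add_adjacent_intervals (hV.intervalIntegrable_Icc hp hτ' hb')
          (hV.intervalIntegrable_Icc hp hb' ht), hint1 hτb le_rfl, add_assoc]
      congr 2
      rw [intervalIntegral.integral_of_le hbt, intervalIntegral.integral_of_le hbt]
      refine setIntegral_congr_fun measurableSet_Ioc fun s hs => ?_
      exact (piecewise_eq_of_notMem (Iic b) _ _ (not_le.2 hs.1)).symm
  · rw [ae_restrict_iff' measurableSet_Icc] at hv3 hv3' ⊢
    filter_upwards [hv3, hv3'] with t h1 h2 ht
    by_cases htb : t ≤ b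
    · simp only [piecewise_eq_of_mem (Iic b) _ _ htb]
      exact h1 ⟨ht.1, htb⟩
    · simp only [piecewise_eq_of_notMem (Iic b) _ _ htb]
      exact h2 ⟨(not_le.1 htb).le, ht.2⟩

end IsRegularSolution

/-! ### Variation of constants -/

theorem ContinuousOn.memLp_restrict_Icc {X : Type*} [NormedAddCommGroup X] {p : ℝ≥0∞} {a b : ℝ}
    {f : ℝ → X} (hf : ContinuousOn f (Icc a b)) : MemLp f p (volume.restrict (Icc a b)) := by
  obtain ⟨C, hC⟩ := isCompact_Icc.exists_bound_of_continuousOn hf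
  refine MemLp.of_bound (hf.aestronglyMeasurable measurableSet_Icc) C ?_
  filter_upwards [ae_restrict_mem measurableSet_Icc] with t ht using hC t ht

namespace IsWellPosedWith

variable {𝕜 : Type*} {X : Type*} [RCLike 𝕜] [NormedAddCommGroup X] [NormedSpace 𝕜 X]
  [NormedSpace ℝ X] {p : ℝ≥0∞} {A : ℝ → X →ₗ.[𝕜] X} {U : EvolutionFamily 𝕜 X}

/-- Variation of constants over one short interval with the inhomogeneity frozen along the flow:
`w(t) = U(t, a)y + (t - a)U(t, a)z` is a regular solution of `w' = A(t)w + U(t, a)z`. No closedness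
of the operators `A(t)` is needed. -/
theorem isRegularSolution_affine [IsScalarTower ℝ 𝕜 X] [CompleteSpace X] (hp : 1 ≤ p)
    (hA : IsWellPosedWith p A U) {a b : ℝ} (hab : a ≤ b) {y z : X} (hy : y ∈ (A a).domain)
    (hz : z ∈ (A a).domain) :
    IsRegularSolution p A (fun t => U t a z) (fun t => U t a y + (t - a) • U t a z) a b := by
  obtain ⟨hy1, -, v, hv1, hv2, hv3⟩ := hA.existence a y hy b hab
  obtain ⟨hz1, -, w, hw1, hw2, hw3⟩ := hA.existence a z hz b hab
  simp only [U.self_eq_id, ContinuousLinearMap.id_apply] at hv2 hw2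
  have hcont : ContinuousOn (fun t => U t a z) (Icc a b) :=
    (U.continuousOn_apply z).comp (f := fun t : ℝ => ((t, a) : ℝ × ℝ)) (by fun_prop)
      (fun t ht => ht.1)
  have hmul : MemLp (fun t => (t - a) • w t) p (volume.restrict (Icc a b)) := by
    refine hw1.of_le_mul (c := b - a)
      ((by fun_prop : Continuous fun t : ℝ => t - a).aestronglyMeasurable.smul
        hw1.aestronglyMeasurable) ?_
    filter_upwards [ae_restrict_mem measurableSet_Icc] with t ht
    rw [norm_smul, Real.norm_of_nonneg (sub_nonneg.2 ht.1)]
    gcongr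
    exact ht.2
  refine ⟨fun t ht => ?_, hcont.memLp_restrict_Icc,
    fun t => v t + (U t a z + (t - a) • w t), hv1.add (hcont.memLp_restrict_Icc.add hmul),
    fun t ht => ?_, ?_⟩
  · simp only [RCLike.real_smul_eq_coe_smul (K := 𝕜)]
    exact (A t).domain.add_mem (hy1 t ht) ((A t).domain.smul_mem _ (hz1 t ht))
  · have ha : a ∈ Icc a b := ⟨le_rfl, hab⟩
    have h1 : ∫ s in a..t, (U s a z + (s - a) • w s) =
        ∫ s in a..t, ((z + ∫ r in a..s, w r) + (s - a) • w s) := by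
      refine intervalIntegral.integral_congr fun s hs => ?_
      rw [uIcc_of_le ht.1] at hs
      rw [← hw2 s ⟨hs.1, hs.2.trans ht.2⟩]
    have h2 : MemLp (fun t => U t a z + (t - a) • w t) p (volume.restrict (Icc a b)) :=
      hcont.memLp_restrict_Icc.add hmul
    change U t a y + (t - a) • U t a z = U a a y + (a - a) • U a a z + _
    rw [intervalIntegral.integral_add (hv1.intervalIntegrable_Icc hp ha ht)
      (h2.intervalIntegrable_Icc hp ha ht), h1,
      ← intervalIntegral.sub_smul_primitive ht.1 (hw1.intervalIntegrable_Icc hp ha ht)]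
    simp only [U.self_eq_id, ContinuousLinearMap.id_apply, sub_self, zero_smul, add_zero]
    rw [hv2 t ht, hw2 t ht]
    abel
  · filter_upwards [hv3, hw3] with t h h'
    have := (A t).graph.add_mem h ((A t).graph.smul_mem ((t - a : ℝ) : 𝕜) h')
    rw [Prod.smul_mk, Prod.mk_add_mk, ← RCLike.real_smul_eq_coe_smul,
      ← RCLike.real_smul_eq_coe_smul] at this
    convert this using 2
    simp only [sub_zero]
    abel

/-- A continuous inhomogeneity is approximated, uniformly on short intervals, by orbits
`s ↦ U(s, a)z` with `z` in the common domain. -/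
theorem exists_orbit_approx (hA : IsWellPosedWith p A U) {f : ℝ → X} (hf : Continuous f) (τ T : ℝ)
    {ε : ℝ} (hε : 0 < ε) :
    ∃ δ > 0, ∀ a ∈ Icc τ T, ∃ z ∈ (A a).domain, ∀ s ∈ Icc a T, s ≤ a + δ →
      ‖U s a z - f s‖ ≤ ε := by
  obtain ⟨D, hD, hAD⟩ := hA.common_domain
  obtain ⟨M, hM, hUM⟩ := U.exists_extend_bound (T - τ)
  let Φ : ℝ × ℝ → X := fun q => U.extend q.2 q.1 (f q.1) - f q.2
  have hΦ : Continuous Φ :=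
    (U.continuous_extend_comp continuous_snd continuous_fst (hf.comp continuous_fst)).sub
      (hf.comp continuous_snd)
  have hunif := (isCompact_Icc.prod isCompact_Icc :
    IsCompact (Icc τ T ×ˢ Icc τ T)).uniformContinuousOn_of_continuous hΦ.continuousOn
  rw [Metric.uniformContinuousOn_iff] at hunif
  obtain ⟨δ, hδ, h⟩ := hunif (ε / 2) (by positivity)
  refine ⟨δ / 2, by positivity, fun a ha => ?_⟩
  obtain ⟨z, hzD, hz⟩ := Metric.mem_closure_iff.1 (hD (f a)) (ε / (2 * M)) (by positivity)
  refine ⟨z, by rw [hAD]; exact hzD, fun s hs hsa => ?_⟩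
  have hsT : s ∈ Icc τ T := ⟨ha.1.trans hs.1, hs.2⟩
  have h1 : ‖Φ (a, s)‖ ≤ ε / 2 := by
    have := h (a, s) ⟨ha, hsT⟩ (a, a) ⟨ha, ha⟩ (by
      rw [Prod.dist_eq, dist_self, Real.dist_eq, abs_of_nonneg (sub_nonneg.2 hs.1)]
      exact max_lt hδ (by linarith))
    have h0 : Φ (a, a) = 0 := by simp [Φ, U.extend_of_le le_rfl, U.self_eq_id]
    rw [h0, dist_zero_right] at this
    exact this.le
  have h2 : ‖U.extend s a (z - f a)‖ ≤ ε / 2 := by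
    refine ((U.extend s a).le_opNorm _).trans ?_
    calc ‖U.extend s a‖ * ‖z - f a‖ ≤ M * (ε / (2 * M)) := by
          gcongr
          · exact hUM _ _ (by linarith [ha.1, hs.2])
          · rw [← dist_eq_norm, dist_comm]
            exact hz.le
      _ = ε / 2 := by field_simp
  have h3 : U s a z - f s = U.extend s a (z - f a) + Φ (a, s) := by
    simp only [Φ, map_sub, U.extend_of_le hs.1]
    abel
  rw [h3]
  exact (norm_add_le _ _).trans (by linarith)

/-- Polygonal approximation of the mild solution: gluing affine pieces gives a regular solution `w`
whose inhomogeneity `g` is uniformly close to a given `f`, and which satisfies the variation of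
constants formula. -/
theorem exists_approx_mild [IsScalarTower ℝ 𝕜 X] [CompleteSpace X] (hp : 1 ≤ p)
    (hA : IsWellPosedWith p A U) {f : ℝ → X} (hf : Continuous f) {τ T : ℝ} (hτT : τ ≤ T)
    {x : X} (hx : x ∈ (A τ).domain) {ε : ℝ} (hε : 0 < ε) :
    ∃ g w : ℝ → X, IsRegularSolution p A g w τ T ∧ w τ = x ∧
      (∀ t ∈ Icc τ T, ‖g t - f t‖ ≤ ε) ∧
        w T = U T τ x + ∫ s in τ..T, U.extend T s (g s) := by
  obtain ⟨D, hD, hAD⟩ := hA.common_domain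
  obtain ⟨δ, hδ, hz⟩ := hA.exists_orbit_approx hf τ T hε
  obtain ⟨N, hN⟩ := exists_nat_gt ((T - τ) / δ)
  have hN0 : (0 : ℝ) < N := lt_of_le_of_lt (div_nonneg (sub_nonneg.2 hτT) hδ.le) hN
  let d : ℝ := (T - τ) / N
  have hd0 : 0 ≤ d := div_nonneg (sub_nonneg.2 hτT) hN0.le
  have hdδ : d ≤ δ := by
    rw [div_lt_iff₀ hδ] at hN
    rw [div_le_iff₀ hN0]
    linarith
  have hdN : τ + N * d = T := by
    simp only [d]
    field_simp
    ring
  suffices H : ∀ n : ℕ, n ≤ N → ∃ g w : ℝ → X, IsRegularSolution p A g w τ (τ + n * d) ∧ w τ = x ∧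
      (∀ t ∈ Icc τ (τ + n * d), ‖g t - f t‖ ≤ ε) ∧
        w (τ + n * d) = U (τ + n * d) τ x +
          ∫ s in τ..(τ + n * d), U.extend (τ + n * d) s (g s) by
    have := H N le_rfl
    rwa [hdN] at this
  intro n
  induction n with
  | zero =>
    intro _
    refine ⟨f, fun _ => x, ?_, rfl, fun t _ => by simp [hε.le], ?_⟩
    · have h0 : (volume.restrict (Icc τ (τ + ((0 : ℕ) : ℝ) * d))) = 0 := by simp
      rw [IsRegularSolution, h0]
      refine ⟨fun t _ => ?_, by simp, 0, by simp, by simp, by simp⟩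
      rwa [hAD, ← hAD τ]
    · simp [U.self_eq_id]
  | succ n ih =>
    intro hn
    obtain ⟨g, w, hw, hwx, hg, hmild⟩ := ih (by omega)
    set a : ℝ := τ + n * d with ha
    have hab : τ + ((n + 1 : ℕ) : ℝ) * d = a + d := by
      push_cast
      ring
    rw [hab]
    set b : ℝ := a + d with hb
    have hτa : τ ≤ a := by
      have : 0 ≤ n * d := by positivity
      linarith
    have hba : a ≤ b := by linarith
    have hbT : b ≤ T := by
      rw [← hab, ← hdN]
      gcongr
    have haT : a ∈ Icc τ T := ⟨hτa, hba.trans hbT⟩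
    obtain ⟨z, hzD, hz⟩ := hz a haT
    have hwa : w a ∈ (A a).domain := hw.1 a ⟨hτa, le_rfl⟩
    have haff := hA.isRegularSolution_affine hp hba hwa hzD
    have hcat := hw.concat hp hτa hba haff (by simp [U.self_eq_id])
    refine ⟨_, _, hcat, ?_, fun t ht => ?_, ?_⟩
    · rw [piecewise_eq_of_mem (Iic a) _ _ hτa, hwx]
    · by_cases hta : t ≤ a
      · rw [piecewise_eq_of_mem (Iic a) _ _ hta]
        exact hg t ⟨ht.1, hta⟩
      · rw [piecewise_eq_of_notMem (Iic a) _ _ hta]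
        exact hz t ⟨(not_le.1 hta).le, ht.2.trans hbT⟩ (by linarith [ht.2])
    · set G := (Iic a).piecewise g fun t => U t a z with hG
      have hGint := U.memLp_extend_apply hcat.2.1
      have hI (c e : ℝ) (hc : c ∈ Icc τ b) (he : e ∈ Icc τ b) :
          IntervalIntegrable (fun s => U.extend b s (G s)) volume c e :=
        hGint.intervalIntegrable_Icc hp hc he
      have hτm : τ ∈ Icc τ b := ⟨le_rfl, hτa.trans hba⟩
      have ham : a ∈ Icc τ b := ⟨hτa, hba⟩
      have hbm : b ∈ Icc τ b := ⟨hτa.trans hba, le_rfl⟩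
      have e1 : ∫ s in τ..a, U.extend b s (G s) = U b a (∫ s in τ..a, U.extend a s (g s)) := by
        rw [← ContinuousLinearMap.intervalIntegral_comp_comm _
          ((U.memLp_extend_apply hw.2.1).intervalIntegrable_Icc hp ⟨le_rfl, hτa⟩ ⟨hτa, le_rfl⟩)]
        refine intervalIntegral.integral_congr fun s hs => ?_
        rw [uIcc_of_le hτa] at hs
        simp only [hG]
        rw [piecewise_eq_of_mem (Iic a) _ _ hs.2, U.extend_of_le (hs.2.trans hba),
          U.extend_of_le hs.2, U.comp_eq b a s hs.2 hba]
        rfl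
      have e2 : ∫ s in a..b, U.extend b s (G s) = (b - a) • U b a z := by
        rw [← intervalIntegral.integral_const, intervalIntegral.integral_of_le hba,
          intervalIntegral.integral_of_le hba]
        refine setIntegral_congr_fun measurableSet_Ioc fun s hs => ?_
        simp only [hG]
        rw [piecewise_eq_of_notMem (Iic a) _ _ (not_le.2 hs.1), U.extend_of_le hs.2,
          U.comp_eq b s a hs.1.le hs.2]
        rfl
      rw [← intervalIntegral.integral_add_adjacent_intervals (hI τ a hτm ham) (hI a b ham hbm),
        e1, e2, U.comp_eq b a τ hτa hba, ContinuousLinearMap.comp_apply]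
      have hwb : (Iic a).piecewise w (fun t => U t a (w a) + (t - a) • U t a z) b =
          U b a (w a) + (b - a) • U b a z := by
        by_cases hba' : b ≤ a
        · have hEq : b = a := le_antisymm hba' hba
          rw [piecewise_eq_of_mem (Iic a) _ _ hba', hEq]
          simp [U.self_eq_id]
        · rw [piecewise_eq_of_notMem (Iic a) _ _ hba']
      rw [hwb, hmild, map_add]
      abel

/-- A regular solution with continuous inhomogeneity satisfies the variation of constants formula:
by continuous dependence it is close to the polygonal approximations, which satisfy the formula for
a nearby inhomogeneity. -/
theorem variation_of_constants [IsScalarTower ℝ 𝕜 X] [CompleteSpace X] (hp : 1 ≤ p)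
    (hA : IsWellPosedWith p A U) {f u : ℝ → X} (hf : Continuous f) {τ T : ℝ} (hτT : τ ≤ T)
    (hu : IsRegularSolution p A f u τ T) :
    u T = U T τ (u τ) + ∫ s in τ..T, U.extend T s (f s) := by
  obtain ⟨C, hC⟩ := hA.continuous_dependence τ T hτT
  obtain ⟨M, hM, hUM⟩ := U.exists_extend_bound (T - τ)
  have hfint : IntervalIntegrable (fun s => U.extend T s (f s)) volume τ T :=
    (U.continuous_extend_comp continuous_const continuous_id hf).intervalIntegrable _ _
  set V : ℝ := (volume (Icc τ T)).toReal ^ (p.toReal⁻¹) with hV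
  have hbound : ∀ ε > 0, ‖u T - (U T τ (u τ) + ∫ s in τ..T, U.extend T s (f s))‖ ≤
      ε * (|C| * V + M * (T - τ)) := by
    intro ε hε
    have hτm : τ ∈ Icc τ T := ⟨le_rfl, hτT⟩
    have hTm : T ∈ Icc τ T := ⟨hτT, le_rfl⟩
    obtain ⟨g, w, hw, hwx, hg, hmild⟩ := hA.exists_approx_mild hp hf hτT (hu.1 τ hτm) hε
    have h1 := hC _ _ (hu.sub hp hτT hw) T hTm
    have h2 : (eLpNorm (fun t => f t - g t) p (volume.restrict (Icc τ T))).toReal ≤ V * ε := by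
      have h3 : ∀ᵐ t ∂volume.restrict (Icc τ T), ‖f t - g t‖ ≤ ε := by
        filter_upwards [ae_restrict_mem measurableSet_Icc] with t ht
        rw [norm_sub_rev]
        exact hg t ht
      have h4 := eLpNorm_le_of_ae_bound (p := p) h3
      have h5 : (volume.restrict (Icc τ T)) univ ^ p.toReal⁻¹ ≠ ∞ :=
        ENNReal.rpow_ne_top_of_nonneg (by positivity) (by simp)
      have h6 := ENNReal.toReal_mono (ENNReal.mul_ne_top h5 ENNReal.ofReal_ne_top) h4
      rwa [ENNReal.toReal_mul, ← ENNReal.toReal_rpow, ENNReal.toReal_ofReal hε.le,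
        Measure.restrict_apply_univ] at h6
    rw [hwx, sub_self, norm_zero, zero_add] at h1
    have h7 : ‖u T - w T‖ ≤ |C| * (V * ε) :=
      h1.trans ((mul_le_mul_of_nonneg_right (le_abs_self C) ENNReal.toReal_nonneg).trans
        (by gcongr))
    have hgint : IntervalIntegrable (fun s => U.extend T s (g s)) volume τ T :=
      (U.memLp_extend_apply hw.2.1).intervalIntegrable_Icc hp hτm hTm
    have h8 : ‖∫ s in τ..T, (U.extend T s (g s) - U.extend T s (f s))‖ ≤ M * ε * |T - τ| := by
      refine intervalIntegral.norm_integral_le_of_norm_le_const fun s hs => ?_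
      rw [uIoc_of_le hτT] at hs
      rw [← map_sub]
      refine ((U.extend T s).le_opNorm _).trans ?_
      gcongr
      · exact hUM _ _ (by linarith [hs.1])
      · exact hg s ⟨hs.1.le, hs.2⟩
    rw [intervalIntegral.integral_sub hgint hfint, abs_of_nonneg (sub_nonneg.2 hτT)] at h8
    have h9 : u T - (U T τ (u τ) + ∫ s in τ..T, U.extend T s (f s)) =
        (u T - w T) + ((∫ s in τ..T, U.extend T s (g s)) - ∫ s in τ..T, U.extend T s (f s)) := by
      rw [hmild]
      abel
    rw [h9]
    refine (norm_add_le _ _).trans ((add_le_add h7 h8).trans (le_of_eq ?_))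
    ring
  rw [← sub_eq_zero, ← norm_le_zero_iff]
  set c : ℝ := |C| * V + M * (T - τ) with hc
  have hlim : Tendsto (fun ε : ℝ => ε * c) (𝓝[>] 0) (𝓝 0) := by
    have : Tendsto (fun ε : ℝ => ε * c) (𝓝 0) (𝓝 (0 * c)) := by
      exact (continuous_id.mul continuous_const).tendsto 0
    rw [zero_mul] at this
    exact this.mono_left nhdsWithin_le_nhds
  exact ge_of_tendsto hlim (eventually_mem_nhdsWithin.mono fun ε hε => hbound ε hε)

/-- The Duhamel formula comparing the propagators of `A` and of its bounded perturbation `A + B`.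
For `x` in the common domain, `t ↦ W(t, τ)x` is a regular solution for `A` with inhomogeneity
`B(t)W(t, τ)x`; the general case follows by density. -/
theorem duhamel [IsScalarTower ℝ 𝕜 X] [CompleteSpace X] (hp : 1 ≤ p)
    (hA : IsWellPosedWith p A U) {B : ℝ → X →L[𝕜] X}
    (hBc : Continuous fun q : X × ℝ => B q.2 q.1) {W : EvolutionFamily 𝕜 X}
    (hAB : IsWellPosedWith p (fun t => (B t : X →ₗ[𝕜] X) +ᵥ A t) W) {τ T : ℝ} (hτT : τ ≤ T)
    (x : X) :
    W T τ x = U T τ x + ∫ s in τ..T, U.extend T s (B s (W.extend s τ x)) := by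
  obtain ⟨D, hD, hAD⟩ := hA.common_domain
  have hcont : Continuous fun q : X × ℝ => U.extend T q.2 (B q.2 (W.extend q.2 τ q.1)) :=
    U.continuous_extend_comp continuous_const continuous_snd
      (hBc.comp ((W.continuous_extend_comp continuous_snd continuous_const continuous_fst).prodMk
        continuous_snd))
  have hclosed : IsClosed
      {x | W T τ x = U T τ x + ∫ s in τ..T, U.extend T s (B s (W.extend s τ x))} :=
    isClosed_eq (by fun_prop) ((U T τ).continuous.add
      (intervalIntegral.continuous_parametric_intervalIntegral_of_continuous' hcont _ _))
  refine closure_minimal (fun x hx => ?_) hclosed (hD x)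
  have hx' : x ∈ ((B τ : X →ₗ[𝕜] X) +ᵥ A τ).domain := by
    change x ∈ (A τ).domain
    rw [hAD]
    exact hx
  have hf : Continuous fun t => B t (W.extend t τ x) :=
    hBc.comp ((W.continuous_extend_comp continuous_id continuous_const continuous_const).prodMk
      continuous_id)
  have hreg : IsRegularSolution p A (fun t => B t (W.extend t τ x)) (fun t => W t τ x) τ T := by
    obtain ⟨h1, -, v, h3, h4, h5⟩ := hAB.existence τ x hx' T hτT
    refine ⟨fun t ht => h1 t ht, hf.continuousOn.memLp_restrict_Icc, v, h3, h4, ?_⟩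
    filter_upwards [h5, ae_restrict_mem measurableSet_Icc] with t ht htm
    rw [sub_zero, LinearPMap.mem_graph_iff] at ht
    obtain ⟨y, hy1, hy2⟩ := ht
    rw [LinearPMap.mem_graph_iff]
    refine ⟨⟨y, y.2⟩, hy1, ?_⟩
    simp only at hy1 hy2
    rw [W.extend_of_le htm.1, ← hy2, LinearPMap.vadd_apply, ← hy1]
    simp
  have := hA.variation_of_constants hp hf hτT hreg
  rw [W.self_eq_id, ContinuousLinearMap.id_apply] at this
  exact this

end IsWellPosedWith

/-! ### Multiplication operators and convergence in `L_p` -/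

section LpTools

variable {X : Type*} [NormedAddCommGroup X] {p : ℝ≥0∞}

/-- Dominated convergence to zero in `L_p`, `p < ∞`. -/
theorem MeasureTheory.tendsto_eLpNorm_zero_of_dominated {α ι : Type*} {m : MeasurableSpace α}
    {μ : Measure α} {l : Filter ι} [l.IsCountablyGenerated] (hp0 : p ≠ 0) (hp : p ≠ ∞)
    {F : ι → α → X} {b : α → ℝ} (hF : ∀ᶠ i in l, AEStronglyMeasurable (F i) μ)
    (hb : MemLp b p μ) (hFb : ∀ᶠ i in l, ∀ᵐ a ∂μ, ‖F i a‖ ≤ b a)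
    (hlim : ∀ᵐ a ∂μ, Tendsto (fun i => F i a) l (𝓝 0)) :
    Tendsto (fun i => eLpNorm (F i) p μ) l (𝓝 0) := by
  have hq : 0 < p.toReal := ENNReal.toReal_pos hp0 hp
  have key : Tendsto (fun i => ∫⁻ a, ‖F i a‖ₑ ^ p.toReal ∂μ) l (𝓝 (∫⁻ _, 0 ∂μ)) := by
    refine tendsto_lintegral_filter_of_dominated_convergence'
      (fun a => ‖b a‖ₑ ^ p.toReal) ?_ ?_ ?_ ?_
    · filter_upwards [hF] with i hi using hi.enorm.pow_const _
    · filter_upwards [hFb] with i hi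
      filter_upwards [hi] with a ha
      gcongr
      exact enorm_le_iff_norm_le.2 (ha.trans (le_abs_self _))
    · exact (lintegral_rpow_enorm_lt_top_of_eLpNorm_lt_top hp0 hp hb.2).ne
    · filter_upwards [hlim] with a ha
      have h1 : Tendsto (fun i => ‖F i a‖ₑ) l (𝓝 0) := by
        rw [← enorm_zero (E := X)]
        exact (continuous_enorm.tendsto (0 : X)).comp ha
      have h2 := (ENNReal.continuous_rpow_const (y := p.toReal)).tendsto 0
      rw [ENNReal.zero_rpow_of_pos hq] at h2
      exact h2.comp h1
  simp only [eLpNorm_eq_lintegral_rpow_enorm_toReal hp0 hp]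
  rw [lintegral_zero] at key
  have h2 := (ENNReal.continuous_rpow_const (y := 1 / p.toReal)).tendsto 0
  rw [ENNReal.zero_rpow_of_pos (by positivity)] at h2
  exact h2.comp key

theorem MeasureTheory.Lp.tendsto_of_dominated {α ι : Type*} {m : MeasurableSpace α}
    {μ : Measure α} {l : Filter ι} [l.IsCountablyGenerated] [Fact (1 ≤ p)] (hp : p ≠ ∞)
    {v : ι → Lp X p μ} {w : Lp X p μ} {F : ι → α → X} {f : α → X}
    (hv : ∀ᶠ i in l, v i =ᵐ[μ] F i) (hw : w =ᵐ[μ] f) {b : α → ℝ} (hb : MemLp b p μ)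
    (hFb : ∀ᶠ i in l, ∀ᵐ a ∂μ, ‖F i a - f a‖ ≤ b a)
    (hlim : ∀ᵐ a ∂μ, Tendsto (fun i => F i a) l (𝓝 (f a))) : Tendsto v l (𝓝 w) := by
  have hp0 : p ≠ 0 := (zero_lt_one.trans_le (Fact.out : 1 ≤ p)).ne'
  rw [Lp.tendsto_Lp_iff_tendsto_eLpNorm']
  have h1 : Tendsto (fun i => eLpNorm (fun a => F i a - f a) p μ) l (𝓝 0) := by
    refine tendsto_eLpNorm_zero_of_dominated hp0 hp ?_ hb hFb ?_
    · filter_upwards [hv] with i hi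
      exact ((Lp.aestronglyMeasurable (v i)).congr hi).sub ((Lp.aestronglyMeasurable w).congr hw)
    · filter_upwards [hlim] with a ha
      exact tendsto_sub_nhds_zero_iff.2 ha
  refine h1.congr' ?_
  filter_upwards [hv] with i hi
  exact eLpNorm_congr_ae (hi.sub hw).symm

/-- For a uniformly Lipschitz family of maps, convergence on a dense set implies convergence. -/
theorem tendsto_of_dense_of_lipschitz {ι E F : Type*} [PseudoMetricSpace E] [PseudoMetricSpace F]
    {l : Filter ι} {D : ι → E → F} {D' : E → F} {C : ℝ}
    (hD : ∀ᶠ i in l, ∀ u v, dist (D i u) (D i v) ≤ C * dist u v)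
    (hD' : ∀ u v, dist (D' u) (D' v) ≤ C * dist u v) {S : Set E} (hS : Dense S)
    (h : ∀ u ∈ S, Tendsto (fun i => D i u) l (𝓝 (D' u))) (u : E) :
    Tendsto (fun i => D i u) l (𝓝 (D' u)) := by
  rw [Metric.tendsto_nhds]
  intro ε hε
  have hpos : 0 < 3 * (|C| + 1) := by positivity
  obtain ⟨v, hvS, hv⟩ := Metric.mem_closure_iff.1 (hS u) (ε / (3 * (|C| + 1))) (by positivity)
  have hC : C * dist u v ≤ ε / 3 := by
    calc C * dist u v ≤ (|C| + 1) * (ε / (3 * (|C| + 1))) := by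
          gcongr
          exact (le_abs_self C).trans (by linarith)
      _ = ε / 3 := by field_simp
  filter_upwards [hD, Metric.tendsto_nhds.1 (h v hvS) (ε / 3) (by positivity)] with i hi hiv
  have h1 := (hi u v).trans hC
  have h2 := (hD' u v).trans hC
  have h3 := dist_triangle4 (D i u) (D i v) (D' v) (D' u)
  rw [dist_comm (D' v)] at h3
  linarith

theorem MeasureTheory.Lp.dense_hasCompactSupport [NormedSpace ℝ X] [Fact (1 ≤ p)] (hp : p ≠ ∞) :
    Dense {u : Lp X p (volume : Measure ℝ) |
      ∃ g : ℝ → X, Continuous g ∧ HasCompactSupport g ∧ u =ᵐ[volume] g} := by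
  intro u
  rw [Metric.mem_closure_iff]
  intro ε hε
  obtain ⟨g, hgs, hgu, hgc, hgm⟩ := (Lp.memLp u).exists_hasCompactSupport_eLpNorm_sub_le hp
    (ε := ENNReal.ofReal (ε / 2)) (by simpa using hε)
  refine ⟨hgm.toLp g, ⟨g, hgc, hgs, hgm.coeFn_toLp⟩, ?_⟩
  rw [Lp.dist_def, eLpNorm_congr_ae ((EventuallyEq.refl _ (u : ℝ → X)).sub hgm.coeFn_toLp)]
  have := ENNReal.toReal_mono ENNReal.ofReal_ne_top hgu
  rw [ENNReal.toReal_ofReal (by positivity)] at this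
  exact this.trans_lt (by linarith)

/-- A compactly supported continuous function and its translates by at most `1` are dominated by a
multiple of the indicator of a common bounded interval. -/
theorem HasCompactSupport.exists_interval_bound {g : ℝ → X} (hg : Continuous g)
    (hgs : HasCompactSupport g) :
    ∃ R C : ℝ, 0 ≤ C ∧ ∀ t h : ℝ, 0 ≤ h → h ≤ 1 →
      ‖g (t - h)‖ ≤ (Icc (-R) R).indicator (fun _ => C) t := by
  obtain ⟨C, hC⟩ := hgs.exists_bound_of_continuous hg
  obtain ⟨R, hR⟩ := (hgs.isCompact.isBounded).subset_closedBall 0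
  refine ⟨R + 1, C, (norm_nonneg _).trans (hC 0), fun t h h0 h1 => ?_⟩
  by_cases ht : t ∈ Icc (-(R + 1)) (R + 1)
  · rw [indicator_of_mem ht]
    exact hC _
  · rw [indicator_of_notMem ht, norm_le_zero_iff]
    by_contra hne
    have hmem := hR (subset_tsupport g hne)
    rw [Metric.mem_closedBall, dist_zero_right, Real.norm_eq_abs, abs_le] at hmem
    exact ht ⟨by linarith [hmem.1], by linarith [hmem.2]⟩

theorem memLp_indicator_Icc_const (R C : ℝ) :
    MemLp ((Icc (-R) R).indicator fun _ => C) p (volume : Measure ℝ) :=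
  memLp_indicator_const p measurableSet_Icc C (Or.inr (by simp))

/-- Averages of a jointly continuous function over shrinking intervals. -/
theorem tendsto_average_interval [NormedSpace ℝ X] [CompleteSpace X] {Ψ : ℝ → ℝ → X}
    (hΨ : Continuous (Function.uncurry Ψ)) (t : ℝ) :
    Tendsto (fun h : ℝ => h⁻¹ • ∫ s in (t - h)..t, Ψ s h) (𝓝[>] 0) (𝓝 (Ψ t 0)) := by
  rw [Metric.tendsto_nhds]
  intro ε hε
  obtain ⟨δ, hδ, h⟩ := Metric.continuous_iff.1 hΨ (t, 0) (ε / 2) (by positivity)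
  filter_upwards [Ioo_mem_nhdsGT hδ] with k hk
  have hk0 : 0 < k := hk.1
  have hconst : Ψ t 0 = k⁻¹ • ∫ s in (t - k)..t, Ψ t 0 := by
    rw [intervalIntegral.integral_const, sub_sub_cancel, smul_smul, inv_mul_cancel₀ hk0.ne',
      one_smul]
  have hI : IntervalIntegrable (fun s => Ψ s k) volume (t - k) t :=
    (hΨ.comp (continuous_id.prodMk continuous_const)).intervalIntegrable _ _
  rw [hconst, dist_eq_norm, ← smul_sub, ← intervalIntegral.integral_sub hI (by simp), norm_smul,
    Real.norm_of_nonneg (inv_nonneg.2 hk0.le)]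
  have : ‖∫ s in (t - k)..t, (Ψ s k - Ψ t 0)‖ ≤ ε / 2 * |t - (t - k)| := by
    refine intervalIntegral.norm_integral_le_of_norm_le_const fun s hs => ?_
    rw [uIoc_of_le (by linarith)] at hs
    rw [← dist_eq_norm]
    refine (h (s, k) ?_).le
    rw [Prod.dist_eq, max_lt_iff, Real.dist_eq, Real.dist_eq]
    simp only [sub_zero]
    rw [abs_of_pos hk0, abs_sub_comm, abs_of_nonneg (by linarith [hs.2])]
    exact ⟨by linarith [hs.1, hk.2], hk.2⟩
  rw [sub_sub_cancel, abs_of_pos hk0] at this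
  calc k⁻¹ * ‖∫ s in (t - k)..t, (Ψ s k - Ψ t 0)‖ ≤ k⁻¹ * (ε / 2 * k) := by gcongr
    _ = ε / 2 := by field_simp
    _ < ε := by linarith

theorem NNReal.tendsto_coe_nhdsGT_zero :
    Tendsto (fun h : ℝ≥0 => (h : ℝ)) (𝓝[>] 0) (𝓝[>] 0) := by
  refine tendsto_nhdsWithin_iff.2 ⟨?_, ?_⟩
  · exact (NNReal.continuous_coe.tendsto 0).mono_left nhdsWithin_le_nhds
  · filter_upwards [self_mem_nhdsWithin] with h hh
    exact NNReal.coe_pos.2 hh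

end LpTools

section Multiplier

variable {𝕜 : Type*} {X : Type*} [RCLike 𝕜] [NormedAddCommGroup X] [NormedSpace 𝕜 X]

/-- A bounded operator-valued function whose action preserves strong measurability, so that
multiplication by it is a bounded operator on `L_p`. -/
structure IsMultiplier (b : ℝ → X →L[𝕜] X) : Prop where
  stronglyMeasurable : ∀ f : ℝ → X, StronglyMeasurable f → StronglyMeasurable fun t => b t (f t)
  bound : ∃ C : ℝ, ∀ t, ‖b t‖ ≤ C

theorem IsMultiplier.memLp {b : ℝ → X →L[𝕜] X} (hb : IsMultiplier b) {p : ℝ≥0∞}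
    (u : Lp X p (volume : Measure ℝ)) : MemLp (fun t => b t (u t)) p volume := by
  obtain ⟨C, hC⟩ := hb.bound
  refine (Lp.memLp u).of_le_mul (c := C)
    (hb.stronglyMeasurable _ (Lp.stronglyMeasurable u)).aestronglyMeasurable
    (Eventually.of_forall fun t => ?_)
  exact ((b t).le_opNorm _).trans (by gcongr; exact hC t)

/-- Multiplication by an operator-valued function, as a linear map on `L_p(ℝ; X)`. -/
noncomputable def IsMultiplier.toLinearMap {b : ℝ → X →L[𝕜] X} (hb : IsMultiplier b) (p : ℝ≥0∞) :
    Lp X p (volume : Measure ℝ) →ₗ[𝕜] Lp X p (volume : Measure ℝ) where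
  toFun u := (hb.memLp u).toLp _
  map_add' u v := by
    rw [← MemLp.toLp_add, MemLp.toLp_eq_toLp_iff]
    filter_upwards [Lp.coeFn_add u v] with t ht
    rw [ht, Pi.add_apply, map_add, Pi.add_apply]
  map_smul' c u := by
    rw [RingHom.id_apply, ← MemLp.toLp_const_smul, MemLp.toLp_eq_toLp_iff]
    filter_upwards [Lp.coeFn_smul c u] with t ht
    rw [ht, Pi.smul_apply, map_smul, Pi.smul_apply]

variable {p : ℝ≥0∞} [Fact (1 ≤ p)]

/-- Multiplication by an operator-valued function, as a bounded operator on `L_p(ℝ; X)`. -/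
noncomputable def IsMultiplier.op {b : ℝ → X →L[𝕜] X} (hb : IsMultiplier b) (p : ℝ≥0∞)
    [Fact (1 ≤ p)] : Lp X p (volume : Measure ℝ) →L[𝕜] Lp X p (volume : Measure ℝ) :=
  (hb.toLinearMap p).mkContinuousOfExistsBound (by
    obtain ⟨C, hC⟩ := hb.bound
    refine ⟨C, fun u => Lp.norm_le_mul_norm_of_ae_le_mul ?_⟩
    filter_upwards [(hb.memLp u).coeFn_toLp] with t ht
    change ‖((hb.memLp u).toLp _ : Lp X p (volume : Measure ℝ)) t‖ ≤ _
    rw [ht]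
    exact ((b t).le_opNorm _).trans (by gcongr; exact hC t))

theorem IsMultiplier.coeFn_op {b : ℝ → X →L[𝕜] X} (hb : IsMultiplier b)
    (u : Lp X p (volume : Measure ℝ)) : hb.op p u =ᵐ[volume] fun t => b t (u t) :=
  (hb.memLp u).coeFn_toLp

theorem IsMultiplier.norm_op_le {b : ℝ → X →L[𝕜] X} (hb : IsMultiplier b) {C : ℝ} (hC0 : 0 ≤ C)
    (hC : ∀ t, ‖b t‖ ≤ C) : ‖hb.op p‖ ≤ C := by
  refine ContinuousLinearMap.opNorm_le_bound _ hC0 fun u => Lp.norm_le_mul_norm_of_ae_le_mul ?_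
  filter_upwards [hb.coeFn_op u] with t ht
  rw [ht]
  exact ((b t).le_opNorm _).trans (by gcongr; exact hC t)

theorem IsMultiplier.of_continuous {b : ℝ → X →L[𝕜] X} (h1 : ∀ x, Continuous fun t => b t x)
    (h2 : ∃ C : ℝ, ∀ t, ‖b t‖ ≤ C) : (Continuous fun q : X × ℝ => b q.2 q.1) ∧ IsMultiplier b := by
  obtain ⟨C, hC⟩ := h2
  have hcont : Continuous fun q : X × ℝ => b q.2 q.1 := by
    refine continuous_prod_of_continuous_lipschitzWith _ C.toNNReal h1 fun t => ?_
    refine (b t).lipschitz.weaken ?_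
    rw [← NNReal.coe_le_coe, coe_nnnorm]
    exact (hC t).trans (Real.le_coe_toNNReal C)
  exact ⟨hcont, fun f hf => hcont.comp_stronglyMeasurable (hf.prodMk stronglyMeasurable_id), C, hC⟩

open Classical in
theorem IsMultiplier.indicator {b : ℝ → X →L[𝕜] X} (hb : IsMultiplier b) {F : Set ℝ}
    (hF : MeasurableSet F) : IsMultiplier (F.indicator b) := by
  refine ⟨fun f hf => ?_, ?_⟩
  · convert (hb.stronglyMeasurable f hf).indicator hF using 2 with t
    by_cases ht : t ∈ F <;> simp [ht]
  · obtain ⟨C, hC⟩ := hb.bound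
    refine ⟨C, fun t => ?_⟩
    by_cases ht : t ∈ F
    · rw [indicator_of_mem ht]
      exact hC t
    · rw [indicator_of_notMem ht, norm_zero]
      exact (norm_nonneg _).trans (hC t)

theorem IsMultiplier.id : IsMultiplier (fun _ : ℝ => ContinuousLinearMap.id 𝕜 X) :=
  ⟨fun _ hf => hf, 1, fun _ => ContinuousLinearMap.norm_id_le⟩

end Multiplier

/-! ### Bounded perturbations of the generator of an evolution semigroup -/

theorem MeasureTheory.Lp.norm_le_of_ae_le_shift {X : Type*} [NormedAddCommGroup X] {p : ℝ≥0∞}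
    {v w : Lp X p (volume : Measure ℝ)} {h K : ℝ} (H : ∀ᵐ t, ‖v t‖ ≤ K * ‖w (t - h)‖) :
    ‖v‖ ≤ K * ‖w‖ := by
  have hmp := measurePreserving_sub_right (volume : Measure ℝ) h
  have hw : MemLp (fun t : ℝ => w (t - h)) p volume := (Lp.memLp w).comp_measurePreserving hmp
  have hnorm : ‖hw.toLp _‖ = ‖w‖ := by
    rw [Lp.norm_toLp, Lp.norm_def]
    congr 1
    exact eLpNorm_comp_measurePreserving (Lp.aestronglyMeasurable w) hmp
  rw [← hnorm]
  refine Lp.norm_le_mul_norm_of_ae_le_mul ?_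
  filter_upwards [H, hw.coeFn_toLp] with t h1 h2
  rwa [h2]

theorem MeasureTheory.ae_shift {P : ℝ → Prop} (h : ℝ) (H : ∀ᵐ t, P t) : ∀ᵐ t, P (t - h) :=
  (measurePreserving_sub_right (volume : Measure ℝ) h).quasiMeasurePreserving.ae H

namespace EvolutionFamily

variable {𝕜 : Type*} {X : Type*} [RCLike 𝕜] [NormedAddCommGroup X] [NormedSpace 𝕜 X]
  [NormedSpace ℝ X] [IsScalarTower ℝ 𝕜 X] [CompleteSpace X] {p : ℝ≥0∞} [Fact (1 ≤ p)]

/-- If two evolution families are related by the Duhamel formula with perturbation `b`, then the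
difference quotients of their evolution semigroups differ by multiplication by `b` in the limit. -/
theorem tendsto_semigroup_sub (hp : p ≠ ∞) {U W : EvolutionFamily 𝕜 X} {b : ℝ → X →L[𝕜] X}
    (hbc : Continuous fun q : X × ℝ => b q.2 q.1) (hb : IsMultiplier b)
    (hD : ∀ τ T : ℝ, τ ≤ T → ∀ x : X,
      W T τ x = U T τ x + ∫ s in τ..T, U.extend T s (b s (W.extend s τ x)))
    (u : Lp X p (volume : Measure ℝ)) :
    Tendsto (fun h : ℝ≥0 => ((h : ℝ) : 𝕜)⁻¹ •
      (W.evolutionSemigroup p h u - U.evolutionSemigroup p h u)) (𝓝[>] 0) (𝓝 (hb.op p u)) := by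
  obtain ⟨M, hM, hUM⟩ := U.exists_extend_bound 1
  obtain ⟨M', hM', hWM⟩ := W.exists_extend_bound 1
  obtain ⟨C, hC⟩ := hb.bound
  have hC0 : 0 ≤ C := (norm_nonneg _).trans (hC 0)
  set K : ℝ := M * (C * M') with hK
  have hdiff (t h : ℝ) (h0 : 0 ≤ h) (x : X) : W t (t - h) x - U t (t - h) x =
      ∫ s in (t - h)..t, U.extend t s (b s (W.extend s (t - h) x)) := by
    rw [hD (t - h) t (by linarith), add_sub_cancel_left]
  -- Uniform boundedness of the quotients reduces the claim to compactly supported continuous `u`,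
  -- where the Duhamel integral is an average of a jointly continuous function.
  have hdiff_le (t h : ℝ) (h0 : 0 ≤ h) (h1 : h ≤ 1) (x : X) :
      ‖W t (t - h) x - U t (t - h) x‖ ≤ h * (K * ‖x‖) := by
    rw [hdiff t h h0]
    have : ∀ s ∈ uIoc (t - h) t, ‖U.extend t s (b s (W.extend s (t - h) x))‖ ≤ K * ‖x‖ := by
      intro s hs
      rw [uIoc_of_le (by linarith)] at hs
      calc ‖U.extend t s (b s (W.extend s (t - h) x))‖
          ≤ ‖U.extend t s‖ * (‖b s‖ * (‖W.extend s (t - h)‖ * ‖x‖)) := by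
            refine (ContinuousLinearMap.le_opNorm _ _).trans ?_
            gcongr
            refine (ContinuousLinearMap.le_opNorm _ _).trans ?_
            gcongr
            exact ContinuousLinearMap.le_opNorm _ _
        _ ≤ M * (C * (M' * ‖x‖)) := by
            gcongr
            · exact hUM _ _ (by linarith [hs.1])
            · exact hC s
            · exact hWM _ _ (by linarith [hs.2])
        _ = K * ‖x‖ := by rw [hK]; ring
    refine (intervalIntegral.norm_integral_le_of_norm_le_const this).trans (le_of_eq ?_)
    rw [sub_sub_cancel, abs_of_nonneg h0, mul_comm]
  have hae (h : ℝ≥0) (u : Lp X p (volume : Measure ℝ)) :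
      ∀ᵐ t, (((h : ℝ) : 𝕜)⁻¹ • (W.evolutionSemigroup p h u - U.evolutionSemigroup p h u) :
        Lp X p (volume : Measure ℝ)) t =
          (h : ℝ)⁻¹ • (W t (t - h) (u (t - h)) - U t (t - h) (u (t - h))) := by
    filter_upwards [Lp.coeFn_smul (((h : ℝ) : 𝕜)⁻¹)
      (W.evolutionSemigroup p h u - U.evolutionSemigroup p h u),
      Lp.coeFn_sub (W.evolutionSemigroup p h u) (U.evolutionSemigroup p h u),
      W.coeFn_evolutionSemigroup h u, U.coeFn_evolutionSemigroup h u] with t h1 h2 h3 h4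
    rw [h1, Pi.smul_apply, h2, Pi.sub_apply, h3, h4, ← RCLike.ofReal_inv,
      ← RCLike.real_smul_eq_coe_smul]
  have hsmall : ∀ᶠ h : ℝ≥0 in 𝓝[>] 0, 0 < (h : ℝ) ∧ (h : ℝ) ≤ 1 := by
    filter_upwards [NNReal.tendsto_coe_nhdsGT_zero (Ioc_mem_nhdsGT zero_lt_one)] with h hh
      using hh
  have hquot (t h : ℝ) (h0 : 0 < h) (h1 : h ≤ 1) (x : X) :
      ‖h⁻¹ • (W t (t - h) x - U t (t - h) x)‖ ≤ K * ‖x‖ := by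
    rw [norm_smul, Real.norm_of_nonneg (inv_nonneg.2 h0.le)]
    calc h⁻¹ * ‖W t (t - h) x - U t (t - h) x‖ ≤ h⁻¹ * (h * (K * ‖x‖)) := by
          gcongr
          exact hdiff_le t h h0.le h1 x
      _ = K * ‖x‖ := by field_simp
  refine tendsto_of_dense_of_lipschitz (C := max K C) (D := fun (h : ℝ≥0)
    (u : Lp X p (volume : Measure ℝ)) => ((h : ℝ) : 𝕜)⁻¹ •
      (W.evolutionSemigroup p h u - U.evolutionSemigroup p h u)) (D' := hb.op p) ?_ ?_
        (Lp.dense_hasCompactSupport hp) ?_ u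
  · filter_upwards [hsmall] with h hh u v
    rw [dist_eq_norm, dist_eq_norm, ← smul_sub, sub_sub_sub_comm, ← map_sub, ← map_sub]
    refine (Lp.norm_le_of_ae_le_shift (h := h) (K := K) ?_).trans
      (mul_le_mul_of_nonneg_right (le_max_left _ _) (norm_nonneg _))
    filter_upwards [hae h (u - v)] with t ht
    rw [ht]
    exact hquot t h hh.1 hh.2 _
  · intro u v
    rw [dist_eq_norm, dist_eq_norm, ← map_sub]
    exact ((hb.op p).le_of_opNorm_le (hb.norm_op_le hC0 hC) _).trans
      (mul_le_mul_of_nonneg_right (le_max_right _ _) (norm_nonneg _))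
  · rintro u ⟨g, hgc, hgs, hug⟩
    obtain ⟨R, C', hC', hR⟩ := hgs.exists_interval_bound hgc
    refine Lp.tendsto_of_dominated hp
      (F := fun (h : ℝ≥0) t => (h : ℝ)⁻¹ • (W t (t - h) (g (t - h)) - U t (t - h) (g (t - h))))
      (f := fun t => b t (g t)) (b := (Icc (-R) R).indicator fun _ => K * C' + C * C')
      (Eventually.of_forall fun h => ?_) ?_ (memLp_indicator_Icc_const _ _) ?_ ?_
    · filter_upwards [hae h u, ae_shift h hug] with t h1 h2
      rw [h1, h2]
    · filter_upwards [hb.coeFn_op u, hug] with t h1 h2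
      rw [h1, h2]
    · filter_upwards [hsmall] with h hh
      refine Eventually.of_forall fun t => ?_
      have h1 := (hquot t h hh.1 hh.2 (g (t - h))).trans
        (mul_le_mul_of_nonneg_left (hR t h hh.1.le hh.2) (by positivity))
      have h2 : ‖b t (g t)‖ ≤ C * (Icc (-R) R).indicator (fun _ => C') t := by
        have := hR t 0 le_rfl zero_le_one
        rw [sub_zero] at this
        exact ((b t).le_opNorm _).trans (mul_le_mul (hC t) this (norm_nonneg _) hC0)
      refine (norm_sub_le _ _).trans ((add_le_add h1 h2).trans (le_of_eq ?_))
      by_cases ht : t ∈ Icc (-R) R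
      · simp [indicator_of_mem ht]
      · simp [indicator_of_notMem ht]
    · refine Eventually.of_forall fun t => ?_
      have hΨ : Continuous (Function.uncurry fun s h : ℝ =>
          U.extend t s (b s (W.extend s (t - h) (g (t - h))))) := by
        refine U.continuous_extend_comp continuous_const continuous_fst (hbc.comp
          (Continuous.prodMk ?_ continuous_fst))
        exact W.continuous_extend_comp continuous_fst (by fun_prop) (hgc.comp (by fun_prop))
      have h1 := (tendsto_average_interval hΨ t).comp NNReal.tendsto_coe_nhdsGT_zero
      simp only [sub_zero, U.extend_of_le le_rfl, W.extend_of_le le_rfl, U.self_eq_id,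
        W.self_eq_id, ContinuousLinearMap.id_apply] at h1
      refine h1.congr fun h => ?_
      rw [hdiff t h h.2]
      rfl

/-- The generator of the perturbed evolution semigroup is the bounded perturbation of the original
generator by multiplication. -/
theorem mem_G_graph_iff_of_duhamel (hp : p ≠ ∞) {U W : EvolutionFamily 𝕜 X} {b : ℝ → X →L[𝕜] X}
    (hbc : Continuous fun q : X × ℝ => b q.2 q.1) (hb : IsMultiplier b)
    (hD : ∀ τ T : ℝ, τ ≤ T → ∀ x : X,
      W T τ x = U T τ x + ∫ s in τ..T, U.extend T s (b s (W.extend s τ x)))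
    (u f : Lp X p (volume : Measure ℝ)) :
    (u, f) ∈ (W.G p).graph ↔ (u, f - hb.op p u) ∈ (U.G p).graph := by
  rw [G, G, mem_generator_graph_iff, mem_generator_graph_iff]
  have h1 := tendsto_semigroup_sub hp hbc hb hD u
  constructor
  · intro h
    refine (h.sub h1).congr fun k => ?_
    rw [← smul_sub]
    congr 1
    abel
  · intro h
    have h2 := h.add h1
    rw [sub_add_cancel] at h2
    refine h2.congr fun k => ?_
    rw [← smul_add]
    congr 1
    abel

end EvolutionFamily

/-! ### The Green operator of an exponentially stable evolution family -/

section Averages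

variable {X : Type*} [NormedAddCommGroup X] {p : ℝ≥0∞}

/-- Jensen's inequality for averages of translates against a probability measure. -/
theorem lintegral_translate_rpow_le (hp1 : 1 ≤ p) (hp : p ≠ ∞) {μ : Measure ℝ}
    [IsProbabilityMeasure μ] {f : ℝ → X} (hf : StronglyMeasurable f) (t : ℝ) :
    (∫⁻ h, ‖f (t - h)‖ₑ ∂μ) ^ p.toReal ≤ ∫⁻ h, ‖f (t - h)‖ₑ ^ p.toReal ∂μ := by
  have hp0 : p ≠ 0 := (zero_lt_one.trans_le hp1).ne'
  have hq : 0 < p.toReal := ENNReal.toReal_pos hp0 hp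
  have hm : AEStronglyMeasurable (fun h => f (t - h)) μ :=
    (hf.comp_measurable (measurable_const.sub measurable_id)).aestronglyMeasurable
  have h1 := eLpNorm_le_eLpNorm_of_exponent_le hp1 hm
  rw [eLpNorm_one_eq_lintegral_enorm, eLpNorm_eq_lintegral_rpow_enorm_toReal hp0 hp] at h1
  have h2 := ENNReal.rpow_le_rpow h1 hq.le
  rwa [← ENNReal.rpow_mul, one_div_mul_cancel hq.ne', ENNReal.rpow_one] at h2

/-- Averages of translates against a probability measure contract the `L_p` norm. -/
theorem eLpNorm_le_of_translate_average (hp1 : 1 ≤ p) (hp : p ≠ ∞) {μ : Measure ℝ}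
    [IsProbabilityMeasure μ] {f v : ℝ → X} (hf : StronglyMeasurable f) {c : ℝ≥0∞}
    (hv : ∀ᵐ t, ‖v t‖ₑ ≤ c * ∫⁻ h, ‖f (t - h)‖ₑ ∂μ) :
    eLpNorm v p volume ≤ c * eLpNorm f p volume := by
  have hp0 : p ≠ 0 := (zero_lt_one.trans_le hp1).ne'
  have hq : 0 < p.toReal := ENNReal.toReal_pos hp0 hp
  have hm : Measurable fun z : ℝ × ℝ => ‖f (z.1 - z.2)‖ₑ ^ p.toReal :=
    (hf.comp_measurable (measurable_fst.sub measurable_snd)).enorm.pow_const _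
  have hm1 : Measurable fun t : ℝ => ∫⁻ h, ‖f (t - h)‖ₑ ^ p.toReal ∂μ := hm.lintegral_prod_right'
  rw [eLpNorm_eq_lintegral_rpow_enorm_toReal hp0 hp, eLpNorm_eq_lintegral_rpow_enorm_toReal hp0 hp]
  have key : ∫⁻ t, ‖v t‖ₑ ^ p.toReal ≤ c ^ p.toReal * ∫⁻ t, ‖f t‖ₑ ^ p.toReal := by
    calc ∫⁻ t, ‖v t‖ₑ ^ p.toReal
        ≤ ∫⁻ t, c ^ p.toReal * ∫⁻ h, ‖f (t - h)‖ₑ ^ p.toReal ∂μ := by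
          refine lintegral_mono_ae ?_
          filter_upwards [hv] with t ht
          refine (ENNReal.rpow_le_rpow ht hq.le).trans ?_
          rw [ENNReal.mul_rpow_of_nonneg _ _ hq.le]
          gcongr
          exact lintegral_translate_rpow_le hp1 hp hf t
      _ = c ^ p.toReal * ∫⁻ h, (∫⁻ t, ‖f (t - h)‖ₑ ^ p.toReal) ∂μ := by
          rw [lintegral_const_mul _ hm1, lintegral_lintegral_swap hm.aemeasurable]
      _ = c ^ p.toReal * ∫⁻ t, ‖f t‖ₑ ^ p.toReal := by
          have : ∀ h : ℝ, ∫⁻ t, ‖f (t - h)‖ₑ ^ p.toReal = ∫⁻ t, ‖f t‖ₑ ^ p.toReal := fun h =>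
            lintegral_sub_right_eq_self (fun t => ‖f t‖ₑ ^ p.toReal) h
          simp only [this, lintegral_const, measure_univ, mul_one]
  refine (ENNReal.rpow_le_rpow key (by positivity)).trans (le_of_eq ?_)
  rw [ENNReal.mul_rpow_of_nonneg _ _ (by positivity), ← ENNReal.rpow_mul,
    mul_one_div_cancel hq.ne', ENNReal.rpow_one]

/-- The exponential probability distribution `κ e^{-κ h} dh` on `h > 0`. -/
noncomputable def expWeight (κ : ℝ) : Measure ℝ :=
  (volume.restrict (Ioi 0)).withDensity fun h => ENNReal.ofReal (κ * Real.exp (-κ * h))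

theorem measurable_expWeight_density (κ : ℝ) :
    Measurable fun h : ℝ => ENNReal.ofReal (κ * Real.exp (-κ * h)) := by fun_prop

theorem isProbabilityMeasure_expWeight {κ : ℝ} (hκ : 0 < κ) :
    IsProbabilityMeasure (expWeight κ) := by
  constructor
  have hint : IntegrableOn (fun h => κ * Real.exp (-κ * h)) (Ioi 0) :=
    (integrableOn_exp_mul_Ioi (neg_lt_zero.2 hκ) 0).const_mul κ
  rw [expWeight, withDensity_apply _ MeasurableSet.univ, Measure.restrict_univ,
    ← ofReal_integral_eq_lintegral_ofReal hint
      (Eventually.of_forall fun h => by positivity), integral_const_mul,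
    integral_exp_mul_Ioi (neg_lt_zero.2 hκ)]
  simp [hκ.ne']

theorem lintegral_expWeight (κ : ℝ) {G : ℝ → ℝ≥0∞} (hG : Measurable G) :
    ∫⁻ h, G h ∂(expWeight κ) = ∫⁻ h in Ioi 0, ENNReal.ofReal (κ * Real.exp (-κ * h)) * G h := by
  rw [expWeight, lintegral_withDensity_eq_lintegral_mul _ (measurable_expWeight_density κ) hG]
  rfl

theorem lintegral_expWeight_le {κ : ℝ} (hκ : 0 < κ) {G : ℝ → ℝ≥0∞} (hG : Measurable G) :
    ∫⁻ h, G h ∂(expWeight κ) ≤ ENNReal.ofReal κ * ∫⁻ h, G h := by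
  rw [lintegral_expWeight κ hG, ← lintegral_const_mul _ hG]
  refine le_trans ?_ (setLIntegral_le_lintegral (Ioi 0) _)
  refine setLIntegral_mono (hG.const_mul _) fun h hh => ?_
  gcongr
  have : Real.exp (-κ * h) ≤ 1 := Real.exp_le_one_iff.2 (by nlinarith [mem_Ioi.1 hh])
  nlinarith

theorem lintegral_translate_expWeight_le (hp1 : 1 ≤ p) (hp : p ≠ ∞) {κ : ℝ} (hκ : 0 < κ)
    (f : Lp X p (volume : Measure ℝ)) (t : ℝ) :
    ∫⁻ h, ‖f (t - h)‖ₑ ∂(expWeight κ) ≤ ENNReal.ofReal (κ ^ (1 / p.toReal) * ‖f‖) := by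
  have hp0 : p ≠ 0 := (zero_lt_one.trans_le hp1).ne'
  have hq : 0 < p.toReal := ENNReal.toReal_pos hp0 hp
  have := isProbabilityMeasure_expWeight hκ
  have hf := Lp.stronglyMeasurable f
  have hm : Measurable fun h : ℝ => ‖f (t - h)‖ₑ ^ p.toReal :=
    (hf.comp_measurable (measurable_const.sub measurable_id)).enorm.pow_const _
  have h1 := (lintegral_translate_rpow_le hp1 hp hf t).trans (lintegral_expWeight_le hκ hm)
  rw [lintegral_sub_left_eq_self (fun s => ‖f s‖ₑ ^ p.toReal) t] at h1
  have h2 := ENNReal.rpow_le_rpow h1 (by positivity : 0 ≤ 1 / p.toReal)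
  rw [← ENNReal.rpow_mul, mul_one_div_cancel hq.ne', ENNReal.rpow_one,
    ENNReal.mul_rpow_of_nonneg _ _ (by positivity),
    ← eLpNorm_eq_lintegral_rpow_enorm_toReal hp0 hp] at h2
  rw [ENNReal.ofReal_mul (by positivity), ← ENNReal.ofReal_rpow_of_pos hκ, Lp.norm_def,
    ENNReal.ofReal_toReal (Lp.eLpNorm_ne_top f)]
  exact h2

end Averages

namespace EvolutionFamily

variable {𝕜 : Type*} {X : Type*} [RCLike 𝕜] [NormedAddCommGroup X] [NormedSpace 𝕜 X]

/-- An evolution family is exponentially stable with constant `M` and rate `κ > 0`. -/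
structure IsStable (V : EvolutionFamily 𝕜 X) (M κ : ℝ) : Prop where
  pos : 0 < κ
  bound : ∀ t s : ℝ, s ≤ t → ‖V t s‖ ≤ M * Real.exp (-κ * (t - s))

theorem IsStable.nonneg {V : EvolutionFamily 𝕜 X} {M κ : ℝ} (hV : V.IsStable M κ) : 0 ≤ M := by
  have := (norm_nonneg _).trans (hV.bound 0 0 le_rfl)
  simpa using this

theorem IsStable.norm_le {V : EvolutionFamily 𝕜 X} {M κ : ℝ} (hV : V.IsStable M κ) (t s : ℝ) :
    ‖V.extend t s‖ ≤ M := by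
  refine (hV.bound _ _ (le_max_right t s)).trans ?_
  have h1 : Real.exp (-κ * (max t s - s)) ≤ 1 :=
    Real.exp_le_one_iff.2 (by nlinarith [hV.pos, le_max_right t s])
  nlinarith [hV.nonneg]

/-- The mild solution on the whole line with inhomogeneity `f`, in terms of the time lag `h`:
`∫_{h > 0} V(t, t - h) f(t - h) dh`. -/
noncomputable def greenFun [NormedSpace ℝ X] (V : EvolutionFamily 𝕜 X) (f : ℝ → X) (t : ℝ) : X :=
  ∫ h in Ioi 0, V.extend t (t - h) (f (t - h))

variable {V : EvolutionFamily 𝕜 X} {M κ : ℝ} {p : ℝ≥0∞}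

theorem stronglyMeasurable_green_integrand (V : EvolutionFamily 𝕜 X) {f : ℝ → X}
    (hf : StronglyMeasurable f) :
    StronglyMeasurable fun z : ℝ × ℝ => V.extend z.1 (z.1 - z.2) (f (z.1 - z.2)) :=
  V.continuous_extend.comp_stronglyMeasurable
    ((hf.comp_measurable (measurable_fst.sub measurable_snd)).prodMk
      (measurable_fst.stronglyMeasurable.prodMk
        (measurable_fst.sub measurable_snd).stronglyMeasurable))

theorem IsStable.lintegral_green_le (hV : V.IsStable M κ) {f : ℝ → X}
    (hf : StronglyMeasurable f) (t : ℝ) :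
    ∫⁻ h in Ioi 0, ‖V.extend t (t - h) (f (t - h))‖ₑ ≤
      ENNReal.ofReal (M / κ) * ∫⁻ h, ‖f (t - h)‖ₑ ∂(expWeight κ) := by
  have hm : Measurable fun h : ℝ => ‖f (t - h)‖ₑ :=
    (hf.comp_measurable (measurable_const.sub measurable_id)).enorm
  have hm' : Measurable fun h : ℝ => ENNReal.ofReal (κ * Real.exp (-κ * h)) * ‖f (t - h)‖ₑ :=
    (measurable_expWeight_density κ).mul hm
  rw [lintegral_expWeight κ hm, ← lintegral_const_mul _ hm']
  refine setLIntegral_mono (hm'.const_mul _) fun h hh => ?_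
  have hh0 : 0 ≤ h := (mem_Ioi.1 hh).le
  rw [← mul_assoc, ← ENNReal.ofReal_mul (div_nonneg hV.nonneg hV.pos.le)]
  have h1 : M / κ * (κ * Real.exp (-κ * h)) = M * Real.exp (-κ * h) := by
    have := hV.pos.ne'
    field_simp
  rw [h1, ← ofReal_norm, ← ofReal_norm,
    ← ENNReal.ofReal_mul (mul_nonneg hV.nonneg (Real.exp_nonneg _))]
  refine ENNReal.ofReal_le_ofReal (((V.extend t (t - h)).le_opNorm _).trans ?_)
  gcongr
  rw [V.extend_of_le (by linarith)]
  simpa using hV.bound t (t - h) (by linarith)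

theorem IsStable.integrable_green (hV : V.IsStable M κ) [Fact (1 ≤ p)] (hp : p ≠ ∞)
    (f : Lp X p (volume : Measure ℝ)) (t : ℝ) :
    IntegrableOn (fun h => V.extend t (t - h) (f (t - h))) (Ioi 0) := by
  refine ⟨((V.stronglyMeasurable_green_integrand (Lp.stronglyMeasurable f)).comp_measurable
    (measurable_const.prodMk measurable_id)).aestronglyMeasurable, ?_⟩
  refine (hV.lintegral_green_le (Lp.stronglyMeasurable f) t).trans_lt ?_
  refine ENNReal.mul_lt_top ENNReal.ofReal_lt_top ?_
  exact (lintegral_translate_expWeight_le Fact.out hp hV.pos f t).trans_lt ENNReal.ofReal_lt_top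

variable [NormedSpace ℝ X]

theorem IsStable.enorm_greenFun_le (hV : V.IsStable M κ) {f : ℝ → X}
    (hf : StronglyMeasurable f) (t : ℝ) :
    ‖V.greenFun f t‖ₑ ≤ ENNReal.ofReal (M / κ) * ∫⁻ h, ‖f (t - h)‖ₑ ∂(expWeight κ) :=
  (enorm_integral_le_lintegral_enorm _).trans (hV.lintegral_green_le hf t)

/-- The mild solution is bounded by the `L_p` norm of the inhomogeneity, at every time. -/
theorem IsStable.norm_greenFun_le (hV : V.IsStable M κ) [Fact (1 ≤ p)] (hp : p ≠ ∞)
    (f : Lp X p (volume : Measure ℝ)) (t : ℝ) :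
    ‖V.greenFun f t‖ ≤ M / κ * (κ ^ (1 / p.toReal) * ‖f‖) := by
  have hMκ : 0 ≤ M / κ := div_nonneg hV.nonneg hV.pos.le
  have h1 := (hV.enorm_greenFun_le (Lp.stronglyMeasurable f) t).trans
    (mul_le_mul_right (lintegral_translate_expWeight_le Fact.out hp hV.pos f t) _)
  rw [← ENNReal.ofReal_mul hMκ, ← ofReal_norm] at h1
  refine (ENNReal.ofReal_le_ofReal_iff ?_).1 h1
  have := hV.pos
  positivity

theorem stronglyMeasurable_greenFun (V : EvolutionFamily 𝕜 X) {f : ℝ → X}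
    (hf : StronglyMeasurable f) : StronglyMeasurable (V.greenFun f) :=
  (V.stronglyMeasurable_green_integrand hf).integral_prod_right'
    (ν := (volume : Measure ℝ).restrict (Ioi 0))

theorem IsStable.eLpNorm_greenFun_le (hV : V.IsStable M κ) [Fact (1 ≤ p)] (hp : p ≠ ∞)
    (f : Lp X p (volume : Measure ℝ)) :
    eLpNorm (V.greenFun f) p volume ≤ ENNReal.ofReal (M / κ) * eLpNorm f p volume :=
  have := isProbabilityMeasure_expWeight hV.pos
  eLpNorm_le_of_translate_average Fact.out hp (Lp.stronglyMeasurable f)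
    (Eventually.of_forall fun t => hV.enorm_greenFun_le (Lp.stronglyMeasurable f) t)

theorem IsStable.memLp_greenFun (hV : V.IsStable M κ) [Fact (1 ≤ p)] (hp : p ≠ ∞)
    (f : Lp X p (volume : Measure ℝ)) : MemLp (V.greenFun f) p volume :=
  ⟨(V.stronglyMeasurable_greenFun (Lp.stronglyMeasurable f)).aestronglyMeasurable,
    (hV.eLpNorm_greenFun_le hp f).trans_lt
      (ENNReal.mul_lt_top ENNReal.ofReal_lt_top (Lp.eLpNorm_lt_top f))⟩

theorem _root_.MeasureTheory.ae_reflect {P : ℝ → Prop} (t : ℝ) (H : ∀ᵐ s, P s) (S : Set ℝ) :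
    ∀ᵐ h ∂(volume.restrict S), P (t - h) :=
  ae_restrict_of_ae
    ((Measure.measurePreserving_sub_left (volume : Measure ℝ) t).quasiMeasurePreserving.ae H)

/-- The mild solution depends on the inhomogeneity only up to null sets, at every time. -/
theorem greenFun_congr_ae (V : EvolutionFamily 𝕜 X) {f g : ℝ → X} (h : f =ᵐ[volume] g) :
    V.greenFun f = V.greenFun g := by
  ext t
  refine integral_congr_ae ?_
  filter_upwards [ae_reflect t h (Ioi 0)] with s hs
  rw [hs]

variable [IsScalarTower ℝ 𝕜 X] [Fact (1 ≤ p)]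

/-- The Green operator `f ↦ ∫_{h > 0} V(t, t - h) f(t - h) dh` of an exponentially stable evolution
family on `L_p(ℝ; X)`. -/
noncomputable def IsStable.green (hV : V.IsStable M κ) (hp : p ≠ ∞) :
    Lp X p (volume : Measure ℝ) →L[𝕜] Lp X p (volume : Measure ℝ) :=
  LinearMap.mkContinuous
    { toFun := fun f => (hV.memLp_greenFun hp f).toLp _
      map_add' := fun f g => by
        rw [← MemLp.toLp_add, MemLp.toLp_eq_toLp_iff, V.greenFun_congr_ae (Lp.coeFn_add f g)]
        refine Eventually.of_forall fun t => ?_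
        simp only [greenFun, Pi.add_apply, map_add]
        exact integral_add (hV.integrable_green hp f t) (hV.integrable_green hp g t)
      map_smul' := fun c f => by
        rw [RingHom.id_apply, ← MemLp.toLp_const_smul, MemLp.toLp_eq_toLp_iff,
          V.greenFun_congr_ae (Lp.coeFn_smul c f)]
        refine Eventually.of_forall fun t => ?_
        simp only [greenFun, Pi.smul_apply, map_smul]
        exact integral_smul c _ }
    (M / κ) fun f => by
      change ‖(hV.memLp_greenFun hp f).toLp _‖ ≤ _
      rw [Lp.norm_toLp, Lp.norm_def]
      have := ENNReal.toReal_mono (ENNReal.mul_ne_top ENNReal.ofReal_ne_top (Lp.eLpNorm_ne_top f))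
        (hV.eLpNorm_greenFun_le hp f)
      rwa [ENNReal.toReal_mul, ENNReal.toReal_ofReal (div_nonneg hV.nonneg hV.pos.le)] at this

theorem IsStable.coeFn_green (hV : V.IsStable M κ) (hp : p ≠ ∞)
    (f : Lp X p (volume : Measure ℝ)) : hV.green hp f =ᵐ[volume] V.greenFun f :=
  (hV.memLp_greenFun hp f).coeFn_toLp

theorem IsStable.norm_green_le (hV : V.IsStable M κ) (hp : p ≠ ∞) :
    ‖(hV.green hp : Lp X p (volume : Measure ℝ) →L[𝕜] Lp X p (volume : Measure ℝ))‖ ≤ M / κ :=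
  LinearMap.mkContinuous_norm_le _ (div_nonneg hV.nonneg hV.pos.le) _

end EvolutionFamily

/-! ### The generator in terms of the Green operator -/

theorem MeasureTheory.setIntegral_Ioi_comp_add_right {X : Type*} [NormedAddCommGroup X]
    [NormedSpace ℝ X] (φ : ℝ → X) (k : ℝ) : ∫ h in Ioi 0, φ (h + k) = ∫ h in Ioi k, φ h := by
  have h1 := (measurePreserving_add_right (volume : Measure ℝ) k).setIntegral_preimage_emb
    (measurableEmbedding_addRight k) φ (Ioi k)
  rw [← h1]
  congr 1
  simp

namespace EvolutionFamily

variable {𝕜 : Type*} {X : Type*} [RCLike 𝕜] [NormedAddCommGroup X] [NormedSpace 𝕜 X]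
  {V : EvolutionFamily 𝕜 X} {M κ : ℝ} {p : ℝ≥0∞}

theorem extend_comp_extend (V : EvolutionFamily 𝕜 X) {t s r : ℝ} (hst : s ≤ t) (hrs : r ≤ s)
    (x : X) : V t s (V.extend s r x) = V.extend t r x := by
  rw [V.extend_of_le hrs, V.extend_of_le (hrs.trans hst), V.comp_eq t s r hrs hst]
  rfl

/-- The exponentially rescaled evolution family `e^{-c(t - s)} U(t, s)`. -/
noncomputable def rescale (U : EvolutionFamily 𝕜 X) (c : ℝ) : EvolutionFamily 𝕜 X where
  toFun t s := ((Real.exp (-c * (t - s)) : ℝ) : 𝕜) • U t s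
  continuousOn_apply x := by
    refine ContinuousOn.smul ?_ (U.continuousOn_apply x)
    exact (RCLike.continuous_ofReal.comp (by fun_prop)).continuousOn
  exists_exp_bound := by
    obtain ⟨ω, C, h⟩ := U.exists_exp_bound
    refine ⟨-c + ω, C, fun t τ hτ => ?_⟩
    rw [norm_smul, RCLike.norm_ofReal, abs_of_pos (Real.exp_pos _), add_mul, Real.exp_add,
      mul_left_comm]
    gcongr
    exact h t τ hτ
  self_eq_id t := by simp [U.self_eq_id]
  comp_eq t s τ h1 h2 := by
    rw [U.comp_eq t s τ h1 h2, ContinuousLinearMap.comp_smul, ContinuousLinearMap.smul_comp,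
      smul_smul, ← RCLike.ofReal_mul, ← Real.exp_add]
    congr 3
    ring

theorem rescale_apply (U : EvolutionFamily 𝕜 X) (c t s : ℝ) :
    U.rescale c t s = ((Real.exp (-c * (t - s)) : ℝ) : 𝕜) • U t s := rfl

theorem evolutionSemigroup_rescale (U : EvolutionFamily 𝕜 X) (c : ℝ) (k : ℝ≥0)
    (u : Lp X p (volume : Measure ℝ)) :
    (U.rescale c).evolutionSemigroup p k u =
      ((Real.exp (-c * k) : ℝ) : 𝕜) • U.evolutionSemigroup p k u := by
  refine Lp.ext ?_
  filter_upwards [(U.rescale c).coeFn_evolutionSemigroup k u,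
    Lp.coeFn_smul ((Real.exp (-c * k) : ℝ) : 𝕜) (U.evolutionSemigroup p k u),
    U.coeFn_evolutionSemigroup k u] with t h1 h2 h3
  rw [h1, h2, Pi.smul_apply, h3, rescale_apply, sub_sub_cancel]
  rfl

theorem exists_rescale_isStable (U : EvolutionFamily 𝕜 X) :
    ∃ M ω : ℝ, ∀ c > ω, (U.rescale c).IsStable M (c - ω) := by
  obtain ⟨ω, M, h⟩ := U.exists_exp_bound
  refine ⟨M, ω, fun c hc => ⟨sub_pos.2 hc, fun t s hst => ?_⟩⟩
  rw [rescale_apply, norm_smul, RCLike.norm_ofReal, abs_of_pos (Real.exp_pos _),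
    show -(c - ω) * (t - s) = -c * (t - s) + ω * (t - s) by ring, Real.exp_add, mul_left_comm]
  gcongr
  exact h t s hst

variable [Fact (1 ≤ p)]

/-- Rescaling shifts the generator. -/
theorem mem_G_rescale_graph (U : EvolutionFamily 𝕜 X) (c : ℝ)
    (u f : Lp X p (volume : Measure ℝ)) :
    (u, f - (c : 𝕜) • u) ∈ ((U.rescale c).G p).graph ↔ (u, f) ∈ (U.G p).graph := by
  rw [G, G, mem_generator_graph_iff, mem_generator_graph_iff]
  have hexp : Tendsto (fun k : ℝ≥0 => Real.exp (-c * k)) (𝓝[>] 0) (𝓝 1) := by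
    have h : Continuous fun k : ℝ≥0 => Real.exp (-c * k) := by fun_prop
    have h0 := (h.tendsto 0).mono_left (nhdsWithin_le_nhds (s := Ioi 0))
    simpa using h0
  have hE : Tendsto (fun k : ℝ≥0 => ((Real.exp (-c * k) : ℝ) : 𝕜)) (𝓝[>] 0) (𝓝 1) := by
    have := (RCLike.continuous_ofReal (K := 𝕜)).tendsto (1 : ℝ)
    rw [RCLike.ofReal_one] at this
    exact this.comp hexp
  have hder : Tendsto (fun k : ℝ≥0 => (k : ℝ)⁻¹ * (Real.exp (-c * k) - 1)) (𝓝[>] 0) (𝓝 (-c)) := by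
    have hd : HasDerivAt (fun k : ℝ => Real.exp (-c * k)) (-c) 0 := by
      have := ((hasDerivAt_id (0 : ℝ)).const_mul (-c)).exp
      simpa using this
    have := (hasDerivAt_iff_tendsto_slope_zero.1 hd).mono_left
      (nhdsWithin_mono 0 (fun x hx => (ne_of_gt hx : x ≠ 0) : Ioi (0 : ℝ) ⊆ {0}ᶜ))
    simp only [zero_add, mul_zero, Real.exp_zero, smul_eq_mul] at this
    exact this.comp NNReal.tendsto_coe_nhdsGT_zero
  have hQ : Tendsto (fun k : ℝ≥0 => (((k : ℝ)⁻¹ * (Real.exp (-c * k) - 1) : ℝ) : 𝕜) • u) (𝓝[>] 0)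
      (𝓝 (-((c : 𝕜) • u))) := by
    have h1 := ((RCLike.continuous_ofReal (K := 𝕜)).tendsto (-c)).comp hder
    rw [RCLike.ofReal_neg] at h1
    rw [← neg_smul]
    exact h1.smul_const u
  have hid (k : ℝ≥0) : ((k : ℝ) : 𝕜)⁻¹ • ((U.rescale c).evolutionSemigroup p k u - u) =
      ((Real.exp (-c * k) : ℝ) : 𝕜) • (((k : ℝ) : 𝕜)⁻¹ • (U.evolutionSemigroup p k u - u)) +
        (((k : ℝ)⁻¹ * (Real.exp (-c * k) - 1) : ℝ) : 𝕜) • u := by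
    rw [evolutionSemigroup_rescale]
    push_cast
    module
  constructor
  · intro h
    have h1 := (h.sub hQ)
    rw [sub_neg_eq_add, sub_add_cancel] at h1
    have hE' := hE.inv₀ one_ne_zero
    rw [inv_one] at hE'
    have h2 := hE'.smul h1
    rw [one_smul] at h2
    refine h2.congr fun k => ?_
    have hne : ((Real.exp (-c * k) : ℝ) : 𝕜) ≠ 0 := RCLike.ofReal_ne_zero.2 (Real.exp_pos _).ne'
    rw [hid, add_sub_cancel_right, inv_smul_smul₀ hne]
  · intro h
    have h1 := (hE.smul h).add hQ
    rw [one_smul, ← sub_eq_add_neg] at h1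
    exact h1.congr fun k => (hid k).symm

variable [NormedSpace ℝ X] [IsScalarTower ℝ 𝕜 X]

/-- Both orders of composing the Green operator with the semigroup at time `k` restrict the lag
integral to lags larger than `k`; see also `IsStable.semigroup_green`. -/
theorem IsStable.green_semigroup (hV : V.IsStable M κ) (hp : p ≠ ∞) (k : ℝ≥0)
    (f : Lp X p (volume : Measure ℝ)) :
    hV.green hp (V.evolutionSemigroup p k f) =ᵐ[volume]
      fun t => ∫ h in Ioi (k : ℝ), V.extend t (t - h) (f (t - h)) := by
  filter_upwards [hV.coeFn_green hp (V.evolutionSemigroup p k f)] with t ht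
  rw [ht, greenFun,
    ← setIntegral_Ioi_comp_add_right (fun h => V.extend t (t - h) (f (t - h)))]
  refine integral_congr_ae ?_
  filter_upwards [ae_reflect t (V.coeFn_evolutionSemigroup k f) (Ioi 0),
    ae_restrict_mem measurableSet_Ioi] with h hh hpos
  have h0 : (0 : ℝ) < h := hpos
  rw [hh, V.extend_of_le (by linarith),
    ← V.extend_of_le (t := t - h) (s := t - h - k) (by simp), V.extend_comp_extend (by linarith)
      (by simp), sub_sub]

variable [CompleteSpace X]

theorem IsStable.semigroup_green (hV : V.IsStable M κ) (hp : p ≠ ∞) (k : ℝ≥0)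
    (f : Lp X p (volume : Measure ℝ)) :
    V.evolutionSemigroup p k (hV.green hp f) =ᵐ[volume]
      fun t => ∫ h in Ioi (k : ℝ), V.extend t (t - h) (f (t - h)) := by
  filter_upwards [V.coeFn_evolutionSemigroup k (hV.green hp f),
    ae_shift k (hV.coeFn_green hp f)] with t h1 h2
  rw [h1, h2, greenFun, ← ContinuousLinearMap.integral_comp_comm _ (hV.integrable_green hp f _),
    ← setIntegral_Ioi_comp_add_right (fun h => V.extend t (t - h) (f (t - h)))]
  refine setIntegral_congr_fun measurableSet_Ioi fun h hh => ?_
  have h0 : (0 : ℝ) < h := hh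
  rw [V.extend_comp_extend (by simp) (by linarith), sub_sub, add_comm (k : ℝ)]

theorem IsStable.green_comm (hV : V.IsStable M κ) (hp : p ≠ ∞) (k : ℝ≥0)
    (f : Lp X p (volume : Measure ℝ)) :
    hV.green hp (V.evolutionSemigroup p k f) = V.evolutionSemigroup p k (hV.green hp f) :=
  Lp.ext ((hV.green_semigroup hp k f).trans (hV.semigroup_green hp k f).symm)

/-- The difference quotients of the semigroup on the range of the Green operator: averages of
`V(t, t - h) f(t - h)` over `0 < h ≤ k`, up to sign. -/
theorem IsStable.quotient_green (hV : V.IsStable M κ) (hp : p ≠ ∞) (k : ℝ≥0)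
    (f : Lp X p (volume : Measure ℝ)) :
    (((k : ℝ) : 𝕜)⁻¹ • (V.evolutionSemigroup p k (hV.green hp f) - hV.green hp f) :
      Lp X p (volume : Measure ℝ)) =ᵐ[volume]
      fun t => -((k : ℝ)⁻¹ • ∫ h in Ioc 0 (k : ℝ), V.extend t (t - h) (f (t - h))) := by
  filter_upwards [Lp.coeFn_smul (((k : ℝ) : 𝕜)⁻¹)
      (V.evolutionSemigroup p k (hV.green hp f) - hV.green hp f),
      Lp.coeFn_sub (V.evolutionSemigroup p k (hV.green hp f)) (hV.green hp f),
      hV.semigroup_green hp k f, hV.coeFn_green hp f] with t h1 h2 h3 h4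
  have hint := hV.integrable_green hp f t
  rw [h1, Pi.smul_apply, h2, Pi.sub_apply, h3, h4, ← RCLike.ofReal_inv,
    ← RCLike.real_smul_eq_coe_smul, greenFun, ← Ioc_union_Ioi_eq_Ioi k.coe_nonneg,
    setIntegral_union (Ioc_disjoint_Ioi le_rfl) measurableSet_Ioi
      (hint.mono_set Ioc_subset_Ioi_self) (hint.mono_set (Ioi_subset_Ioi k.coe_nonneg)),
    sub_add_eq_sub_sub_swap, sub_self, zero_sub, smul_neg]

/-- The Green operator maps into the domain of the generator, and the generator sends `J f` to
`-f`. -/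
theorem IsStable.tendsto_quotient_green (hV : V.IsStable M κ) (hp : p ≠ ∞)
    (f : Lp X p (volume : Measure ℝ)) :
    Tendsto (fun k : ℝ≥0 => ((k : ℝ) : 𝕜)⁻¹ •
      (V.evolutionSemigroup p k (hV.green hp f) - hV.green hp f)) (𝓝[>] 0) (𝓝 (-f)) := by
  have hM := hV.nonneg
  have hsmall : ∀ᶠ h : ℝ≥0 in 𝓝[>] 0, 0 < (h : ℝ) ∧ (h : ℝ) ≤ 1 := by
    filter_upwards [NNReal.tendsto_coe_nhdsGT_zero (Ioc_mem_nhdsGT zero_lt_one)] with h hh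
      using hh
  refine tendsto_of_dense_of_lipschitz (C := max M 1) (D := fun (k : ℝ≥0)
    (f : Lp X p (volume : Measure ℝ)) => ((k : ℝ) : 𝕜)⁻¹ •
      (V.evolutionSemigroup p k (hV.green hp f) - hV.green hp f)) (D' := fun f => -f) ?_ ?_
        (Lp.dense_hasCompactSupport hp) ?_ f
  · filter_upwards [hsmall] with k hk u v
    rw [dist_eq_norm, dist_eq_norm, ← smul_sub, sub_sub_sub_comm, ← map_sub, ← map_sub]
    refine le_trans ?_ (mul_le_mul_of_nonneg_right (le_max_left M 1) (norm_nonneg _))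
    set w := u - v
    -- The uniform distribution on `(0, k]`.
    let μ : Measure ℝ := (ENNReal.ofReal k)⁻¹ • volume.restrict (Ioc 0 (k : ℝ))
    have hk0 : ENNReal.ofReal k ≠ 0 := (ENNReal.ofReal_pos.2 hk.1).ne'
    have : IsProbabilityMeasure μ := by
      constructor
      rw [Measure.smul_apply, Measure.restrict_apply_univ, Real.volume_Ioc, sub_zero, smul_eq_mul,
        ENNReal.inv_mul_cancel hk0 ENNReal.ofReal_ne_top]
    have hm (t : ℝ) : Measurable fun h : ℝ => ‖w (t - h)‖ₑ :=
      ((Lp.stronglyMeasurable w).comp_measurable (measurable_const.sub measurable_id)).enorm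
    have hle : ∀ᵐ t, ‖(((k : ℝ) : 𝕜)⁻¹ • (V.evolutionSemigroup p k (hV.green hp w) -
        hV.green hp w) : Lp X p (volume : Measure ℝ)) t‖ₑ ≤
          ENNReal.ofReal M * ∫⁻ h, ‖w (t - h)‖ₑ ∂μ := by
      filter_upwards [hV.quotient_green hp k w] with t ht
      rw [ht, enorm_neg, enorm_smul, lintegral_smul_measure, smul_eq_mul, mul_left_comm,
        ← lintegral_const_mul _ (hm t)]
      have h1 : ‖(k : ℝ)⁻¹‖ₑ = (ENNReal.ofReal k)⁻¹ := by
        rw [← ENNReal.ofReal_inv_of_pos hk.1, ← ofReal_norm,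
          Real.norm_of_nonneg (inv_nonneg.2 hk.1.le)]
      rw [h1]
      gcongr
      refine (enorm_integral_le_lintegral_enorm _).trans (lintegral_mono fun h => ?_)
      rw [← ofReal_norm, ← ofReal_norm, ← ENNReal.ofReal_mul hM]
      refine ENNReal.ofReal_le_ofReal (((V.extend t (t - h)).le_opNorm _).trans ?_)
      gcongr
      exact hV.norm_le _ _
    have h2 := eLpNorm_le_of_translate_average Fact.out hp (Lp.stronglyMeasurable w) hle
    have h3 := ENNReal.toReal_mono
      (ENNReal.mul_ne_top ENNReal.ofReal_ne_top (Lp.eLpNorm_ne_top w)) h2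
    rwa [ENNReal.toReal_mul, ENNReal.toReal_ofReal hM] at h3
  · intro u v
    rw [dist_neg_neg]
    exact le_mul_of_one_le_left dist_nonneg (le_max_right _ _)
  · rintro u ⟨g, hgc, hgs, hug⟩
    obtain ⟨R, C, hC, hR⟩ := hgs.exists_interval_bound hgc
    have hcont (t : ℝ) : Continuous fun h => V.extend t (t - h) (g (t - h)) :=
      V.continuous_extend_comp continuous_const (by fun_prop) (hgc.comp (by fun_prop))
    refine Lp.tendsto_of_dominated hp
      (F := fun (k : ℝ≥0) t => -((k : ℝ)⁻¹ • ∫ h in Ioc 0 (k : ℝ), V.extend t (t - h) (g (t - h))))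
      (f := fun t => -g t) (b := (Icc (-R) R).indicator fun _ => M * C + C)
      (Eventually.of_forall fun k => ?_) ?_ (memLp_indicator_Icc_const _ _) ?_ ?_
    · filter_upwards [hV.quotient_green hp k u] with t h1
      rw [h1]
      congr 2
      refine integral_congr_ae ?_
      filter_upwards [ae_reflect t hug (Ioc 0 (k : ℝ))] with s hs
      rw [hs]
    · filter_upwards [Lp.coeFn_neg u, hug] with t h1 h2
      rw [h1, Pi.neg_apply, h2]
    · filter_upwards [hsmall] with k hk
      refine Eventually.of_forall fun t => ?_
      set c := (Icc (-R) R).indicator (fun _ => C) t with hc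
      have h1 : ‖∫ h in Ioc 0 (k : ℝ), V.extend t (t - h) (g (t - h))‖ ≤ M * c * k := by
        have := norm_setIntegral_le_of_norm_le_const (μ := (volume : Measure ℝ))
          (s := Ioc 0 (k : ℝ)) (C := M * c) (f := fun h => V.extend t (t - h) (g (t - h)))
          (by simp) (fun h hh => ?_)
        · simpa [measureReal_def] using this
        · refine ((V.extend t (t - h)).le_opNorm _).trans ?_
          gcongr
          · exact hV.norm_le _ _
          · exact hR t h hh.1.le (hh.2.trans hk.2)
      have h2 : ‖g t‖ ≤ c := by simpa using hR t 0 le_rfl zero_le_one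
      have h3 : ‖-((k : ℝ)⁻¹ • ∫ h in Ioc 0 (k : ℝ), V.extend t (t - h) (g (t - h)))‖ ≤ M * c := by
        rw [norm_neg, norm_smul, Real.norm_of_nonneg (inv_nonneg.2 hk.1.le)]
        calc (k : ℝ)⁻¹ * ‖∫ h in Ioc 0 (k : ℝ), V.extend t (t - h) (g (t - h))‖
            ≤ (k : ℝ)⁻¹ * (M * c * k) := by gcongr
          _ = M * c := by
            have := hk.1.ne'
            field_simp
      have h4 : ‖-g t‖ ≤ c := by rwa [norm_neg]
      refine (norm_sub_le _ _).trans ((add_le_add h3 h4).trans (le_of_eq ?_))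
      by_cases ht : t ∈ Icc (-R) R
      · simp [hc, indicator_of_mem ht]
      · simp [hc, indicator_of_notMem ht]
    · refine Eventually.of_forall fun t => ?_
      have hΨ : Continuous (Function.uncurry fun s _ : ℝ => V.extend t s (g s)) :=
        V.continuous_extend_comp continuous_const continuous_fst (hgc.comp continuous_fst)
      have h1 := ((tendsto_average_interval hΨ t).comp NNReal.tendsto_coe_nhdsGT_zero).neg
      simp only [V.extend_of_le le_rfl, V.self_eq_id, ContinuousLinearMap.id_apply] at h1
      refine h1.congr fun k => ?_
      simp only [Function.comp_apply]
      rw [← intervalIntegral.integral_of_le k.coe_nonneg,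
        intervalIntegral.integral_comp_sub_left (fun s => V.extend t s (g s)) t, sub_zero]

/-- The generator of an exponentially stable evolution semigroup is invertible, with inverse minus
the Green operator. -/
theorem IsStable.mem_G_graph_iff (hV : V.IsStable M κ) (hp : p ≠ ∞)
    (u f : Lp X p (volume : Measure ℝ)) :
    (u, f) ∈ (V.G p).graph ↔ u = -hV.green hp f := by
  rw [G, mem_generator_graph_iff]
  constructor
  · intro h
    -- Since `J` commutes with the semigroup, the quotients at `J u` converge to `J f` as well as
    -- to `-u`.
    have h1 := ((hV.green hp).continuous.tendsto f).comp h
    have h2 := hV.tendsto_quotient_green hp u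
    have h3 : Tendsto (fun k : ℝ≥0 => ((k : ℝ) : 𝕜)⁻¹ •
        (V.evolutionSemigroup p k (hV.green hp u) - hV.green hp u)) (𝓝[>] 0)
          (𝓝 (hV.green hp f)) := by
      refine h1.congr fun k => ?_
      simp only [Function.comp_apply, map_smul, map_sub, hV.green_comm]
    rw [← tendsto_nhds_unique h2 h3, neg_neg]
  · rintro rfl
    have h := (hV.tendsto_quotient_green hp f).neg
    rw [neg_neg] at h
    refine h.congr fun k => ?_
    rw [map_neg, ← smul_neg]
    congr 1
    abel

end EvolutionFamily

/-! ### Strong integrals of compact operators -/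

section StrongIntegral

theorem Metric.totallyBounded_of_approx {X : Type*} [PseudoMetricSpace X] {S : Set X}
    (h : ∀ ε > 0, ∃ K : Set X, TotallyBounded K ∧ ∀ x ∈ S, ∃ y ∈ K, dist x y ≤ ε) :
    TotallyBounded S := by
  refine Metric.totallyBounded_iff.2 fun ε hε => ?_
  obtain ⟨K, hK, hS⟩ := h (ε / 2) (by positivity)
  obtain ⟨t, ht, hKt⟩ := Metric.totallyBounded_iff.1 hK (ε / 2) (by positivity)
  refine ⟨t, ht, fun x hx => ?_⟩
  obtain ⟨y, hy, hxy⟩ := hS x hx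
  obtain ⟨z, hz, hyz⟩ := mem_iUnion₂.1 (hKt hy)
  refine mem_iUnion₂.2 ⟨z, hz, ?_⟩
  have := dist_triangle x y z
  rw [Metric.mem_ball] at hyz ⊢
  linarith

theorem TotallyBounded.exists_index_bound {X : Type*} [PseudoMetricSpace X] {x : ℕ → X}
    (h : TotallyBounded (range x)) {ε : ℝ} (hε : 0 < ε) :
    ∃ N, ∀ k, ∃ j < N, dist (x k) (x j) < ε := by
  obtain ⟨t, htx, htf, hcov⟩ := Metric.finite_approx_of_totallyBounded h ε hε
  choose! i hi using fun y (hy : y ∈ t) => htx hy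
  obtain ⟨N, hN⟩ := (htf.image i).bddAbove
  refine ⟨N + 1, fun k => ?_⟩
  obtain ⟨y, hy, hky⟩ := mem_iUnion₂.1 (hcov (mem_range_self k))
  refine ⟨i y, Nat.lt_succ_of_le (hN (mem_image_of_mem i hy)), ?_⟩
  rw [hi y hy]
  exact hky

/-- A set is totally bounded as soon as its sequences are. -/
theorem Metric.totallyBounded_of_seq {X : Type*} [PseudoMetricSpace X] {S : Set X}
    (h : ∀ x : ℕ → X, (∀ n, x n ∈ S) → TotallyBounded (range x)) : TotallyBounded S := by
  refine Metric.totallyBounded_iff.2 fun ε hε => ?_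
  by_contra! hne
  obtain ⟨x, hx⟩ := seq_of_forall_finite_exists (P := fun y t => y ∈ S ∧ ∀ z ∈ t, ε ≤ dist y z)
    fun t ht => by
      obtain ⟨y, hy, hyt⟩ := not_subset.1 (hne t ht)
      refine ⟨y, hy, fun z hz => ?_⟩
      by_contra! hlt
      exact hyt (mem_iUnion₂.2 ⟨z, hz, hlt⟩)
  obtain ⟨N, hN⟩ := (h x fun n => (hx n).1).exists_index_bound hε
  obtain ⟨j, hj, hlt⟩ := hN N
  exact hlt.not_ge ((hx N).2 _ (mem_image_of_mem x hj))

theorem TotallyBounded.exists_add {X : Type*} [NormedAddCommGroup X] {S T : Set X}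
    (hS : TotallyBounded S) (hT : TotallyBounded T) :
    TotallyBounded {y | ∃ a ∈ S, ∃ b ∈ T, y = a + b} := by
  refine Metric.totallyBounded_iff.2 fun ε hε => ?_
  obtain ⟨s, hs, hSs⟩ := Metric.totallyBounded_iff.1 hS (ε / 2) (by positivity)
  obtain ⟨t, ht, hTt⟩ := Metric.totallyBounded_iff.1 hT (ε / 2) (by positivity)
  refine ⟨_, hs.image2 (· + ·) ht, ?_⟩
  rintro y ⟨a, ha, b, hb, rfl⟩
  obtain ⟨a', ha', haa⟩ := mem_iUnion₂.1 (hSs ha)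
  obtain ⟨b', hb', hbb⟩ := mem_iUnion₂.1 (hTt hb)
  refine mem_iUnion₂.2 ⟨a' + b', mem_image2_of_mem ha' hb', ?_⟩
  rw [Metric.mem_ball] at haa hbb ⊢
  linarith [dist_add_add_le a b a' b']

/-- The set of sums of `N` vectors from given totally bounded sets is totally bounded. -/
theorem totallyBounded_sum {X : Type*} [NormedAddCommGroup X] {S : ℕ → Set X}
    (hS : ∀ j, TotallyBounded (S j)) (N : ℕ) :
    TotallyBounded {y | ∃ z : ℕ → X, (∀ j, z j ∈ S j) ∧ y = ∑ j ∈ Finset.range N, z j} := by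
  induction N with
  | zero =>
    refine (finite_singleton (0 : X)).totallyBounded.subset ?_
    rintro y ⟨z, -, rfl⟩
    simp
  | succ N ih =>
    refine (ih.exists_add (hS N)).subset ?_
    rintro y ⟨z, hz, rfl⟩
    exact ⟨_, ⟨z, hz, rfl⟩, z N, hz N, Finset.sum_range_succ _ _⟩

variable {α : Type*} {m : MeasurableSpace α} {μ : Measure α}

/-- The integrals of a fixed integrable function over all measurable sets form a totally bounded
set: for a multiple of an indicator they lie on a segment, and the property passes to sums and
limits. -/
theorem totallyBounded_setIntegral {X : Type*} [NormedAddCommGroup X] [NormedSpace ℝ X]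
    [CompleteSpace X]
    {g : α → X} (hg : Integrable g μ) :
    TotallyBounded {y | ∃ F, MeasurableSet F ∧ y = ∫ s in F, g s ∂μ} := by
  refine hg.induction (P := fun g =>
    TotallyBounded {y | ∃ F, MeasurableSet F ∧ y = ∫ s in F, g s ∂μ}) ?_ ?_ ?_ ?_
  · intro c s hs hμs
    have h1 : IsCompact ((fun r : ℝ => r • c) '' Icc 0 (μ.real s)) :=
      isCompact_Icc.image (by fun_prop)
    refine h1.totallyBounded.subset ?_
    rintro y ⟨F, hF, rfl⟩
    refine ⟨μ.real (s ∩ F), ⟨measureReal_nonneg, measureReal_mono inter_subset_left hμs.ne⟩, ?_⟩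
    simp only
    rw [integral_indicator_const _ hs, measureReal_restrict_apply hs]
  · intro f g _ hf hg hPf hPg
    refine (hPf.exists_add hPg).subset ?_
    rintro y ⟨F, hF, rfl⟩
    exact ⟨_, ⟨F, hF, rfl⟩, _, ⟨F, hF, rfl⟩, integral_add hf.integrableOn hg.integrableOn⟩
  · refine isClosed_of_closure_subset fun f hf => Metric.totallyBounded_of_approx fun ε hε => ?_
    obtain ⟨g, hg, hfg⟩ := Metric.mem_closure_iff.1 hf ε hε
    refine ⟨_, hg, ?_⟩
    rintro y ⟨F, hF, rfl⟩
    refine ⟨_, ⟨F, hF, rfl⟩, ?_⟩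
    have hf1 := L1.integrable_coeFn f
    have hg1 := L1.integrable_coeFn g
    rw [dist_eq_norm, ← integral_sub hf1.integrableOn hg1.integrableOn]
    refine (norm_integral_le_integral_norm _).trans ?_
    refine (setIntegral_le_integral (hf1.sub hg1).norm
      (Eventually.of_forall fun _ => norm_nonneg _)).trans ?_
    rw [L1.dist_eq_integral_dist] at hfg
    simpa [dist_eq_norm] using hfg.le
  · intro f g hfg _ hf
    refine hf.subset ?_
    rintro y ⟨F, hF, rfl⟩
    exact ⟨F, hF, integral_congr_ae (ae_restrict_of_ae hfg.symm)⟩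

/-- The integrals of a uniformly bounded, pointwise totally bounded sequence of functions form a
totally bounded set.
A set of large measure is cut, for each `k`, into finitely many measurable pieces on which `g k` is
close to one of finitely many members of the sequence. -/
theorem totallyBounded_range_integral {X : Type*} [NormedAddCommGroup X] [NormedSpace ℝ X]
    [CompleteSpace X] [IsFiniteMeasure μ] {g : ℕ → α → X} (hm : ∀ k, StronglyMeasurable (g k))
    {C : ℝ} (hC : ∀ k s, ‖g k s‖ ≤ C) (hg : ∀ s, TotallyBounded (range fun k => g k s)) :
    TotallyBounded (range fun k => ∫ s, g k s ∂μ) := by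
  classical
  refine Metric.totallyBounded_of_approx fun ε hε => ?_
  have hint k : Integrable (g k) μ :=
    Integrable.of_bound (hm k).aestronglyMeasurable C (Eventually.of_forall (hC k))
  by_cases hne : Nonempty α
  swap
  · refine ⟨{0}, (finite_singleton _).totallyBounded, ?_⟩
    rintro y ⟨k, rfl⟩
    rw [not_nonempty_iff] at hne
    refine ⟨0, rfl, ?_⟩
    simpa [μ.eq_zero_of_isEmpty] using hε.le
  have hC0 : 0 ≤ C := (norm_nonneg _).trans (hC 0 hne.some)
  obtain ⟨η, hη, hηε⟩ : ∃ η > 0, η * μ.real univ ≤ ε / 2 := by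
    refine ⟨ε / 2 / (μ.real univ + 1), by positivity, ?_⟩
    rw [div_mul_eq_mul_div, div_le_iff₀ (by positivity)]
    nlinarith [measureReal_nonneg (μ := μ) (s := univ)]
  let D (k j : ℕ) : Set α := {s | ‖g k s - g j s‖ < η}
  have hD k j : MeasurableSet (D k j) :=
    ((hm k).sub (hm j)).norm.measurable measurableSet_Iio
  -- The points at which `N` members of the sequence form an `η`-net for all of it.
  let E (N : ℕ) : Set α := ⋂ k, ⋃ j ∈ Finset.range N, D k j
  have hE N : MeasurableSet (E N) :=
    MeasurableSet.iInter fun k => Finset.measurableSet_biUnion _ fun j _ => hD k j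
  have hEmono : Monotone E := fun N N' h => iInter_mono fun k =>
    biUnion_subset_biUnion_left (by simpa using h)
  have hEuniv : ⋃ N, E N = univ := by
    refine eq_univ_of_forall fun s => ?_
    obtain ⟨N, hN⟩ := (hg s).exists_index_bound hη
    refine mem_iUnion.2 ⟨N, mem_iInter.2 fun k => ?_⟩
    obtain ⟨j, hj, hlt⟩ := hN k
    exact mem_iUnion₂.2 ⟨j, Finset.mem_range.2 hj, by rwa [dist_eq_norm] at hlt⟩
  have hlim : Tendsto (fun N => μ.real (E N)ᶜ) atTop (𝓝 0) := by
    have h1 := tendsto_measure_iInter_atTop (μ := μ) (s := fun N => (E N)ᶜ)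
      (fun N => (hE N).compl.nullMeasurableSet)
      (fun N N' h => compl_subset_compl.2 (hEmono h)) ⟨0, measure_ne_top _ _⟩
    rw [← compl_iUnion, hEuniv, compl_univ, measure_empty] at h1
    exact (ENNReal.tendsto_toReal ENNReal.zero_ne_top).comp h1
  obtain ⟨N, hN⟩ : ∃ N, C * μ.real (E N)ᶜ ≤ ε / 2 := by
    have h1 := hlim.const_mul C
    rw [mul_zero] at h1
    exact (h1.eventually_le_const (by positivity : (0 : ℝ) < ε / 2)).exists
  refine ⟨_, totallyBounded_sum (fun j => totallyBounded_setIntegral (hint j)) N, ?_⟩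
  rintro y ⟨k, rfl⟩
  -- On `F j` the index `j` is the first one with `g j` within `η` of `g k`.
  let F : ℕ → Set α := disjointed (D k)
  have hF j : MeasurableSet (F j) := MeasurableSet.disjointed (hD k) j
  refine ⟨∑ j ∈ Finset.range N, ∫ s in F j, g j s ∂μ, ⟨_, fun j => ⟨F j, hF j, rfl⟩, rfl⟩, ?_⟩
  have hint' j : Integrable ((F j).indicator (g j)) μ := (hint j).indicator (hF j)
  have hφ : Integrable (fun s => ∑ j ∈ Finset.range N, (F j).indicator (g j) s) μ :=
    integrable_finsetSum _ fun j _ => hint' j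
  simp only [← integral_indicator (hF _)]
  rw [← integral_finsetSum _ fun j _ => hint' j, dist_eq_norm, ← integral_sub (hint k) hφ]
  have hpt s : ‖g k s - ∑ j ∈ Finset.range N, (F j).indicator (g j) s‖ ≤
      η + (E N)ᶜ.indicator (fun _ => C) s := by
    by_cases hs : ∃ j ∈ Finset.range N, s ∈ F j
    · obtain ⟨j, hj, hsj⟩ := hs
      rw [Finset.sum_eq_single_of_mem j hj fun i _ hij => indicator_of_notMem (fun hi =>
        disjoint_left.1 (disjoint_disjointed (D k) hij) hi hsj) _, indicator_of_mem hsj]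
      have h1 : ‖g k s - g j s‖ < η := disjointed_subset (D k) j hsj
      exact h1.le.trans (le_add_of_nonneg_right (indicator_nonneg (fun _ _ => hC0) s))
    · push Not at hs
      rw [Finset.sum_eq_zero fun j hj => indicator_of_notMem (hs j hj) _, sub_zero]
      have hsE : s ∈ (E N)ᶜ := by
        intro h
        obtain ⟨j, hj, hsj⟩ := mem_iUnion₂.1 (mem_iInter.1 h k)
        have h1 : ∃ i, s ∈ D k i := ⟨j, hsj⟩
        refine hs (Nat.find h1) (Finset.mem_range.2
          ((Nat.find_min' h1 hsj).trans_lt (Finset.mem_range.1 hj))) ?_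
        change s ∈ disjointed (D k) _
        rw [disjointed_eq_inter_compl]
        exact ⟨Nat.find_spec h1, mem_iInter₂.2 fun i hi => Nat.find_min h1 hi⟩
      rw [indicator_of_mem hsE]
      linarith [hC k s]
  have hi2 : Integrable (fun s => η + (E N)ᶜ.indicator (fun _ => C) s) μ :=
    (integrable_const η).add ((integrable_const C).indicator (hE N).compl)
  refine (norm_integral_le_of_norm_le hi2 (Eventually.of_forall hpt)).trans ?_
  rw [integral_add (integrable_const η) ((integrable_const C).indicator (hE N).compl),
    integral_const, integral_indicator_const _ (hE N).compl, smul_eq_mul, smul_eq_mul]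
  linarith

/-- A strong integral of uniformly bounded compact operators over a finite measure space is
compact. -/
theorem IsCompactOperator.of_strong_integral {𝕜 E X : Type*} [RCLike 𝕜] [NormedAddCommGroup E]
    [NormedSpace 𝕜 E] [NormedAddCommGroup X] [NormedSpace 𝕜 X] [NormedSpace ℝ X] [CompleteSpace X]
    [IsFiniteMeasure μ] {T : α → E →L[𝕜] X} (hT : ∀ s, IsCompactOperator (T s))
    (hm : ∀ f, StronglyMeasurable fun s => T s f) {C : ℝ} (hC : ∀ s, ‖T s‖ ≤ C)
    {R : E →L[𝕜] X} (hR : ∀ f, R f = ∫ s, T s f ∂μ) : IsCompactOperator R := by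
  refine (isCompactOperator_iff_isCompact_closure_image_ball (R : E →ₗ[𝕜] X) one_pos).2 ?_
  refine (Metric.totallyBounded_of_seq fun y hy => ?_).closure.isCompact_of_isClosed
    isClosed_closure
  choose f hf hfy using hy
  have h1 := totallyBounded_range_integral (μ := μ) (g := fun k s => T s (f k)) (C := C)
    (fun k => hm (f k)) (fun k s => ?_) (fun s => ?_)
  · convert h1 using 3 with k
    rw [← hfy k]
    exact hR (f k)
  · refine ((T s).le_opNorm _).trans ?_
    have h2 : ‖f k‖ ≤ 1 := (mem_ball_zero_iff.1 (hf k)).le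
    have h3 := hC s
    have := norm_nonneg (T s)
    nlinarith [norm_nonneg (f k)]
  · have h2 := (hT s).isCompact_closure_image_ball (f := (T s : E →ₗ[𝕜] X)) 1
    refine h2.totallyBounded.subset ?_
    rintro _ ⟨k, rfl⟩
    exact subset_closure ⟨f k, hf k, rfl⟩

end StrongIntegral

/-! ### Compactness between two Green operators -/

theorem memLp_indicator_Ioi_exp {p : ℝ≥0∞} (hp0 : p ≠ 0) (hp : p ≠ ∞) {κ : ℝ} (hκ : 0 < κ)
    (a b C : ℝ) :
    MemLp ((Ioi a).indicator fun t => C * Real.exp (-κ * (t - b))) p (volume : Measure ℝ) := by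
  rw [memLp_indicator_iff_restrict measurableSet_Ioi]
  have hq : 0 < p.toReal := ENNReal.toReal_pos hp0 hp
  have hm : Continuous fun t : ℝ => C * Real.exp (-κ * (t - b)) := by fun_prop
  rw [← integrable_norm_rpow_iff hm.aestronglyMeasurable hp0 hp]
  have h1 := (exp_neg_integrableOn_Ioi a (mul_pos hκ hq)).const_mul
    (|C| ^ p.toReal * Real.exp (κ * b * p.toReal))
  refine h1.congr (Eventually.of_forall fun t => ?_)
  simp only
  rw [norm_mul, Real.norm_eq_abs, Real.norm_of_nonneg (Real.exp_nonneg _),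
    Real.mul_rpow (abs_nonneg _) (Real.exp_nonneg _), ← Real.exp_mul, mul_assoc, ← Real.exp_add]
  congr 2
  ring

/-- Integration over a set of finite measure, as a bounded operator on `L_p`. -/
noncomputable def MeasureTheory.Lp.setIntegralCLM {α X : Type*} {m : MeasurableSpace α}
    [NormedAddCommGroup X] [NormedSpace ℝ X] (p : ℝ≥0∞) [Fact (1 ≤ p)] (μ : Measure α)
    (A : Set α) (hA : μ A < ∞) : Lp X p μ →L[ℝ] X :=
  have hint (u : Lp X p μ) : IntegrableOn u A μ :=
    have : IsFiniteMeasure (μ.restrict A) := ⟨by simpa using hA⟩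
    ((Lp.memLp u).restrict A).integrable Fact.out
  LinearMap.mkContinuous
    { toFun := fun u => ∫ t in A, u t ∂μ
      map_add' := fun u v => by
        rw [← integral_add (hint u) (hint v)]
        exact integral_congr_ae (ae_restrict_of_ae (Lp.coeFn_add u v))
      map_smul' := fun c u => by
        rw [RingHom.id_apply, ← integral_smul]
        exact integral_congr_ae (ae_restrict_of_ae (Lp.coeFn_smul c u)) }
    (μ A ^ (1 / (1 : ℝ≥0∞).toReal - 1 / p.toReal)).toReal fun u => by
      change ‖∫ t in A, u t ∂μ‖ ≤ _
      have hfin : μ A ^ (1 / (1 : ℝ≥0∞).toReal - 1 / p.toReal) ≠ ∞ := by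
        refine ENNReal.rpow_ne_top_of_nonneg ?_ hA.ne
        rw [ENNReal.toReal_one, div_one, sub_nonneg, one_div]
        by_cases hp : p = ∞
        · simp [hp]
        · exact inv_le_one_of_one_le₀ (ENNReal.toReal_one ▸ ENNReal.toReal_mono hp Fact.out)
      have h1 : ‖∫ t in A, u t ∂μ‖ₑ ≤
          μ A ^ (1 / (1 : ℝ≥0∞).toReal - 1 / p.toReal) * eLpNorm u p μ := by
        refine (enorm_integral_le_lintegral_enorm _).trans ?_
        rw [← eLpNorm_one_eq_lintegral_enorm]
        refine (eLpNorm_le_eLpNorm_mul_rpow_measure_univ (p := 1) (q := p) Fact.out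
          (Lp.aestronglyMeasurable u).restrict).trans ?_
        rw [Measure.restrict_apply_univ, mul_comm]
        gcongr
        exact Measure.restrict_le_self
      have h2 := ENNReal.toReal_mono (ENNReal.mul_ne_top hfin (Lp.eLpNorm_ne_top u)) h1
      rwa [ENNReal.toReal_mul, toReal_enorm] at h2

namespace EvolutionFamily

variable {𝕜 : Type*} {X : Type*} [RCLike 𝕜] [NormedAddCommGroup X] [NormedSpace 𝕜 X]
  {V : EvolutionFamily 𝕜 X} {M κ : ℝ} {p : ℝ≥0∞}

/-- The trajectory started at time `s` from `x`, extended by zero to the past. -/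
noncomputable def trajectory (V : EvolutionFamily 𝕜 X) (s : ℝ) (x : X) : ℝ → X :=
  (Ioi s).indicator fun t => V.extend t s x

theorem stronglyMeasurable_trajectory (V : EvolutionFamily 𝕜 X) {g : ℝ → X}
    (hg : StronglyMeasurable g) :
    StronglyMeasurable fun z : ℝ × ℝ => V.trajectory z.2 (g z.2) z.1 := by
  have h1 : StronglyMeasurable fun z : ℝ × ℝ => V.extend z.1 z.2 (g z.2) :=
    V.continuous_extend.comp_stronglyMeasurable ((hg.comp_measurable measurable_snd).prodMk
      (measurable_fst.stronglyMeasurable.prodMk measurable_snd.stronglyMeasurable))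
  exact h1.indicator (measurableSet_lt measurable_snd measurable_fst)

theorem IsStable.norm_trajectory_le (hV : V.IsStable M κ) {s a b : ℝ} (ha : a ≤ s) (hb : s ≤ b)
    (x : X) (t : ℝ) :
    ‖V.trajectory s x t‖ ≤ (Ioi a).indicator (fun t => M * ‖x‖ * Real.exp (-κ * (t - b))) t := by
  have hM := hV.nonneg
  by_cases ht : t ∈ Ioi s
  · rw [trajectory, indicator_of_mem ht, indicator_of_mem (mem_Ioi.2 (ha.trans_lt ht)),
      V.extend_of_le (mem_Ioi.1 ht).le]
    refine ((V t s).le_opNorm x).trans ?_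
    rw [mul_right_comm]
    gcongr
    refine (hV.bound t s (mem_Ioi.1 ht).le).trans ?_
    gcongr M * Real.exp ?_
    nlinarith [hV.pos]
  · rw [trajectory, indicator_of_notMem ht, norm_zero]
    exact indicator_nonneg (fun _ _ => by positivity) _

theorem IsStable.norm_trajectory_le_const (hV : V.IsStable M κ) (s : ℝ) (x : X) (t : ℝ) :
    ‖V.trajectory s x t‖ ≤ M * ‖x‖ := by
  refine (norm_indicator_le_norm_self _ _).trans (((V.extend t s).le_opNorm x).trans ?_)
  gcongr
  exact hV.norm_le t s

theorem IsStable.memLp_trajectory (hV : V.IsStable M κ) (hp0 : p ≠ 0) (hp : p ≠ ∞) (s : ℝ) (x : X) :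
    MemLp (V.trajectory s x) p volume := by
  refine (memLp_indicator_Ioi_exp hp0 hp hV.pos s s (M * ‖x‖)).mono' ?_
    (Eventually.of_forall (hV.norm_trajectory_le le_rfl le_rfl x))
  exact ((V.stronglyMeasurable_trajectory (g := fun _ => x)
    stronglyMeasurable_const).comp_measurable (measurable_id.prodMk measurable_const)).aestronglyMeasurable

theorem IsStable.norm_toLp_trajectory_le (hV : V.IsStable M κ) (hp0 : p ≠ 0) (hp : p ≠ ∞) (s : ℝ)
    (x : X) : ‖(hV.memLp_trajectory hp0 hp s x).toLp _‖ ≤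
      (eLpNorm ((Ioi 0).indicator fun t => M * Real.exp (-κ * (t - 0))) p volume).toReal * ‖x‖ := by
  have h0 := memLp_indicator_Ioi_exp hp0 hp hV.pos 0 0 M
  have h1 : eLpNorm (V.trajectory s x) p volume ≤
      ‖‖x‖‖ₑ * eLpNorm ((Ioi 0).indicator fun t => M * Real.exp (-κ * (t - 0))) p volume := by
    rw [← eLpNorm_comp_measurePreserving h0.aestronglyMeasurable
      (measurePreserving_sub_right volume s), ← eLpNorm_const_smul]
    refine eLpNorm_mono_real fun t => (hV.norm_trajectory_le le_rfl le_rfl x t).trans (le_of_eq ?_)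
    by_cases ht : s < t
    · simp [indicator, ht]
      ring
    · simp [indicator, ht]
  rw [Lp.norm_toLp]
  have h2 := ENNReal.toReal_mono (ENNReal.mul_ne_top enorm_ne_top h0.2.ne) h1
  rwa [ENNReal.toReal_mul, toReal_enorm, norm_norm, mul_comm] at h2

variable [Fact (1 ≤ p)]

/-- The operator sending `x` to the trajectory started at time `s` from `x`. -/
noncomputable def IsStable.launch (hV : V.IsStable M κ) (hp : p ≠ ∞) (s : ℝ) :
    X →L[𝕜] Lp X p (volume : Measure ℝ) :=
  have hp0 : p ≠ 0 := (zero_lt_one.trans_le (Fact.out : 1 ≤ p)).ne'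
  LinearMap.mkContinuous
    { toFun := fun x => (hV.memLp_trajectory hp0 hp s x).toLp _
      map_add' := fun x y => by
        rw [← MemLp.toLp_add, MemLp.toLp_eq_toLp_iff]
        refine Eventually.of_forall fun t => ?_
        by_cases ht : t ∈ Ioi s <;> simp [trajectory, indicator, ht]
      map_smul' := fun c x => by
        rw [RingHom.id_apply, ← MemLp.toLp_const_smul, MemLp.toLp_eq_toLp_iff]
        refine Eventually.of_forall fun t => ?_
        by_cases ht : t ∈ Ioi s <;> simp [trajectory, indicator, ht] }
    _ (hV.norm_toLp_trajectory_le hp0 hp s)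

theorem IsStable.coeFn_launch (hV : V.IsStable M κ) (hp : p ≠ ∞) (s : ℝ) (x : X) :
    (hV.launch hp s x : Lp X p (volume : Measure ℝ)) =ᵐ[volume] V.trajectory s x :=
  (hV.memLp_trajectory (zero_lt_one.trans_le (Fact.out : 1 ≤ p)).ne' hp s x).coeFn_toLp

theorem IsStable.exists_norm_launch_le (hV : V.IsStable M κ) (hp : p ≠ ∞) :
    ∃ K : ℝ≥0, ∀ s, ‖(hV.launch hp s : X →L[𝕜] Lp X p (volume : Measure ℝ))‖ ≤ K :=
  ⟨⟨_, ENNReal.toReal_nonneg⟩, fun s => ContinuousLinearMap.opNorm_le_bound _ ENNReal.toReal_nonneg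
    (hV.norm_toLp_trajectory_le (zero_lt_one.trans_le (Fact.out : 1 ≤ p)).ne' hp s)⟩

theorem IsStable.continuous_launch_apply (hV : V.IsStable M κ) (hp : p ≠ ∞) (x : X) :
    Continuous fun s => (hV.launch hp s x : Lp X p (volume : Measure ℝ)) := by
  have hp0 : p ≠ 0 := (zero_lt_one.trans_le (Fact.out : 1 ≤ p)).ne'
  have hM := hV.nonneg
  refine continuous_iff_continuousAt.2 fun s₀ => ?_
  have hb := memLp_indicator_Ioi_exp hp0 hp hV.pos (s₀ - 1) (s₀ + 1) (M * ‖x‖)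
  refine Lp.tendsto_of_dominated hp (Eventually.of_forall fun s => hV.coeFn_launch hp s x)
    (hV.coeFn_launch hp s₀ x) (hb.add hb) ?_ ?_
  · filter_upwards [Icc_mem_nhds (by linarith : s₀ - 1 < s₀) (by linarith : s₀ < s₀ + 1)] with s hs
    refine Eventually.of_forall fun t => (norm_sub_le _ _).trans (add_le_add ?_ ?_)
    · exact hV.norm_trajectory_le hs.1 hs.2 x t
    · exact hV.norm_trajectory_le (by linarith) (by linarith) x t
  -- The trajectory jumps at its starting time, so convergence fails only at `t = s₀`.
  · filter_upwards [compl_mem_ae_iff.2 (measure_singleton (μ := volume) s₀)] with t ht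
    rcases lt_or_gt_of_ne (show t ≠ s₀ from ht) with h | h
    · refine tendsto_const_nhds.congr' ?_
      filter_upwards [Ioi_mem_nhds h] with s hs
      rw [trajectory, trajectory, indicator_of_notMem (by simpa using h.le),
        indicator_of_notMem (by simpa using (mem_Ioi.1 hs).le)]
    · have hc : Continuous fun s => V.extend t s x :=
        V.continuous_extend_comp continuous_const continuous_id continuous_const
      rw [trajectory, indicator_of_mem (mem_Ioi.2 h)]
      refine (hc.tendsto s₀).congr' ?_
      filter_upwards [Iio_mem_nhds h] with s hs
      rw [trajectory, indicator_of_mem (mem_Ioi.2 hs)]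

theorem IsStable.stronglyMeasurable_launch (hV : V.IsStable M κ) (hp : p ≠ ∞) {g : ℝ → X}
    (hg : StronglyMeasurable g) :
    StronglyMeasurable fun s => (hV.launch hp s (g s) : Lp X p (volume : Measure ℝ)) := by
  obtain ⟨K, hK⟩ := hV.exists_norm_launch_le (p := p) hp
  have hcont : Continuous fun q : X × ℝ => (hV.launch hp q.2 q.1 : Lp X p (volume : Measure ℝ)) :=
    continuous_prod_of_continuous_lipschitzWith _ K (hV.continuous_launch_apply hp)
      fun s => (hV.launch hp s).lipschitz.weaken (by exact_mod_cast hK s)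
  exact hcont.comp_stronglyMeasurable (hg.prodMk stronglyMeasurable_id)

variable [NormedSpace ℝ X]

/-- The lag integral rewritten as an integral over the starting times of trajectories. -/
theorem greenFun_indicator (V : EvolutionFamily 𝕜 X) {S : Set ℝ} (hS : MeasurableSet S)
    (g : ℝ → X) (t : ℝ) :
    V.greenFun (S.indicator g) t = ∫ s in S, V.trajectory s (g s) t := by
  rw [greenFun, ← integral_indicator measurableSet_Ioi, ← integral_indicator hS,
    ← integral_sub_left_eq_self _ volume t]
  congr 1
  ext h
  by_cases hh : h < t <;> by_cases hs : h ∈ S <;> simp [indicator, trajectory, hh, hs]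

variable [CompleteSpace X] [IsScalarTower ℝ 𝕜 X]

/-- The Green operator applied to a bounded function of bounded support is the `L_p`-valued integral
of the trajectories started from its values. -/
theorem IsStable.green_eq_integral_launch (hV : V.IsStable M κ) (hp : p ≠ ∞) {S : Set ℝ}
    (hS : MeasurableSet S) (hSfin : volume S < ∞) {g : ℝ → X} (hg : StronglyMeasurable g) {C : ℝ}
    (hC : ∀ s, ‖g s‖ ≤ C) {v : Lp X p (volume : Measure ℝ)} (hv : v =ᵐ[volume] S.indicator g) :
    hV.green hp v = ∫ s in S, (hV.launch hp s (g s) : Lp X p (volume : Measure ℝ)) := by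
  have hp0 : p ≠ 0 := (zero_lt_one.trans_le (Fact.out : 1 ≤ p)).ne'
  have hM := hV.nonneg
  have hfinS : IsFiniteMeasure (volume.restrict S) := ⟨by simpa using hSfin⟩
  obtain ⟨K, hK⟩ := hV.exists_norm_launch_le (p := p) hp
  have hint : Integrable (fun s => (hV.launch hp s (g s) : Lp X p (volume : Measure ℝ)))
      (volume.restrict S) :=
    Integrable.of_bound (hV.stronglyMeasurable_launch hp hg).aestronglyMeasurable (K * C)
      (Eventually.of_forall fun s => ((hV.launch hp s).le_opNorm _).trans
        (mul_le_mul (hK s) (hC s) (norm_nonneg _) K.2))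
  have hintOn (w : Lp X p (volume : Measure ℝ)) (A : Set ℝ) (hA : volume A < ∞) :
      IntegrableOn w A :=
    have : IsFiniteMeasure (volume.restrict A) := ⟨by simpa using hA⟩
    ((Lp.memLp w).restrict A).integrable Fact.out
  -- Elements of `L_p` are determined by their integrals over sets of finite measure, which turns
  -- the `L_p`-valued integral into a double integral.
  refine Lp.ext (Lp.ae_eq_of_forall_setIntegral_eq _ _ hp0 hp (fun A _ hA => hintOn _ A hA)
    (fun A _ hA => hintOn _ A hA) fun A hA hAfin => ?_)
  have hfinA : IsFiniteMeasure (volume.restrict A) := ⟨by simpa using hAfin⟩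
  have hL (w : Lp X p (volume : Measure ℝ)) :
      Lp.setIntegralCLM p volume A hAfin w = ∫ t in A, w t := rfl
  rw [← hL (∫ s in S, (hV.launch hp s (g s) : Lp X p (volume : Measure ℝ))),
    ← ContinuousLinearMap.integral_comp_comm _ hint]
  have h1 : ∫ t in A, hV.green hp v t = ∫ t in A, ∫ s in S, V.trajectory s (g s) t := by
    refine integral_congr_ae (ae_restrict_of_ae ?_)
    filter_upwards [hV.coeFn_green hp v] with t ht
    rw [ht, V.greenFun_congr_ae hv, V.greenFun_indicator hS]
  have h2 (s : ℝ) : Lp.setIntegralCLM p volume A hAfin (hV.launch hp s (g s)) =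
      ∫ t in A, V.trajectory s (g s) t :=
    integral_congr_ae (ae_restrict_of_ae (hV.coeFn_launch hp s (g s)))
  simp only [h1, h2]
  refine integral_integral_swap (Integrable.of_bound
    (V.stronglyMeasurable_trajectory hg).aestronglyMeasurable (M * C)
      (Eventually.of_forall fun z => (hV.norm_trajectory_le_const _ _ _).trans ?_))
  gcongr
  exact hC _

/-- The value at time `t` of the mild solution, as a bounded operator. -/
noncomputable def IsStable.greenAt (hV : V.IsStable M κ) (hp : p ≠ ∞) (t : ℝ) :
    Lp X p (volume : Measure ℝ) →L[𝕜] X :=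
  LinearMap.mkContinuous
    { toFun := fun f => V.greenFun f t
      map_add' := fun f g => by
        rw [V.greenFun_congr_ae (Lp.coeFn_add f g)]
        simp only [greenFun, Pi.add_apply, map_add]
        exact integral_add (hV.integrable_green hp f t) (hV.integrable_green hp g t)
      map_smul' := fun c f => by
        rw [RingHom.id_apply, V.greenFun_congr_ae (Lp.coeFn_smul c f)]
        simp only [greenFun, Pi.smul_apply, map_smul]
        exact integral_smul c _ }
    (M / κ * κ ^ (1 / p.toReal)) fun f => by
      rw [mul_assoc]
      exact hV.norm_greenFun_le hp f t

variable {b : ℝ → X →L[𝕜] X}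

/-- The cut-off product `J 1_S b J` is a strong integral of the compact operators
`f ↦ (the trajectory started at time s from b(s) (J f)(s))`. -/
theorem IsStable.isCompactOperator_green_indicator_green (hV : V.IsStable M κ) (hp : p ≠ ∞)
    (hb : IsMultiplier b) (hcpt : ∀ t, IsCompactOperator (b t)) {S : Set ℝ}
    (hS : MeasurableSet S) (hSfin : volume S < ∞) :
    IsCompactOperator (hV.green hp * (hb.indicator hS).op p * hV.green hp) := by
  have hfinS : IsFiniteMeasure (volume.restrict S) := ⟨by simpa using hSfin⟩
  obtain ⟨K, hK⟩ := hV.exists_norm_launch_le (p := p) hp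
  obtain ⟨C, hC⟩ := hb.bound
  have hC0 : 0 ≤ C := (norm_nonneg _).trans (hC 0)
  have hc0 : 0 ≤ M / κ * κ ^ (1 / p.toReal) :=
    mul_nonneg (div_nonneg hV.nonneg hV.pos.le) (Real.rpow_nonneg hV.pos.le _)
  have hA (t : ℝ) : ‖(hV.greenAt hp t : Lp X p (volume : Measure ℝ) →L[𝕜] X)‖ ≤
    M / κ * κ ^ (1 / p.toReal) := LinearMap.mkContinuous_norm_le _ hc0 _
  have hm (f : Lp X p (volume : Measure ℝ)) : StronglyMeasurable fun s => b s (hV.greenAt hp s f) :=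
    hb.stronglyMeasurable _ (V.stronglyMeasurable_greenFun (Lp.stronglyMeasurable f))
  refine IsCompactOperator.of_strong_integral (μ := volume.restrict S)
    (T := fun s => (hV.launch hp s).comp ((b s).comp (hV.greenAt hp s)))
    (C := K * (C * (M / κ * κ ^ (1 / p.toReal))))
    (fun s => ((hcpt s).comp_clm (hV.greenAt hp s)).clm_comp (hV.launch hp s))
    (fun f => hV.stronglyMeasurable_launch hp (hm f)) (fun s => ?_) (fun f => ?_)
  · refine (ContinuousLinearMap.opNorm_comp_le _ _).trans (mul_le_mul (hK s) ?_ (norm_nonneg _) K.2)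
    exact (ContinuousLinearMap.opNorm_comp_le _ _).trans
      (mul_le_mul (hC s) (hA s) (norm_nonneg _) hC0)
  · refine hV.green_eq_integral_launch hp hS hSfin (hm f)
      (C := C * (M / κ * κ ^ (1 / p.toReal) * ‖f‖)) (fun s => ?_) ?_
    · refine ((b s).le_opNorm _).trans (mul_le_mul (hC s) ?_ (norm_nonneg _) hC0)
      exact ((hV.greenAt hp s).le_opNorm f).trans
        (mul_le_mul_of_nonneg_right (hA s) (norm_nonneg _))
    · filter_upwards [(hb.indicator hS).coeFn_op (hV.green hp f), hV.coeFn_green hp f] with t h1 h2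
      refine h1.trans ?_
      rw [h2]
      by_cases ht : t ∈ S
      · rw [indicator_of_mem ht, indicator_of_mem ht]
        rfl
      · rw [indicator_of_notMem ht, indicator_of_notMem ht]
        rfl

/-- Multiplication by compact operators that vanish at infinity is compact between two Green
operators. -/
theorem IsStable.isCompactOperator_green_op_green (hV : V.IsStable M κ) (hp : p ≠ ∞)
    (hb : IsMultiplier b) (hcpt : ∀ t, IsCompactOperator (b t))
    (hlim : Tendsto (fun t => ‖b t‖) (cocompact ℝ) (𝓝 0)) :
    IsCompactOperator (hV.green hp * hb.op p * hV.green hp) := by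
  let S (n : ℕ) : Set ℝ := Metric.closedBall 0 n
  have hS n : MeasurableSet (S n) := measurableSet_closedBall
  have hop : Tendsto (fun n => (hb.indicator (hS n)).op p) atTop (𝓝 (hb.op p)) := by
    refine Metric.tendsto_atTop.2 fun ε hε => ?_
    have h1 := hlim.eventually_le_const (by positivity : (0 : ℝ) < ε / 2)
    rw [← Metric.cobounded_eq_cocompact] at h1
    obtain ⟨r, -, hr⟩ := (Metric.hasBasis_cobounded_compl_closedBall (0 : ℝ)).mem_iff.1 h1
    obtain ⟨N, hN⟩ := exists_nat_ge r
    refine ⟨N, fun n hn => ?_⟩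
    rw [dist_eq_norm]
    refine (ContinuousLinearMap.opNorm_le_bound _ (by positivity : 0 ≤ ε / 2) fun u =>
      Lp.norm_le_mul_norm_of_ae_le_mul ?_).trans_lt (by linarith)
    filter_upwards [(hb.indicator (hS n)).coeFn_op u, hb.coeFn_op u,
      Lp.coeFn_sub ((hb.indicator (hS n)).op p u) (hb.op p u)] with t h2 h3 h4
    rw [_root_.sub_apply, h4, Pi.sub_apply, h2, h3]
    by_cases ht : t ∈ S n
    · rw [indicator_of_mem ht, sub_self, norm_zero]
      positivity
    · rw [indicator_of_notMem ht, _root_.zero_apply, zero_sub, norm_neg]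
      refine ((b t).le_opNorm _).trans (mul_le_mul_of_nonneg_right (hr fun h => ht ?_)
        (norm_nonneg _))
      have hNn : (N : ℝ) ≤ n := by exact_mod_cast hn
      exact Metric.closedBall_subset_closedBall (hN.trans hNn) h
  refine isCompactOperator_of_tendsto ((tendsto_const_nhds.mul hop).mul tendsto_const_nhds)
    (Eventually.of_forall fun n => ?_)
  exact hV.isCompactOperator_green_indicator_green hp hb hcpt (hS n) measure_closedBall_lt_top

end EvolutionFamily

/-! ### Invariance of the index -/

theorem mainTheorem7 {𝕜 : Type*} {X : Type*} [RCLike 𝕜] [NormedAddCommGroup X]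
    [NormedSpace 𝕜 X] [NormedSpace ℝ X] [IsScalarTower ℝ 𝕜 X] [CompleteSpace X]
    (p : ℝ≥0∞) [Fact (1 ≤ p)] (hp : p ≠ ∞)
    (A : ℝ → X →ₗ.[𝕜] X) (UA : EvolutionFamily 𝕜 X) (hA : IsWellPosedWith p A UA)
    (B : ℝ → X →L[𝕜] X)
    (hB₁ : ∀ x : X, Continuous fun t => B t x)
    (hB₂ : ∃ C : ℝ, ∀ t : ℝ, ‖B t‖ ≤ C)
    (UAB : EvolutionFamily 𝕜 X)
    (hB₃ : IsWellPosedWith p (fun t => (B t : X →ₗ[𝕜] X) +ᵥ A t) UAB)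
    (hB₄ : Tendsto (fun t => ‖B t‖) (cocompact ℝ) (𝓝 0))
    (hB₅ : ∀ t : ℝ, IsCompactOperator (B t)) :
    ((UA.G p).IsFredholm ↔ (UAB.G p).IsFredholm) ∧
      ((UA.G p).IsFredholm → (UA.G p).index = (UAB.G p).index) := by
  obtain ⟨C, hC⟩ := hB₂
  have hC0 : 0 ≤ C := (norm_nonneg _).trans (hC 0)
  obtain ⟨hBc, hb⟩ := IsMultiplier.of_continuous hB₁ ⟨C, hC⟩
  obtain ⟨M, ω, hstable⟩ := UA.exists_rescale_isStable
  have hM : 0 ≤ M := (hstable (ω + 1) (by simp)).nonneg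
  -- The shift is large enough for the product of the multiplication and Green operators to have
  -- norm less than one.
  set c : ℝ := ω + (C * M + 1) with hc
  have hV : (UA.rescale c).IsStable M (c - ω) := hstable c (lt_add_of_pos_right ω (by positivity))
  have hcω : c - ω = C * M + 1 := by rw [hc, add_sub_cancel_left]
  have hGA (u f : Lp X p (volume : Measure ℝ)) : (u, f) ∈ (UA.G p).graph ↔
      u = hV.green hp (((c : 𝕜) • 1 : Lp X p (volume : Measure ℝ) →L[𝕜] _) u - f) := by
    rw [← UA.mem_G_rescale_graph c, hV.mem_G_graph_iff hp, ← map_neg, neg_sub]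
    rfl
  have hGAB (u f : Lp X p (volume : Measure ℝ)) : (u, f) ∈ (UAB.G p).graph ↔
      u = hV.green hp (((c : 𝕜) • 1 + hb.op p : Lp X p (volume : Measure ℝ) →L[𝕜] _) u - f) := by
    rw [EvolutionFamily.mem_G_graph_iff_of_duhamel hp hBc hb
      (fun τ T hτT x => hA.duhamel Fact.out hBc hB₃ hτT x), hGA, _root_.add_apply,
      sub_sub_eq_add_sub]
  have hnorm : ‖hb.op p * hV.green hp‖ < 1 := by
    refine (norm_mul_le_of_le (hb.norm_op_le hC0 hC) (hV.norm_green_le hp)).trans_lt ?_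
    rw [hcω, ← mul_div_assoc, div_lt_one (by positivity)]
    linarith
  obtain ⟨h1, h2⟩ := LinearPMap.isFredholm_iff_of_graph hGA
  obtain ⟨h3, h4⟩ := LinearPMap.isFredholm_iff_of_graph hGAB
  obtain ⟨h5, h6⟩ := ContinuousLinearMap.finiteIndex_perturb (c : 𝕜) hnorm
    (hV.isCompactOperator_green_op_green hp hb hB₅ hB₄)
  have hiff := h1.trans (h5.symm.trans h3.symm)
  refine ⟨hiff, fun hF => ?_⟩
  rw [h2 hF, h6 (h1.1 hF), h4 (hiff.1 hF)]
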